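/- **Setting.** Let $(e_1,e_2,e_3)$ be the standard basis of $\mathbb R^3$, let $A^{\top}(\phi)$ be the rotation by the angle $\phi$ about the $e_3$-axis, and let $A(\phi)=A^{\top}(-\phi)$. A surface of revolution is generated by a regular simple $C^1$ curve $\gamma(t)=(x(t),0,z(t))$, $t\in I$, on a compact interval $I$, with $x\ge 0$ (the curve may close up at its endpoints; if it touches the axis, it does so perpendicularly and at distinct points); it is the image of $\xi(\phi,t)=A^{\top}(\phi)\gamma(t)$. Let $S$ and $T$ be two such surfaces, let $I$, $x$, $\gamma$, $\xi$ belong to $S$, and put $\mathfrak h_1=x$. Let $\omega:S\to[0,\infty)$ be measurable, $g:\mathbb R\to[0,\infty)$ Lipschitz, $a:S\to\mathbb R^3$ Lipschitz, and for $m\in H^1(S,T)$ put $$\mathcal E_\omega(m)=\int_S|\nabla m|^2\,d\xi+\int_S g(m\cdot a)\,d\xi+\int_S|\langle m\rangle_{S_\xi}\times e_3|^2\,\omega^2(\xi)\,d\xi ,$$ where $\langle m\rangle_{S_\xi}$ is the average of $m$ over the circle of latitude $S_\xi$ through $\xi$. Put $\mathcal E_\omega=+\infty$ on maps that are not in $H^1$.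 A minimizer is a map $m\in H^1(S,T)$ of finite energy which minimizes $\mathcal E_\omega$ over $H^1(S,T)$. Let $W(t)=\big(\int_0^{2\pi}\omega^2(\xi(\phi,t))\,d\phi\big)^{1/2}$. Assume that $\sup_{t\in I}\mathfrak h_1(t)W(t)<\infty$ and that $\mathfrak h_1(t)W(t)>\sqrt{2\pi}$ for every $t\in I$ with $\mathfrak h_1(t)>0$. Assume also that $T$ is never flat: for every $h\in\mathbb R$, the set $T\cap\{z=h\}$ is empty or a finite union of circles centred on the axis (a point of the axis counts as a circle of radius $0$). A field $u$ on $S$ is axially symmetric if $u(A^{\top}(\phi)\xi)=A^{\top}(\phi)u(\xi)$ for all $\phi\in\mathbb R$ and $\xi\in S$; axially antisymmetric if $u(A^{\top}(\phi)\xi)=A(\phi)u(\xi)$ for all $\phi$ and $\xi$; and it has line symmetry if for each $\xi\in S$ one of these two identities holds for all $\phi$. For a class $m\in H^1(S,T)$ these properties, and the formula below, refer to a representative of $m$ that is defined on all of $S$ with values in $T$. $H^1(I)$ denotes the continuous functions on $I$ that are locally absolutely continuous in the interior of $I$, with derivative square integrable with respect to $x(t)\,dt$; this is the usual space $H^1(I)$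 if $S$ does not meet the axis. **Theorem.** (i) Let $a$ be axially symmetric. Then either every minimizer is axially symmetric, or axially symmetric minimizers coexist with minimizers that have line symmetry and are not axially symmetric. Consider the one-dimensional problem of minimizing $\mathcal F_s(\gamma)=\mathcal E_\omega(A^{\top}(\phi)\gamma(t))$ among all $\gamma\in H^1(I,T)$. It has a solution of finite energy if $S$ does not meet the axis or $T$ meets the axis; and for every solution $\gamma_s$ of finite energy, $m(\phi,t)=A^{\top}(\phi)\gamma_s(t)$ is an axially symmetric minimizer of $\mathcal E_\omega$ in $H^1(S,T)$. (ii) Let $a$ be axially antisymmetric. Then the same holds with "axially symmetric" replaced by "axially antisymmetric" and with $A^{\top}(\phi)$ replaced by $A(\phi)$ in the one-dimensional problem and in the formula for $m$. In either case, every minimizer $m\in H^1(S,T)$ of $\mathcal E_\omega$ has line symmetry and is of the form $$m(\phi,t)=\alpha_\perp(t)\cos\phi+\beta_\perp(t)\sin\phi+\eta(t)e_3$$ with $\alpha_\perp,\beta_\perp\in H^1(I,\mathbb R^2)$ and $\eta\in H^1(I,\mathbb R)$ such that $\beta_\perp(t)\cdot\alpha_\perp(t)=0$ and $|\beta_\perp(t)|=|\alpha_\perp(t)|$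 for every $t\in I$. -/

import Mathlib

open MeasureTheory Set
open scoped NNReal ENNReal

noncomputable section

namespace AxialMaps

/-- Euclidean three-space. -/
abbrev E3 : Type := EuclideanSpace ℝ (Fin 3)

/-- The rotation by the angle `φ` about the `e₃`-axis. This is `Aᵀ(φ)`; its inverse `A(φ)` is
`axialRot (-φ)`. -/
def axialRot (φ : ℝ) (v : E3) : E3 :=
  !₂[Real.cos φ * v 0 - Real.sin φ * v 1, Real.sin φ * v 0 + Real.cos φ * v 1, v 2]

/-- The vector product `v × e₃`. -/
def crossE3 (v : E3) : E3 := !₂[v 1, - v 0, 0]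

/-- The orthogonal projection onto the plane `ℝ² × {0}`. -/
def perpProj (v : E3) : E3 := !₂[v 0, v 1, 0]

/-- The data of a (compact) surface of revolution: the generating regular simple curve
`t ∈ [a, b] ↦ (x t, 0, z t)`, of class `C¹` with nonvanishing velocity and `x ≥ 0`, whose only
possible self-intersection is that the two endpoints coincide. (A `C¹` map on `[a, b]` is the
restriction of a `C¹` map on `ℝ`; the values outside of `[a, b]` play no role.) If the curve
touches the axis it does so perpendicularly, and at distinct points. -/
structure RevSurface where
  a : ℝ
  b : ℝ
  x : ℝ → ℝ
  z : ℝ → ℝ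
  lt : a < b
  contDiff_x : ContDiff ℝ 1 x
  contDiff_z : ContDiff ℝ 1 z
  regular : ∀ t ∈ Icc a b, ¬ (deriv x t = 0 ∧ deriv z t = 0)
  nonneg : ∀ t ∈ Icc a b, 0 ≤ x t
  simple : ∀ s ∈ Icc a b, ∀ t ∈ Icc a b, s < t → x s = x t → z s = z t → s = a ∧ t = b
  axis_perp : ∀ t ∈ Icc a b, x t = 0 → deriv z t = 0
  axis_ne : x a = 0 → x b = 0 → z a ≠ z b

namespace RevSurface

variable (S : RevSurface)

/-- The generating curve `γ`. -/
def curve (t : ℝ) : E3 := !₂[S.x t, 0, S.z t]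

/-- The parametrization `ξ(φ, t) = Aᵀ(φ) γ(t)`. -/
def param (φ t : ℝ) : E3 := axialRot φ (S.curve t)

/-- The surface as a subset of `ℝ³`. -/
def carrier : Set E3 := {ξ | ∃ φ : ℝ, ∃ t ∈ Icc S.a S.b, ξ = S.param φ t}

/-- The generating curve is a loop. -/
def IsLoop : Prop := S.curve S.a = S.curve S.b

/-- The metric coefficient `h₂ = |γ'|`; the other one is `h₁ = x`. -/
def speed (t : ℝ) : ℝ := Real.sqrt (deriv S.x t ^ 2 + deriv S.z t ^ 2)

/-- The area density `√g = h₁ h₂`. -/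
def areaDensity (t : ℝ) : ℝ := S.x t * S.speed t

/-- The coordinate rectangle. -/
def chart : Set (ℝ × ℝ) := Ioc 0 (2 * Real.pi) ×ˢ Icc S.a S.b

/-- The area measure `dξ` of the surface, that is, the image of `√g dφ dt` under `ξ`. -/
def area : Measure E3 :=
  Measure.map (fun p : ℝ × ℝ => S.param p.1 p.2)
    ((volume.restrict S.chart).withDensity fun p => ENNReal.ofReal (S.areaDensity p.2))

/-- Smooth test functions in the coordinates `(φ, t)`: `2π`-periodic in `φ`, and either vanishing
for `t` near the endpoints, or, if the generating curve is a loop (so that the endpoints are not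
a boundary of the surface), `(b - a)`-periodic in `t`. -/
def IsTest (ψ : ℝ × ℝ → ℝ) : Prop :=
  ContDiff ℝ ((⊤ : ℕ∞) : WithTop ℕ∞) ψ ∧
  (∀ φ t, ψ (φ + 2 * Real.pi, t) = ψ (φ, t)) ∧
  ((∃ c d, S.a < c ∧ d < S.b ∧ ∀ φ t, ψ (φ, t) ≠ 0 → t ∈ Icc c d) ∨
    (S.IsLoop ∧ ∀ φ t, ψ (φ, t + (S.b - S.a)) = ψ (φ, t)))

/-- `∫_S |∇m|² dξ` for a map with `∂_φ m = P` and `∂_t m = Q`: in the orthonormal tangent frame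
`(τ_φ / h₁, τ_t / h₂)` one has `|∇m|² = |P|² / h₁² + |Q|² / h₂²`. -/
def gradEnergy (P Q : ℝ × ℝ → E3) : ℝ≥0∞ :=
  ∫⁻ p in S.chart, ENNReal.ofReal
    ((‖P p‖ ^ 2 / S.x p.2 ^ 2 + ‖Q p‖ ^ 2 / S.speed p.2 ^ 2) * S.areaDensity p.2)

/-- `P` and `Q` are the weak derivatives `∂_φ m` and `∂_t m` (along `τ_φ` and `τ_t`) of the map `m`
on the surface, and the resulting weak tangential gradient is square integrable. -/
structure IsWeakGradient (m : E3 → E3) (P Q : ℝ × ℝ → E3) : Prop where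
  aesm_left : AEStronglyMeasurable P (volume.restrict S.chart)
  aesm_right : AEStronglyMeasurable Q (volume.restrict S.chart)
  finite : S.gradEnergy P Q < ⊤
  weak_left : ∀ ψ : ℝ × ℝ → ℝ, S.IsTest ψ →
    ∫ p in S.chart, fderiv ℝ ψ p (1, 0) • m (S.param p.1 p.2) = - ∫ p in S.chart, ψ p • P p
  weak_right : ∀ ψ : ℝ × ℝ → ℝ, S.IsTest ψ →
    ∫ p in S.chart, fderiv ℝ ψ p (0, 1) • m (S.param p.1 p.2) = - ∫ p in S.chart, ψ p • Q p

/-- The Dirichlet energy `∫_S |∇m|² dξ`. All weak gradients of `m` agree almost everywhere, so the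
infimum is over a single value; it is `+∞` if `m` has no square integrable weak gradient. -/
def dirichlet (m : E3 → E3) : ℝ≥0∞ :=
  ⨅ (P : ℝ × ℝ → E3) (Q : ℝ × ℝ → E3) (_ : S.IsWeakGradient m P Q), S.gradEnergy P Q

/-- `m ∈ H¹(S, ℝ³)` (only the values of `m` on `S` matter, up to null sets). -/
def MemH1 (m : E3 → E3) : Prop :=
  MemLp m 2 S.area ∧ ∃ P Q : ℝ × ℝ → E3, S.IsWeakGradient m P Q

/-- `m ∈ H¹(S, T)`. -/
def MemH1Map (T : RevSurface) (m : E3 → E3) : Prop :=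
  S.MemH1 m ∧ ∀ᵐ ξ ∂S.area, m ξ ∈ T.carrier

/-- The anisotropy energy `∫_S g(m · a) dξ`. -/
def anisotropy (g : ℝ → ℝ≥0) (a m : E3 → E3) : ℝ≥0∞ :=
  ∫⁻ ξ, (g (inner ℝ (m ξ) (a ξ)) : ℝ≥0∞) ∂S.area

end RevSurface

/-- The average of `m` over the circle of latitude through `ξ`. -/
def circleMean (m : E3 → E3) (ξ : E3) : E3 :=
  (2 * Real.pi)⁻¹ • ∫ θ in (0 : ℝ)..(2 * Real.pi), m (axialRot θ ξ)

namespace RevSurface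

variable (S : RevSurface)

/-- The term `∫_S |⟨m⟩_{S_ξ} × e₃|² ω²(ξ) dξ`. -/
def penalty (ω : E3 → ℝ≥0) (m : E3 → E3) : ℝ≥0∞ :=
  ∫⁻ ξ, ENNReal.ofReal (‖crossE3 (circleMean m ξ)‖ ^ 2) * (ω ξ : ℝ≥0∞) ^ 2 ∂S.area

/-- The energy `E_ω`. -/
def energy (ω : E3 → ℝ≥0) (g : ℝ → ℝ≥0) (a m : E3 → E3) : ℝ≥0∞ :=
  S.dirichlet m + S.anisotropy g a m + S.penalty ω m

/-- `m` is a global minimizer of `E_ω` in `H¹(S, T)`, with finite energy. -/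
def IsMinimizer (T : RevSurface) (ω : E3 → ℝ≥0) (g : ℝ → ℝ≥0) (a m : E3 → E3) : Prop :=
  S.MemH1Map T m ∧ S.energy ω g a m < ⊤ ∧
    ∀ u, S.MemH1Map T u → S.energy ω g a m ≤ S.energy ω g a u

/-- The circular integral weight `W(t) = (∫₀^{2π} ω²(φ, t) dφ)^{1/2}`. -/
def circWeight (ω : E3 → ℝ≥0) (t : ℝ) : ℝ≥0∞ :=
  (∫⁻ φ in Ioc 0 (2 * Real.pi), (ω (S.param φ t) : ℝ≥0∞) ^ 2) ^ (1 / 2 : ℝ)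

/-- Axially symmetric vector fields on `S`. -/
def AxiallySymmetric (u : E3 → E3) : Prop :=
  ∀ φ : ℝ, ∀ ξ ∈ S.carrier, u (axialRot φ ξ) = axialRot φ (u ξ)

/-- Axially antisymmetric vector fields on `S`. -/
def AxiallyAntisymmetric (u : E3 → E3) : Prop :=
  ∀ φ : ℝ, ∀ ξ ∈ S.carrier, u (axialRot φ ξ) = axialRot (-φ) (u ξ)

/-- Vector fields with line symmetry on `S`. -/
def LineSymmetric (u : E3 → E3) : Prop :=
  ∀ ξ ∈ S.carrier, (∀ φ : ℝ, u (axialRot φ ξ) = axialRot φ (u ξ)) ∨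
    (∀ φ : ℝ, u (axialRot φ ξ) = axialRot (-φ) (u ξ))

/-- The class of `m` in `H¹(S, T)` contains a map `u : S → T`, defined everywhere on `S`, with the
(pointwise) property `p`. -/
def HasRep (T : RevSurface) (p : (E3 → E3) → Prop) (m : E3 → E3) : Prop :=
  ∃ u : E3 → E3, u =ᵐ[S.area] m ∧ MapsTo u S.carrier T.carrier ∧ p u

/-- `f ∈ H¹(I)` for the parameter interval `I = [a, b]` of `S`, identified with its continuous
representative: `f` is locally absolutely continuous in the interior, and its derivative is
square integrable for the weight `h₁ = x`. If the curve does not meet the axis, then `x` is bounded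
between two positive constants on `I`, and this is the usual space `H¹(I)`. -/
def MemH1I {V : Type} [NormedAddCommGroup V] [NormedSpace ℝ V] (f : ℝ → V) : Prop :=
  ContinuousOn f (Icc S.a S.b) ∧ ∃ f' : ℝ → V,
    AEStronglyMeasurable f' (volume.restrict (Icc S.a S.b)) ∧
    (∫⁻ t in Icc S.a S.b, ENNReal.ofReal (S.x t * ‖f' t‖ ^ 2)) < ⊤ ∧
    ∀ s ∈ Ioo S.a S.b, ∀ t ∈ Ioo S.a S.b, f t - f s = ∫ r in s..t, f' r

/-- Profiles `f ∈ H¹(I, T)`. -/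
def MemH1IMap (T : RevSurface) (f : ℝ → E3) : Prop :=
  S.MemH1I f ∧ MapsTo f (Icc S.a S.b) T.carrier

open scoped Classical in
/-- The vector field `ξ(φ, t) ↦ Aᵀ(φ) f(t)` on `S`. The coordinates of a point of `S` are unique,
up to adding multiples of `2π` to `φ`, outside of a null set (the points on the axis and the circle
along which a closed surface is cut open). -/
def symField (f : ℝ → E3) (ξ : E3) : E3 :=
  if h : ∃ p : ℝ × ℝ, p.2 ∈ Icc S.a S.b ∧ ξ = S.param p.1 p.2 then
    axialRot h.choose.1 (f h.choose.2) else 0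

open scoped Classical in
/-- The vector field `ξ(φ, t) ↦ A(φ) f(t)` on `S`. -/
def antiField (f : ℝ → E3) (ξ : E3) : E3 :=
  if h : ∃ p : ℝ × ℝ, p.2 ∈ Icc S.a S.b ∧ ξ = S.param p.1 p.2 then
    axialRot (-h.choose.1) (f h.choose.2) else 0

/-- `f` solves the problem of minimizing `F` among all profiles in `H¹(I, T)`. -/
def IsOptimalProfile (T : RevSurface) (F : (ℝ → E3) → ℝ≥0∞) (f : ℝ → E3) : Prop :=
  S.MemH1IMap T f ∧ F f < ⊤ ∧ ∀ f₁, S.MemH1IMap T f₁ → F f ≤ F f₁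

/-- The surface is never flat: every horizontal section projects onto a finite (possibly empty)
union of circles centred at the origin, where a point on the axis counts as a circle of radius
zero. Distinct circles of this kind have positive distance. -/
def NeverFlat : Prop :=
  ∀ h : ℝ, ∃ R : Finset ℝ, (∀ r ∈ R, 0 ≤ r) ∧
    perpProj '' (S.carrier ∩ {v | v 2 = h}) =
      ⋃ r ∈ R, {v : E3 | v 2 = 0 ∧ v 0 ^ 2 + v 1 ^ 2 = r ^ 2}

end RevSurface

end AxialMaps

end

/-! Both symmetry types are treated at once: for σ = 1 or σ = -1 consider the fields m(φ, t) = R(σφ)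
f(t), where R(θ) is the rotation by θ about the axis and f is a profile with values in T. The
horizontal components of such a field are first harmonics in φ, so its circle means are vertical and
the penalty vanishes. Its angular derivative has the length of its horizontal part. If the field a
is equivariant with the same σ, then m · a depends on t only. The energy therefore becomes a
one-dimensional functional of f (`IsProfile.energy_field`).

Symmetrization. Given a map m of finite energy, almost every meridian φ yields the profile f(t) =
R(-σφ) m(φ, t). The average over φ of the energies of these profiles is the integral of |m_⊥|²/x² +
|∂_t m|²/h₂² + g(m · a), where m_⊥ is the horizontal part. Wirtinger's inequality on a circle of
latitude gives ∫ |m_⊥|² ≤ ∫ |∂_φ m_⊥|² + |∫ m_⊥|² / (2π). The mean term is absorbed by the penalty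
exactly when W² ≥ 2π/x², and the hypothesis xW > √(2π) is the strict form of this. The average is
thus at most the energy of m, and some meridian gives an equivariant competitor which is no worse
(`IsWeakMap.exists_profile_energy_le`). Hence minimizers among equivariant fields are minimizers,
and every minimizer is accompanied by an equivariant one.

Rigidity. If m is a minimizer, all these inequalities are equalities (`IsWeakMap.ae_of_minimal`). On
almost every circle of latitude the horizontal mean vanishes by strictness, only the frequencies ±1
occur in m_⊥, and the vertical component is constant. So m = α cos φ + β sin φ + η e₃: each circle
of latitude is mapped to a horizontal ellipse in T. Since T is never flat, the distance to the axis
takes finitely many values on the ellipse. Being continuous it is constant, the ellipse is a circle,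
and β is α rotated by a right angle in one of the two directions. This is line symmetry.

Regularity. Weak derivatives are analysed through the Fourier modes in φ, which are weakly
differentiable functions of t, so almost every meridian carries a locally absolutely continuous
representative (`ScalarWG.ae_slice_isPrim`). Two meridians at independent angles determine α and β,
which inherit their regularity (`exists_ellipse_rep`). Where S meets the axis, integrability of
|f_⊥|²/x and of x|f'|² forces f_⊥ → 0, and the height of f converges because T meets the axis in at
most two points (`exists_tendsto_of_perp_zero`). This provides representatives on all of S.

Existence of optimal profiles is the direct method: weak L² compactness of the weighted derivatives,
pointwise convergence by integration, lower semicontinuity of the norm and Fatou's lemma for the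
rest (`exists_profile_limit`). Constant profiles are competitors of finite energy if S avoids the
axis or if the constant is on the axis. -/

section

open Filter Topology
open scoped ContDiff

/-! ### Locally absolutely continuous functions and weak derivatives in one variable -/

namespace AxialMaps

/-- `f` is locally absolutely continuous on `(a, b)` with derivative `f'`. -/
structure IsPrim {V : Type*} [NormedAddCommGroup V] [NormedSpace ℝ V] (a b : ℝ) (f f' : ℝ → V) :
    Prop where
  int : ∀ s ∈ Ioo a b, ∀ t ∈ Ioo a b, IntervalIntegrable f' volume s t
  sub : ∀ s ∈ Ioo a b, ∀ t ∈ Ioo a b, f t - f s = ∫ r in s..t, f' r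

theorem uIcc_subset_Ioo' {a b s t : ℝ} (hs : s ∈ Ioo a b) (ht : t ∈ Ioo a b) :
    uIcc s t ⊆ Ioo a b := (ordConnected_Ioo).uIcc_subset hs ht

theorem intervalIntegrable_of_locallyIntegrableOn {V : Type*} [NormedAddCommGroup V]
    {a b : ℝ} {f' : ℝ → V} (h : LocallyIntegrableOn f' (Ioo a b)) {s t : ℝ} (hs : s ∈ Ioo a b)
    (ht : t ∈ Ioo a b) : IntervalIntegrable f' volume s t := by
  rw [intervalIntegrable_iff']
  exact (h.mono_set (uIcc_subset_Ioo' hs ht)).integrableOn_isCompact isCompact_uIcc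

theorem locallyIntegrableOn_Ioo {V : Type*} [NormedAddCommGroup V]
    {a b : ℝ} {f' : ℝ → V} (h : ∀ c d, a < c → c ≤ d → d < b → IntegrableOn f' (Icc c d)) :
    LocallyIntegrableOn f' (Ioo a b) := by
  intro x hx
  obtain ⟨c, hc, hcx⟩ := exists_between hx.1
  obtain ⟨d, hxd, hd⟩ := exists_between hx.2
  exact ⟨Icc c d, mem_nhdsWithin_of_mem_nhds (Icc_mem_nhds hcx hxd),
    h c d hc (hcx.trans hxd).le hd⟩

namespace IsPrim

variable {V : Type*} [NormedAddCommGroup V] [NormedSpace ℝ V] {a b : ℝ} {f f' : ℝ → V}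

theorem of_integrableOn (hi : ∀ c d, a < c → c ≤ d → d < b → IntegrableOn f' (Icc c d))
    (hsub : ∀ s ∈ Ioo a b, ∀ t ∈ Ioo a b, f t - f s = ∫ r in s..t, f' r) : IsPrim a b f f' :=
  ⟨fun _ hs _ ht => intervalIntegrable_of_locallyIntegrableOn (locallyIntegrableOn_Ioo hi) hs ht,
    hsub⟩

theorem eq_add (h : IsPrim a b f f') {s t : ℝ} (hs : s ∈ Ioo a b) (ht : t ∈ Ioo a b) :
    f t = f s + ∫ r in s..t, f' r := by rw [← h.sub s hs t ht]; abel

theorem continuousOn (h : IsPrim a b f f') : ContinuousOn f (Ioo a b) := by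
  intro x hx
  obtain ⟨c, hc, hcx⟩ := exists_between hx.1
  obtain ⟨d, hxd, hd⟩ := exists_between hx.2
  have hcI : c ∈ Ioo a b := ⟨hc, hcx.trans hx.2⟩
  have hdI : d ∈ Ioo a b := ⟨hx.1.trans hxd, hd⟩
  have h1 := intervalIntegral.continuousOn_primitive_interval' (h.int c hcI d hdI) left_mem_uIcc
  have h2 : ContinuousAt (fun t => f c + ∫ r in c..t, f' r) x := by
    refine continuousAt_const.add (h1.continuousAt ?_)
    rw [uIcc_of_le (hcx.trans hxd).le]
    exact Icc_mem_nhds hcx hxd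
  refine (h2.congr ?_).continuousWithinAt
  filter_upwards [Ioo_mem_nhds hx.1 hx.2] with t ht
  exact (h.eq_add hcI ht).symm

/-- Integration by parts for absolutely continuous functions, where the derivatives exist only
almost everywhere. -/
theorem integral_deriv_mul {f f' g g' : ℝ → ℝ} (hf : IsPrim a b f f') (hg : IsPrim a b g g')
    {s t : ℝ} (hs : s ∈ Ioo a b) (ht : t ∈ Ioo a b) :
    ∫ r in s..t, (f' r * g r + f r * g' r) = f t * g t - f s * g s := by
  -- Outside of (a, b) nothing is known about u, so it is replaced by the explicit primitive with
  -- base point s, which agrees with u on the interval between s and t.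
  have key : ∀ {u u' : ℝ → ℝ}, IsPrim a b u u' →
      AbsolutelyContinuousOnInterval (fun r => u s + ∫ v in s..r, u' v) s t ∧
      (∀ᵐ x, x ∈ uIcc s t → HasDerivAt (fun r => u s + ∫ v in s..r, u' v) (u' x) x) := by
    intro u u' hu
    refine ⟨?_, ?_⟩
    · exact ((LipschitzWith.const (u s)).lipschitzOnWith.absolutelyContinuousOnInterval).add
        ((hu.int s hs t ht).absolutelyContinuousOnInterval_intervalIntegral left_mem_uIcc)
    · filter_upwards [(hu.int s hs t ht).ae_hasDerivAt_integral] with x hx hxm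
      exact (hx hxm s left_mem_uIcc).const_add _
  obtain ⟨f1, f2⟩ := key hf
  obtain ⟨g1, g2⟩ := key hg
  have hI := f1.integral_deriv_mul_eq_sub g1
  simp only [← hf.eq_add hs ht, ← hg.eq_add hs ht, intervalIntegral.integral_same, add_zero] at hI
  rw [← hI]
  apply intervalIntegral.integral_congr_ae
  filter_upwards [f2, g2] with x h1 h2 hx
  have hx' := uIoc_subset_uIcc hx
  have hxI := uIcc_subset_Ioo' hs ht hx'
  rw [(h1 hx').deriv, (h2 hx').deriv, ← hf.eq_add hs hxI, ← hg.eq_add hs hxI]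

theorem mul {f f' g g' : ℝ → ℝ} (hf : IsPrim a b f f') (hg : IsPrim a b g g') :
    IsPrim a b (fun r => f r * g r) (fun r => f' r * g r + f r * g' r) := by
  refine ⟨fun s hs t ht => ?_, fun s hs t ht => (hf.integral_deriv_mul hg hs ht).symm⟩
  have hsub := uIcc_subset_Ioo' hs ht
  exact ((hf.int s hs t ht).mul_continuousOn (hg.continuousOn.mono hsub)).add
    ((hg.int s hs t ht).continuousOn_mul (hf.continuousOn.mono hsub))

theorem of_contDiff {τ : ℝ → ℝ} (hτ : ContDiff ℝ 1 τ) : IsPrim a b τ (deriv τ) := by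
  have hc : Continuous (deriv τ) := hτ.continuous_deriv le_rfl
  refine ⟨fun s _ t _ => hc.intervalIntegrable _ _, fun s _ t _ => ?_⟩
  rw [intervalIntegral.integral_deriv_eq_sub (fun x _ => hτ.differentiable one_ne_zero x)
    (hc.intervalIntegrable _ _)]

theorem clm {W : Type*} [NormedAddCommGroup W] [NormedSpace ℝ W] [CompleteSpace V]
    [CompleteSpace W] (L : V →L[ℝ] W) (hf : IsPrim a b f f') :
    IsPrim a b (fun r => L (f r)) (fun r => L (f' r)) := by
  refine ⟨fun s hs t ht => ?_, fun s hs t ht => ?_⟩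
  · have := hf.int s hs t ht
    exact ⟨L.integrable_comp this.1, L.integrable_comp this.2⟩
  · rw [← map_sub, hf.sub s hs t ht, L.intervalIntegral_comp_comm (hf.int s hs t ht)]

theorem add {g g' : ℝ → V} (hf : IsPrim a b f f') (hg : IsPrim a b g g') :
    IsPrim a b (fun r => f r + g r) (fun r => f' r + g' r) := by
  refine ⟨fun s hs t ht => (hf.int s hs t ht).add (hg.int s hs t ht), fun s hs t ht => ?_⟩
  rw [intervalIntegral.integral_add (hf.int s hs t ht) (hg.int s hs t ht), ← hf.sub s hs t ht,
    ← hg.sub s hs t ht]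
  abel

/-- The primitive of a function which is integrable up to the endpoint is continuous up to the
endpoint. -/
theorem tendsto_left (hf : IsPrim a b f f') {c : ℝ} (hc : c ∈ Ioo a b)
    (hi : IntervalIntegrable f' volume a c) :
    Tendsto f (𝓝[>] a) (𝓝 (f c - ∫ r in a..c, f' r)) := by
  have h1 := intervalIntegral.continuousOn_primitive_interval' hi right_mem_uIcc
  rw [uIcc_of_le hc.1.le] at h1
  have h2 : Tendsto (fun t => f c + ∫ r in c..t, f' r) (𝓝[>] a) (𝓝 (f c + ∫ r in c..a, f' r)) := by
    refine Tendsto.const_add _ ?_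
    have := (h1 a (left_mem_Icc.2 hc.1.le)).mono (Ioc_subset_Icc_self)
    rw [ContinuousWithinAt, nhdsWithin_Ioc_eq_nhdsGT hc.1] at this
    exact this
  rw [intervalIntegral.integral_symm, ← sub_eq_add_neg] at h2
  refine h2.congr' ?_
  filter_upwards [Ioo_mem_nhdsGT (hc.1.trans hc.2)] with t ht
  exact (hf.eq_add hc ht).symm

/-- The reflection t ↦ -t turns every statement at the left endpoint into one at the right endpoint.
-/
theorem comp_neg (hf : IsPrim a b f f') :
    IsPrim (-b) (-a) (fun r => f (-r)) (fun r => -f' (-r)) := by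
  have hm : ∀ {s}, s ∈ Ioo (-b) (-a) → -s ∈ Ioo a b := fun {s} hs =>
    ⟨by linarith [hs.2], by linarith [hs.1]⟩
  refine ⟨fun s hs t ht => ?_, fun s hs t ht => ?_⟩
  · have := (hf.int _ (hm hs) _ (hm ht)).comp_sub_left 0
    simpa [Pi.neg_def] using this.neg
  · rw [intervalIntegral.integral_neg, intervalIntegral.integral_comp_neg (f := f'),
      ← intervalIntegral.integral_symm, hf.sub _ (hm hs) _ (hm ht)]

theorem tendsto_right (hf : IsPrim a b f f') {c : ℝ} (hc : c ∈ Ioo a b)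
    (hi : IntervalIntegrable f' volume c b) :
    Tendsto f (𝓝[<] b) (𝓝 (f c + ∫ r in c..b, f' r)) := by
  have hi' : IntervalIntegrable (fun r => -f' (-r)) volume (-b) (-c) := by
    have := (hi.comp_sub_left 0).neg
    simpa [Pi.neg_def] using this.symm
  have := hf.comp_neg.tendsto_left (c := -c) ⟨by linarith [hc.2], by linarith [hc.1]⟩ hi'
  rw [intervalIntegral.integral_neg, intervalIntegral.integral_comp_neg (f := f')] at this
  simp only [neg_neg, sub_neg_eq_add] at this
  have h2 := this.comp (tendsto_neg_nhdsLT (a := b))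
  refine h2.congr fun t => ?_
  simp

end IsPrim

/-- Smooth functions with compact support in `(a, b)`. -/
def IsBump (a b : ℝ) (τ : ℝ → ℝ) : Prop :=
  ContDiff ℝ ∞ τ ∧ ∃ c d, a < c ∧ c < d ∧ d < b ∧ ∀ t, τ t ≠ 0 → t ∈ Icc c d

theorem deriv_support_Icc {c d : ℝ} {τ : ℝ → ℝ} 
    (hs : ∀ t, τ t ≠ 0 → t ∈ Icc c d) : ∀ t, deriv τ t ≠ 0 → t ∈ Icc c d := by
  intro t ht
  have h1 : t ∈ tsupport (deriv τ) := subset_tsupport _ ht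
  have h2 : tsupport τ ⊆ Icc c d := closure_minimal (fun x hx => hs x hx) isClosed_Icc
  exact h2 (tsupport_deriv_subset (𝕜 := ℝ) h1)

theorem exists_Icc_of_isCompact_subset {a b : ℝ} (hab : a < b) {K : Set ℝ} (hK : IsCompact K)
    (hKs : K ⊆ Ioo a b) : ∃ c d, a < c ∧ c < d ∧ d < b ∧ K ⊆ Icc c d := by
  rcases K.eq_empty_or_nonempty with rfl | hne
  · obtain ⟨c, hc, hcb⟩ := exists_between hab
    obtain ⟨d, hd, hdb⟩ := exists_between hcb
    exact ⟨c, d, hc, hd, hdb, empty_subset _⟩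
  · obtain ⟨m, hm, hmin⟩ := hK.exists_isLeast hne
    obtain ⟨M, hM, hmax⟩ := hK.exists_isGreatest hne
    obtain ⟨d, hd, hdb⟩ := exists_between (hKs hM).2
    exact ⟨m, d, (hKs hm).1, (hmax hm).trans_lt hd, hdb,
      fun x hx => ⟨hmin hx, (hmax hx).trans hd.le⟩⟩

theorem setIntegral_eq_of_support {a b c d : ℝ} (hac : a < c) (hdb : d < b) {h : ℝ → ℝ}
    (hs : ∀ t, h t ≠ 0 → t ∈ Icc c d) (hcd : c ≤ d):
    ∫ t in Ioo a b, h t = ∫ t in c..d, h t := by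
  rw [intervalIntegral.integral_of_le hcd, ← integral_Icc_eq_integral_Ioc,
    setIntegral_eq_of_subset_of_forall_sdiff_eq_zero (t := Ioo a b) measurableSet_Ioo
      (fun t (ht : t ∈ Icc c d) => ⟨hac.trans_le ht.1, ht.2.trans_lt hdb⟩)]
  intro x hx
  by_contra h0
  exact hx.2 (hs x h0)

theorem IsPrim.integral_deriv_bump {a b : ℝ} {f f' τ : ℝ → ℝ} (hf : IsPrim a b f f')
    (hτ : IsBump a b τ) :
    ∫ t in Ioo a b, deriv τ t * f t = - ∫ t in Ioo a b, τ t * f' t := by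
  obtain ⟨hsm, c, d, hac, hcd, hdb, hs⟩ := hτ
  -- On the slightly larger interval [c', d'] the boundary terms vanish, since c' and d' lie outside
  -- of the support bound [c, d].
  obtain ⟨c', hac', hcc'⟩ := exists_between hac
  obtain ⟨d', hdd', hdb'⟩ := exists_between hdb
  have hs' : ∀ t, τ t ≠ 0 → t ∈ Icc c' d' := fun t ht =>
    ⟨hcc'.le.trans (hs t ht).1, (hs t ht).2.trans hdd'.le⟩
  have hcd' : c' < d' := hcc'.trans (hcd.trans hdd')
  have hc0 : τ c' = 0 := by by_contra h; exact absurd (hs _ h).1 (not_le.2 hcc')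
  have hd0 : τ d' = 0 := by by_contra h; exact absurd (hs _ h).2 (not_le.2 hdd')
  have hcI : c' ∈ Ioo a b := ⟨hac', hcd'.trans hdb'⟩
  have hdI : d' ∈ Ioo a b := ⟨hac'.trans hcd', hdb'⟩
  rw [setIntegral_eq_of_support hac' hdb' _ hcd'.le, setIntegral_eq_of_support hac' hdb' _ hcd'.le]
  · have hτp : IsPrim a b τ (deriv τ) := IsPrim.of_contDiff (hsm.of_le (by norm_cast))
    have := hτp.integral_deriv_mul hf hcI hdI
    rw [hc0, hd0, intervalIntegral.integral_add] at this
    · linarith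
    · exact (hτp.int _ hcI _ hdI).mul_continuousOn (hf.continuousOn.mono (uIcc_subset_Ioo' hcI hdI))
    · exact (hf.int _ hcI _ hdI).continuousOn_mul hsm.continuous.continuousOn
  · intro t ht
    exact hs' t (left_ne_zero_of_mul ht)
  · intro t ht
    exact deriv_support_Icc hs' t (left_ne_zero_of_mul ht)

theorem ae_eq_zero_of_forall_isBump {a b : ℝ} (hab : a < b) {f : ℝ → ℝ}
    (hf : LocallyIntegrableOn f (Ioo a b))
    (h : ∀ τ, IsBump a b τ → ∫ t in Ioo a b, τ t * f t = 0) :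
    ∀ᵐ t, t ∈ Ioo a b → f t = 0 := by
  refine isOpen_Ioo.ae_eq_zero_of_integral_contDiff_smul_eq_zero hf fun g hg hgc hgs => ?_
  obtain ⟨c, d, hac, hcd, hdb, hK⟩ := exists_Icc_of_isCompact_subset hab hgc hgs
  rw [← h g ⟨hg, c, d, hac, hcd, hdb, fun t ht => hK (subset_tsupport _ ht)⟩]
  simp only [smul_eq_mul]
  rw [setIntegral_eq_integral_of_forall_compl_eq_zero]
  intro x hx
  by_contra h0
  exact hx (hgs (subset_tsupport _ (left_ne_zero_of_mul h0)))

/-- Otherwise, after rescaling, every bump would have integral zero, and the constant 1 would vanish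
almost everywhere by the fundamental lemma. -/
theorem exists_isBump_integral_eq_one {a b : ℝ} (hab : a < b) :
    ∃ ρ, IsBump a b ρ ∧ ∫ t in Ioo a b, ρ t = 1 := by
  by_contra! hcon
  have : ∀ᵐ t : ℝ, t ∈ Ioo a b → (1 : ℝ) = 0 := by
    refine ae_eq_zero_of_forall_isBump hab ((locallyIntegrable_const (1 : ℝ)).locallyIntegrableOn _)
      fun τ hτ => ?_
    by_contra h0
    set I := ∫ t in Ioo a b, τ t * 1 with hI
    obtain ⟨hsm, c, d, hac, hcd, hdb, hs⟩ := hτ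
    refine hcon (fun t => I⁻¹ * τ t) ⟨contDiff_const.mul hsm, c, d, hac, hcd, hdb, fun t ht =>
      hs t (right_ne_zero_of_mul ht)⟩ ?_
    rw [integral_const_mul]
    simp only [mul_one] at hI
    rw [← hI, inv_mul_cancel₀ h0]
  simp only [one_ne_zero, imp_false] at this
  have h1 : volume (Ioo a b) = 0 := by
    rw [ae_iff] at this
    simpa only [not_not, ofPred_mem_eq, Classical.not_imp, not_false_eq_true, and_true] using this
  simp only [Real.volume_Ioo, ENNReal.ofReal_eq_zero] at h1
  linarith

/-- The mean value zero makes the primitive vanish again beyond the support of τ. -/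
theorem isBump_primitive {a b : ℝ} {τ : ℝ → ℝ} (hτ : IsBump a b τ)
    (h0 : ∫ t in Ioo a b, τ t = 0) :
    ∃ θ, IsBump a b θ ∧ deriv θ = τ := by
  obtain ⟨hsm, c, d, hac, hcd, hdb, hs⟩ := hτ
  have hd : ∀ x, HasDerivAt (fun t => ∫ r in c..t, τ r) (τ x) x := fun x =>
    hsm.continuous.integral_hasStrictDerivAt c x |>.hasDerivAt
  have hder : deriv (fun t => ∫ r in c..t, τ r) = τ := funext fun x => (hd x).deriv
  refine ⟨fun t => ∫ r in c..t, τ r, ⟨?_, c, d, hac, hcd, hdb, ?_⟩, hder⟩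
  · rw [contDiff_infty_iff_deriv]
    exact ⟨fun x => (hd x).differentiableAt, by rw [hder]; exact hsm⟩
  · intro t ht
    by_contra hcon
    apply ht
    rw [mem_Icc, not_and_or, not_le, not_le] at hcon
    rcases hcon with hlt | hgt
    · show ∫ r in c..t, τ r = 0
      rw [intervalIntegral.integral_symm, intervalIntegral.integral_of_le hlt.le,
        integral_Ioc_eq_integral_Ioo, setIntegral_eq_zero_of_forall_eq_zero, neg_zero]
      intro x hx
      by_contra h
      exact absurd (hs x h).1 (not_le.2 hx.2)
    · show ∫ r in c..t, τ r = 0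
      rw [setIntegral_eq_of_support hac hdb hs hcd.le] at h0
      rw [← intervalIntegral.integral_add_adjacent_intervals (b := d)
        (hsm.continuous.intervalIntegrable _ _) (hsm.continuous.intervalIntegrable _ _), h0,
        zero_add, intervalIntegral.integral_of_le hgt.le, setIntegral_eq_zero_of_forall_eq_zero]
      intro x hx
      by_contra h
      exact absurd (hs x h).2 (not_le.2 hx.1)

theorem IsBump.integrableOn_mul {a b : ℝ} {τ f : ℝ → ℝ} (hτ : IsBump a b τ)
    (hf : LocallyIntegrableOn f (Ioo a b)) : IntegrableOn (fun t => τ t * f t) (Ioo a b) := by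
  obtain ⟨hsm, c, d, hac, hcd, hdb, hs⟩ := hτ
  have h1 : IntegrableOn f (Icc c d) :=
    (hf.mono_set (fun t ht => ⟨hac.trans_le ht.1, ht.2.trans_lt hdb⟩)).integrableOn_isCompact
      isCompact_Icc
  have h2 : IntegrableOn (fun t => τ t * f t) (Icc c d) :=
    h1.continuousOn_mul hsm.continuous.continuousOn isCompact_Icc
  refine (h2.integrable_of_forall_notMem_eq_zero ?_).integrableOn
  intro x hx
  by_contra h0
  exact hx (hs x (left_ne_zero_of_mul h0))

theorem IsBump.deriv {a b : ℝ} {τ : ℝ → ℝ} (hτ : IsBump a b τ) : IsBump a b (deriv τ) := by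
  obtain ⟨hsm, c, d, hac, hcd, hdb, hs⟩ := hτ
  exact ⟨(contDiff_infty_iff_deriv.1 hsm).2, c, d, hac, hcd, hdb,
    deriv_support_Icc hs⟩

theorem IsBump.sub_const_mul {a b : ℝ} {τ ρ : ℝ → ℝ} (hτ : IsBump a b τ) (hρ : IsBump a b ρ)
    (k : ℝ) : IsBump a b (fun t => τ t - k * ρ t) := by
  obtain ⟨hsm, c, d, hac, hcd, hdb, hs⟩ := hτ
  obtain ⟨hsm', c', d', hac', hcd', hdb', hs'⟩ := hρ
  refine ⟨hsm.sub (contDiff_const.mul hsm'), min c c', max d d', lt_min hac hac',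
    (min_le_left _ _).trans_lt (hcd.trans_le (le_max_left _ _)), max_lt hdb hdb', fun t ht => ?_⟩
  by_cases h1 : τ t = 0
  · have h2 : ρ t ≠ 0 := by rintro h2; apply ht; simp [h1, h2]
    exact ⟨(min_le_right _ _).trans (hs' t h2).1, (hs' t h2).2.trans (le_max_right _ _)⟩
  · exact ⟨(min_le_left _ _).trans (hs t h1).1, (hs t h1).2.trans (le_max_left _ _)⟩

/-- The lemma of du Bois-Reymond: a function with a weak derivative has a locally absolutely
continuous representative. -/
theorem exists_isPrim_of_weak {a b : ℝ} (hab : a < b) {f f' : ℝ → ℝ}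
    (hf : LocallyIntegrableOn f (Ioo a b)) (hf' : LocallyIntegrableOn f' (Ioo a b))
    (h : ∀ τ, IsBump a b τ →
      ∫ t in Ioo a b, deriv τ t * f t = - ∫ t in Ioo a b, τ t * f' t) :
    ∃ A, IsPrim a b A f' ∧ ∀ᵐ t, t ∈ Ioo a b → f t = A t := by
  obtain ⟨c, hac, hcb⟩ := exists_between hab
  have hc : c ∈ Ioo a b := ⟨hac, hcb⟩
  have hii : ∀ s ∈ Ioo a b, ∀ t ∈ Ioo a b, IntervalIntegrable f' volume s t := fun s hs t ht =>
    intervalIntegrable_of_locallyIntegrableOn hf' hs ht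
  have hN : ∀ k : ℝ, IsPrim a b (fun t => k + ∫ r in c..t, f' r) f' := by
    refine fun k => ⟨hii, fun s hs t ht => ?_⟩
    rw [add_sub_add_left_eq_sub, intervalIntegral.integral_interval_sub_left (hii c hc t ht)
      (hii c hc s hs)]
  set N : ℝ → ℝ := fun t => ∫ r in c..t, f' r with hNdef
  have hN0 : IsPrim a b N f' := by simpa using hN 0
  have hNl : LocallyIntegrableOn N (Ioo a b) := hN0.continuousOn.locallyIntegrableOn
    measurableSet_Ioo
  have hDl : LocallyIntegrableOn (fun t => f t - N t) (Ioo a b) := hf.sub hNl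
  have hD : ∀ τ, IsBump a b τ → ∫ t in Ioo a b, deriv τ t * (f t - N t) = 0 := by
    intro τ hτ
    simp only [mul_sub]
    rw [integral_sub (hτ.deriv.integrableOn_mul hf) (hτ.deriv.integrableOn_mul hNl), h τ hτ,
      hN0.integral_deriv_bump hτ, sub_self]
  obtain ⟨ρ, hρ, hρ1⟩ := exists_isBump_integral_eq_one hab
  -- The difference of f and the primitive N has weak derivative zero. The constant which it must
  -- equal is read off by averaging against the normalized bump ρ.
  set K := ∫ t in Ioo a b, ρ t * (f t - N t) with hK
  refine ⟨fun t => K + N t, hN K, ?_⟩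
  have hcl : LocallyIntegrableOn (fun _ : ℝ => (1:ℝ)) (Ioo a b) :=
    (locallyIntegrable_const 1).locallyIntegrableOn _
  have hcK : LocallyIntegrableOn (fun _ : ℝ => K) (Ioo a b) :=
    (locallyIntegrable_const K).locallyIntegrableOn _
  have := ae_eq_zero_of_forall_isBump hab (f := fun t => f t - N t - K) (hDl.sub hcK) ?_
  · filter_upwards [this] with t ht htI
    linarith [ht htI]
  · intro θ hθ
    set I := ∫ t in Ioo a b, θ t with hI
    have hi : ∀ {τ}, IsBump a b τ → IntegrableOn τ (Ioo a b) := fun hτ => by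
      simpa using hτ.integrableOn_mul hcl
    -- Subtracting a multiple of ρ makes the test function θ a bump of mean zero, hence the
    -- derivative of a bump, to which `hD` applies.
    have hb := hθ.sub_const_mul hρ I
    have h0 : ∫ t in Ioo a b, (θ t - I * ρ t) = 0 := by
      rw [integral_sub (hi hθ) ((hi hρ).const_mul I), integral_const_mul, hρ1, ← hI]; ring
    obtain ⟨τ, hτ, hτd⟩ := isBump_primitive hb h0
    have h1 := hD τ hτ
    rw [hτd] at h1
    have h2 : ∀ t, (θ t - I * ρ t) * (f t - N t) = θ t * (f t - N t) - I * (ρ t * (f t - N t)) :=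
      fun t => by ring
    simp only [h2] at h1
    rw [integral_sub (hθ.integrableOn_mul hDl) ((hρ.integrableOn_mul hDl).const_mul I),
      integral_const_mul, ← hK] at h1
    have h3 : ∀ t, θ t * (f t - N t - K) = θ t * (f t - N t) - K * θ t := fun t => by ring
    simp only [h3]
    rw [integral_sub (hθ.integrableOn_mul hDl) ((hi hθ).const_mul K), integral_const_mul, ← hI]
    linarith

end AxialMaps

/-! ### Boundary values of one-dimensional functions with degenerate weight -/

namespace AxialMaps

/-- The derivative 2hh' of h² is integrable, since 2|hh'| ≤ h²/x + x h'². So h² has a limit at a,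
and a positive limit would make h²/x at least as large as a multiple of 1/(t - a), which is not
integrable. This is the mechanism which sends horizontal components to zero at the axis. -/
theorem IsPrim.tendsto_zero_left {a b C : ℝ} (hab : a < b) {h h' x : ℝ → ℝ}
    (hp : IsPrim a b h h') (hx : ∀ t ∈ Ioo a b, 0 < x t) (hC : ∀ t ∈ Ioo a b, x t ≤ C * (t - a))
    (hm : AEStronglyMeasurable h' (volume.restrict (Ioo a b)))
    (h1 : IntegrableOn (fun t => h t ^ 2 / x t) (Ioo a b))
    (h2 : IntegrableOn (fun t => x t * h' t ^ 2) (Ioo a b)) :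
    Tendsto h (𝓝[>] a) (𝓝 0) := by
  have hC0 : 0 < C := by
    obtain ⟨c, hac, hcb⟩ := exists_between hab
    have := (hx c ⟨hac, hcb⟩).trans_le (hC c ⟨hac, hcb⟩)
    exact pos_of_mul_pos_left this (sub_pos.2 hac).le
  have hu := hp.mul hp
  have hui : IntegrableOn (fun r => h' r * h r + h r * h' r) (Ioo a b) := by
    have hhm : AEStronglyMeasurable h (volume.restrict (Ioo a b)) :=
      hp.continuousOn.aestronglyMeasurable measurableSet_Ioo
    refine Integrable.mono' (h1.add h2) ((hm.mul hhm).add (hhm.mul hm)) ?_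
    filter_upwards [ae_restrict_mem measurableSet_Ioo] with t ht
    have hxt := hx t ht
    have e1 : h t ^ 2 / x t + x t * h' t ^ 2 - 2 * (h t * h' t)
        = (h t - x t * h' t) ^ 2 / x t := by field_simp; ring
    have e2 : h t ^ 2 / x t + x t * h' t ^ 2 + 2 * (h t * h' t)
        = (h t + x t * h' t) ^ 2 / x t := by field_simp; ring
    have p1 : 0 ≤ (h t - x t * h' t) ^ 2 / x t := by positivity
    have p2 : 0 ≤ (h t + x t * h' t) ^ 2 / x t := by positivity
    simp only [Pi.add_apply, Real.norm_eq_abs]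
    rw [abs_le]
    constructor <;> linarith
  obtain ⟨c, hac, hcb⟩ := exists_between hab
  have hlim := hu.tendsto_left ⟨hac, hcb⟩ (by
    rw [intervalIntegrable_iff_integrableOn_Ioo_of_le hac.le]
    exact hui.mono_set (Ioo_subset_Ioo_right hcb.le))
  set L := h c * h c - ∫ r in a..c, (h' r * h r + h r * h' r) with hL
  have hL0 : 0 ≤ L := ge_of_tendsto' hlim fun t => mul_self_nonneg _
  rcases hL0.eq_or_lt with h0 | hpos
  · rw [← h0] at hlim
    have h3 : Tendsto (fun t => √(h t * h t)) (𝓝[>] a) (𝓝 (√0)) :=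
      (Real.continuous_sqrt.tendsto 0).comp hlim
    simp only [Real.sqrt_mul_self_eq_abs, Real.sqrt_zero] at h3
    exact (tendsto_zero_iff_abs_tendsto_zero _).2 h3
  · exfalso
    have hev : ∀ᶠ t in 𝓝[>] a, L / 2 < h t * h t := hlim.eventually (lt_mem_nhds (half_lt_self hpos))
    obtain ⟨e, hae, he⟩ := (mem_nhdsGT_iff_exists_Ioo_subset' hab).1
      (Filter.inter_mem hev (Ioo_mem_nhdsGT hab))
    have hae' : a < e := hae
    -- Near a one has h² > L/2, so 1/(t - a) ≤ C/x ≤ (2C/L) h²/x.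
    have hint : IntegrableOn (fun t => (t - a)⁻¹) (Ioo a e) := by
      refine Integrable.mono' ((h1.mono_set (fun t ht => (he ht).2)).const_mul (2 * C / L)) ?_ ?_
      · exact (measurable_id.sub_const a).inv.aestronglyMeasurable
      · filter_upwards [ae_restrict_mem measurableSet_Ioo] with t ht
        have hxt := hx t (he ht).2
        have hta : 0 < t - a := sub_pos.2 ht.1
        have hb : L / 2 < h t * h t := (he ht).1
        rw [Real.norm_eq_abs, abs_of_pos (inv_pos.2 hta)]
        have : (t - a)⁻¹ ≤ C / x t := by
          rw [inv_le_iff_one_le_mul₀ hta, div_mul_eq_mul_div, le_div_iff₀ hxt, one_mul]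
          exact hC t (he ht).2
        refine this.trans ?_
        rw [← mul_div_assoc]
        refine div_le_div_of_nonneg_right ?_ hxt.le
        rw [div_mul_eq_mul_div, le_div_iff₀ hpos]
        nlinarith
    have := (intervalIntegrable_iff_integrableOn_Ioo_of_le hae'.le).2 hint
    rw [intervalIntegrable_sub_inv_iff] at this
    rcases this with h | h
    · exact hae'.ne h
    · exact h left_mem_uIcc

theorem integrableOn_comp_neg_Ioo {f : ℝ → ℝ} {a b : ℝ} (h : IntegrableOn f (Ioo a b)) :
    IntegrableOn (fun t => f (-t)) (Ioo (-b) (-a)) := by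
  have h1 := (Measure.measurePreserving_neg (volume : Measure ℝ)).integrableOn_comp_preimage
    (MeasurableEquiv.neg ℝ).measurableEmbedding (f := f) (s := Ioo a b)
  have h2 := h1.2 h
  simpa [Function.comp_def] using h2

theorem IsPrim.tendsto_zero_right {a b C : ℝ} (hab : a < b) {h h' x : ℝ → ℝ}
    (hp : IsPrim a b h h') (hx : ∀ t ∈ Ioo a b, 0 < x t) (hC : ∀ t ∈ Ioo a b, x t ≤ C * (b - t))
    (hm : AEStronglyMeasurable h' (volume.restrict (Ioo a b)))
    (h1 : IntegrableOn (fun t => h t ^ 2 / x t) (Ioo a b))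
    (h2 : IntegrableOn (fun t => x t * h' t ^ 2) (Ioo a b)) :
    Tendsto h (𝓝[<] b) (𝓝 0) := by
  have hmem : ∀ {s}, s ∈ Ioo (-b) (-a) → -s ∈ Ioo a b := fun {s} hs =>
    ⟨by linarith [hs.2], by linarith [hs.1]⟩
  have hm' : AEStronglyMeasurable (fun t => h' (-t)) (volume.restrict (Ioo (-b) (-a))) := by
    have h1 := ((Measure.measurePreserving_neg (volume : Measure ℝ)).restrict_preimage
      (measurableSet_Ioo (a := a) (b := b))).quasiMeasurePreserving
    have h2 := hm.comp_quasiMeasurePreserving h1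
    simpa [Function.comp_def] using h2
  have := hp.comp_neg.tendsto_zero_left (x := fun t => x (-t)) (C := C) (neg_lt_neg hab)
    (fun t ht => hx _ (hmem ht)) (fun t ht => (hC _ (hmem ht)).trans_eq (by ring)) hm'.neg
    (integrableOn_comp_neg_Ioo h1) (by simpa using integrableOn_comp_neg_Ioo h2)
  have h2 := this.comp (tendsto_neg_nhdsLT (a := b))
  refine h2.congr fun t => ?_
  simp

/-- A bounded function on a filter with connected bases which omits, frequently, all but
finitely many values converges. -/
theorem exists_tendsto_of_finite_values {l : Filter ℝ} {η : ℝ → ℝ} {F : Set ℝ} (hF : F.Finite)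
    (hl : ∀ s ∈ l, ∃ u ∈ l, u ⊆ s ∧ IsPreconnected u ∧ ContinuousOn η u) {B : ℝ}
    (hB : ∀ᶠ t in l, |η t| ≤ B) (hv : ∀ c, (∃ᶠ t in l, η t = c) → c ∈ F) :
    ∃ c, Tendsto η l (𝓝 c) := by
  refine tendsto_of_no_upcrossings (s := univ) dense_univ ?_ ⟨B, ?_⟩ ⟨-B, ?_⟩
  · rintro α - β - hαβ ⟨h1, h2⟩
    -- If η oscillated between α and β, the intermediate value theorem on arbitrarily small
    -- connected sets of the filter would make it attain a value γ outside of F frequently.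
    have hinf : (Ioo α β \ F).Nonempty := ((Ioo_infinite hαβ).sdiff hF).nonempty
    obtain ⟨γ, hγ, hγF⟩ := hinf
    refine hγF (hv γ ?_)
    rw [frequently_iff]
    intro s hs
    obtain ⟨u, hu, hus, hup, huc⟩ := hl s hs
    obtain ⟨t1, ht1, h1'⟩ := (frequently_iff.1 h1) hu
    obtain ⟨t2, ht2, h2'⟩ := (frequently_iff.1 h2) hu
    obtain ⟨t, ht, hte⟩ := hup.intermediate_value ht1 ht2 huc
      ⟨(h1'.trans hγ.1).le, (hγ.2.trans h2').le⟩
    exact ⟨t, hus ht, hte⟩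
  · exact eventually_map.2 (hB.mono fun t ht => (abs_le.1 ht).2)
  · exact eventually_map.2 (hB.mono fun t ht => (abs_le.1 ht).1)

theorem exists_connected_nhdsGT {a b : ℝ} (hab : a < b) {η : ℝ → ℝ}
    (hη : ContinuousOn η (Ioo a b)) :
    ∀ s ∈ 𝓝[>] a, ∃ u ∈ 𝓝[>] a, u ⊆ s ∧ IsPreconnected u ∧ ContinuousOn η u := by
  intro s hs
  obtain ⟨e, hae, he⟩ := (mem_nhdsGT_iff_exists_Ioo_subset' hab).1
    (Filter.inter_mem hs (Ioo_mem_nhdsGT hab))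
  exact ⟨Ioo a e, Ioo_mem_nhdsGT hae, fun t ht => (he ht).1, isPreconnected_Ioo,
    hη.mono fun t ht => (he ht).2⟩

theorem exists_connected_nhdsLT {a b : ℝ} (hab : a < b) {η : ℝ → ℝ}
    (hη : ContinuousOn η (Ioo a b)) :
    ∀ s ∈ 𝓝[<] b, ∃ u ∈ 𝓝[<] b, u ⊆ s ∧ IsPreconnected u ∧ ContinuousOn η u := by
  intro s hs
  obtain ⟨e, hae, he⟩ := (mem_nhdsLT_iff_exists_Ioo_subset' hab).1
    (Filter.inter_mem hs (Ioo_mem_nhdsLT hab))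
  exact ⟨Ioo e b, Ioo_mem_nhdsLT hae, fun t ht => (he ht).1, isPreconnected_Ioo,
    hη.mono fun t ht => (he ht).2⟩

end AxialMaps

/-! ### Fourier modes on the circle and Wirtinger's inequality -/

namespace AxialMaps

/-- Lebesgue measure on the period interval `(0, 2π]`. -/
noncomputable abbrev circ : Measure ℝ := volume.restrict (Ioc 0 (2 * Real.pi))

/-- The trigonometric monomials `cos (n φ + j π / 2)`. -/
noncomputable def cs (n j : ℤ) (φ : ℝ) : ℝ := Real.cos (n * φ + j * (Real.pi / 2))

theorem cs_zero (n : ℤ) (φ : ℝ) : cs n 0 φ = Real.cos (n * φ) := by simp [cs]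

theorem cs_one (n : ℤ) (φ : ℝ) : cs n 1 φ = - Real.sin (n * φ) := by
  simp [cs, Real.cos_add_pi_div_two]

theorem cs_add_two (n j : ℤ) (φ : ℝ) : cs n (j + 2) φ = - cs n j φ := by
  rw [cs, cs, ← Real.cos_add_pi]
  congr 1; push_cast; ring

/-- The phase index j turns differentiation into a shift, so that sines and cosines need no separate
treatment: j = 0, 1, 2, -1 give cos, -sin, -cos, sin of nφ. -/
theorem hasDerivAt_cs (n j : ℤ) (φ : ℝ) : HasDerivAt (cs n j) (n * cs n (j + 1) φ) φ := by
  have h := (((hasDerivAt_id φ).const_mul (n : ℝ)).add_const (j * (Real.pi / 2))).cos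
  convert! h using 1
  simp only [cs, id]
  rw [show (n : ℝ) * φ + ((j + 1 : ℤ) : ℝ) * (Real.pi / 2) =
    (n * φ + j * (Real.pi / 2)) + Real.pi / 2 by push_cast; ring, Real.cos_add_pi_div_two]
  ring

theorem contDiff_cs (n j : ℤ) {k : WithTop ℕ∞} : ContDiff ℝ k (cs n j) :=
  Real.contDiff_cos.comp ((contDiff_const.mul contDiff_id).add contDiff_const)

theorem continuous_cs (n j : ℤ) : Continuous (cs n j) :=
  (contDiff_cs n j (k := 0)).continuous

theorem cs_periodic (n j : ℤ) : Function.Periodic (cs n j) (2 * Real.pi) := by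
  intro φ
  simp only [cs]
  rw [show (n : ℝ) * (φ + 2 * Real.pi) + j * (Real.pi / 2) =
    (n * φ + j * (Real.pi / 2)) + n * (2 * Real.pi) by ring, Real.cos_add_int_mul_two_pi]

theorem abs_cs_le (n j : ℤ) (φ : ℝ) : |cs n j φ| ≤ 1 := Real.abs_cos_le_one _

theorem two_pi_pos : 0 < 2 * Real.pi := Real.two_pi_pos

theorem integral_circ (f : ℝ → ℝ) : ∫ φ, f φ ∂circ = ∫ φ in (0 : ℝ)..(2 * Real.pi), f φ :=
  (intervalIntegral.integral_of_le two_pi_pos.le).symm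

theorem integral_cs (n j : ℤ) :
    ∫ φ, cs n j φ ∂circ = if n = 0 then 2 * Real.pi * Real.cos (j * (Real.pi / 2)) else 0 := by
  rw [integral_circ]
  split_ifs with h
  · subst h
    simp [cs]
  · have hn : (n : ℝ) ≠ 0 := Int.cast_ne_zero.2 h
    have h1 : ∀ φ, HasDerivAt (fun φ => (n : ℝ)⁻¹ * cs n (j - 1) φ) (cs n j φ) φ := fun φ => by
      have := (hasDerivAt_cs n (j - 1) φ).const_mul (n : ℝ)⁻¹
      rwa [inv_mul_cancel_left₀ hn, sub_add_cancel] at this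
    rw [intervalIntegral.integral_eq_sub_of_hasDerivAt (fun φ _ => h1 φ)
      ((continuous_cs n j).intervalIntegrable _ _)]
    have := cs_periodic n (j - 1) 0
    rw [zero_add] at this
    rw [this, sub_self]

theorem cs_mul_cs (n j m k : ℤ) (φ : ℝ) :
    cs n j φ * cs m k φ = (cs (n + m) (j + k) φ + cs (n - m) (j - k) φ) / 2 := by
  simp only [cs]
  push_cast
  rw [show ((n : ℝ) + m) * φ + (j + k) * (Real.pi / 2) = (n * φ + j * (Real.pi / 2)) +
      (m * φ + k * (Real.pi / 2)) by ring,
    show ((n : ℝ) - m) * φ + (j - k) * (Real.pi / 2) = (n * φ + j * (Real.pi / 2)) -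
      (m * φ + k * (Real.pi / 2)) by ring, Real.cos_add (n * φ + j * (Real.pi / 2)), Real.cos_sub]
  ring

theorem integrable_cs_mul (n j : ℤ) {f : ℝ → ℝ} {μ : Measure ℝ} (hf : Integrable f μ) :
    Integrable (fun φ => cs n j φ * f φ) μ :=
  hf.bdd_mul (continuous_cs n j).aestronglyMeasurable (c := 1)
    (Eventually.of_forall fun φ => by simpa using abs_cs_le n j φ)

theorem MemLp.integrable_circ {f : ℝ → ℝ} (hf : MemLp f 2 circ) : Integrable f circ :=
  hf.integrable one_le_two

theorem integral_cs_mul_cs (n j m k : ℤ) : ∫ φ, cs n j φ * cs m k φ ∂circ =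
    ((if n + m = 0 then 2 * Real.pi * Real.cos ((j + k : ℤ) * (Real.pi / 2)) else 0) +
      (if n - m = 0 then 2 * Real.pi * Real.cos ((j - k : ℤ) * (Real.pi / 2)) else 0)) / 2 := by
  simp only [cs_mul_cs]
  have hi : ∀ n j, Integrable (cs n j) circ := fun n j =>
    ((continuous_cs n j).integrableOn_Icc (a := 0) (b := 2 * Real.pi)).mono_set Ioc_subset_Icc_self
  rw [integral_div, integral_add (hi _ _) (hi _ _), integral_cs, integral_cs]

/-- Parseval's identity. The complex Fourier coefficient of a real function is (2π)⁻¹ times the `j =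
0` mode plus i times the `j = 1` mode. The sum is over all integers, so each nonzero frequency is
counted twice. -/
theorem hasSum_sq_cs {f : ℝ → ℝ} (hf : MemLp f 2 circ) :
    HasSum (fun n : ℤ => (∫ φ, cs n 0 φ * f φ ∂circ) ^ 2 + (∫ φ, cs n 1 φ * f φ ∂circ) ^ 2)
      (2 * Real.pi * ∫ φ, f φ ^ 2 ∂circ) := by
  have hab : (0 : ℝ) < 2 * Real.pi := two_pi_pos
  have hL2 : MemLp (fun φ => (f φ : ℂ)) 2 (volume.restrict (Ioc 0 (2 * Real.pi))) := hf.ofReal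
  have H := (hasSum_sq_fourierCoeffOn hab hL2).mul_left ((2 * Real.pi) ^ 2)
  have hfi := MemLp.integrable_circ hf
  have key : ∀ n : ℤ, fourierCoeffOn hab (fun φ => (f φ : ℂ)) n = (2 * Real.pi : ℝ)⁻¹ •
      (((∫ φ, cs n 0 φ * f φ ∂circ : ℝ) : ℂ) +
        Complex.I * ((∫ φ, cs n 1 φ * f φ ∂circ : ℝ) : ℂ)) := by
    intro n
    rw [fourierCoeffOn_eq_integral, sub_zero, one_div,
      intervalIntegral.integral_of_le hab.le]
    congr 1
    rw [← integral_complex_ofReal, ← integral_complex_ofReal, ← integral_const_mul,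
      ← integral_add (integrable_cs_mul n 0 hfi).ofReal
        ((integrable_cs_mul n 1 hfi).ofReal.const_mul _)]
    refine integral_congr_ae (Eventually.of_forall fun φ => ?_)
    simp only [fourier_coe_apply, smul_eq_mul]
    rw [cs_zero, cs_one]
    have h1 : 2 * (Real.pi : ℂ) * Complex.I * ((-n : ℤ) : ℂ) * (φ : ℂ) / ((2 * Real.pi : ℝ) - 0 : ℝ)
        = ((-(n * φ) : ℝ) : ℂ) * Complex.I := by
      push_cast
      have : (Real.pi : ℂ) ≠ 0 := by exact_mod_cast Real.pi_ne_zero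
      field_simp
      ring
    rw [show (2 * Real.pi : ℝ) = ((2 * Real.pi : ℝ) - 0 : ℝ) by ring, h1, Complex.exp_mul_I,
      ← Complex.ofReal_cos, ← Complex.ofReal_sin, Real.cos_neg, Real.sin_neg]
    push_cast
    ring
  convert! H using 1
  · funext n
    rw [key, norm_smul, mul_pow (‖(2 * Real.pi : ℝ)⁻¹‖), Complex.sq_norm, Complex.normSq_apply]
    simp only [Complex.add_re, Complex.ofReal_re, Complex.mul_re, Complex.I_re, zero_mul,
      Complex.I_im, Complex.ofReal_im, mul_zero, sub_zero, add_zero, Complex.add_im,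
      Complex.mul_im, one_mul, zero_add, norm_inv, Real.norm_eq_abs, sq_abs, inv_pow]
    have : (2 * Real.pi) ^ 2 ≠ 0 := by positivity
    rw [mul_inv_cancel_left₀ this]
    ring
  · simp only [Complex.norm_real, Real.norm_eq_abs, sq_abs, sub_zero, smul_eq_mul]
    rw [← integral_circ]
    field_simp

/-- Completeness of the trigonometric system. All uniqueness statements on the surface are reduced
to it, slice by slice. -/
theorem ae_eq_zero_of_cs {f : ℝ → ℝ} (hf : MemLp f 2 circ)
    (h : ∀ n j : ℤ, ∫ φ, cs n j φ * f φ ∂circ = 0) : f =ᵐ[circ] 0 := by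
  have H := hasSum_sq_cs hf
  simp only [h, ne_eq, OfNat.ofNat_ne_zero, not_false_eq_true, zero_pow, add_zero] at H
  have h0 := H.unique hasSum_zero
  have h1 : ∫ φ, f φ ^ 2 ∂circ = 0 := by
    rcases mul_eq_zero.1 h0 with h | h
    · exact absurd h two_pi_pos.ne'
    · exact h
  have h2 := (integral_eq_zero_iff_of_nonneg (fun φ => sq_nonneg _) hf.integrable_sq).1 h1
  filter_upwards [h2] with φ hφ
  simpa using hφ

/-- The relation between the Fourier modes of a function and those of its weak derivative. -/
def IsWeakDerivCirc (f p : ℝ → ℝ) : Prop :=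
  ∀ n j : ℤ, ∫ φ, cs n j φ * p φ ∂circ = - (n * ∫ φ, cs n (j + 1) φ * f φ ∂circ)

/-- Parseval for p and for f, where the modes of p are n times those of f up to a shift of the
phase. The frequency n = 0 would contribute the negative term -(∫ f)², which is compensated on the
right-hand side, so that all remaining terms are nonnegative. -/
theorem hasSum_wirtinger {f p : ℝ → ℝ} (hf : MemLp f 2 circ) (hp : MemLp p 2 circ)
    (h : IsWeakDerivCirc f p) :
    HasSum (fun n : ℤ => ((n : ℝ) ^ 2 - 1) * (if n = 0 then 0 else
        ((∫ φ, cs n 0 φ * f φ ∂circ) ^ 2 + (∫ φ, cs n 1 φ * f φ ∂circ) ^ 2)))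
      (2 * Real.pi * (∫ φ, p φ ^ 2 ∂circ - ∫ φ, f φ ^ 2 ∂circ) + (∫ φ, f φ ∂circ) ^ 2) := by
  have h1 := ((hasSum_sq_cs hp).sub (hasSum_sq_cs hf)).add
    (hasSum_ite_eq (0 : ℤ) ((∫ φ, f φ ∂circ) ^ 2))
  convert! h1 using 1
  · funext n
    rw [h n 0, h n 1]
    have h2 : ∫ φ, cs n (1 + 1) φ * f φ ∂circ = - ∫ φ, cs n 0 φ * f φ ∂circ := by
      rw [← integral_neg]
      congr 1; funext φ
      have := cs_add_two n 0 φ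
      rw [zero_add] at this
      rw [show (1 + 1 : ℤ) = 2 by norm_num, this]; ring
    rw [h2, zero_add]
    split_ifs with hn
    · subst hn
      have e0 : ∀ φ, cs 0 0 φ = 1 := fun φ => by simp [cs]
      have e1 : ∀ φ, cs 0 1 φ = 0 := fun φ => by simp [cs]
      simp [e0, e1]
    · ring
  · ring

theorem wirtinger_term_nonneg (n : ℤ) {c : ℝ} (hc : 0 ≤ c) :
    0 ≤ ((n : ℝ) ^ 2 - 1) * (if n = 0 then 0 else c) := by
  split_ifs with h
  · simp
  · refine mul_nonneg ?_ hc
    have h1 : 1 ≤ |n| := Int.one_le_abs h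
    have : (1 : ℝ) ≤ (n : ℝ) ^ 2 := by
      have : (1 : ℤ) ≤ n ^ 2 := by nlinarith [sq_abs n]
      exact_mod_cast this
    linarith

/-- Wirtinger's inequality. -/
theorem wirtinger {f p : ℝ → ℝ} (hf : MemLp f 2 circ) (hp : MemLp p 2 circ)
    (h : IsWeakDerivCirc f p) :
    ∫ φ, f φ ^ 2 ∂circ ≤ ∫ φ, p φ ^ 2 ∂circ + (∫ φ, f φ ∂circ) ^ 2 / (2 * Real.pi) := by
  have h1 := (hasSum_wirtinger hf hp h).nonneg fun n => wirtinger_term_nonneg n (by positivity)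
  have h2 := two_pi_pos
  rw [← sub_nonneg, show ∫ φ, p φ ^ 2 ∂circ + (∫ φ, f φ ∂circ) ^ 2 / (2 * Real.pi) -
    ∫ φ, f φ ^ 2 ∂circ = (2 * Real.pi * (∫ φ, p φ ^ 2 ∂circ - ∫ φ, f φ ^ 2 ∂circ) +
      (∫ φ, f φ ∂circ) ^ 2) / (2 * Real.pi) by field_simp; ring]
  positivity

/-- The case of equality in Wirtinger's inequality. -/
theorem wirtinger_eq {f p : ℝ → ℝ} (hf : MemLp f 2 circ) (hp : MemLp p 2 circ)
    (h : IsWeakDerivCirc f p) (h0 : ∫ φ, f φ ∂circ = 0)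
    (he : ∫ φ, p φ ^ 2 ∂circ ≤ ∫ φ, f φ ^ 2 ∂circ) :
    f =ᵐ[circ] fun φ => Real.pi⁻¹ * (∫ θ, cs 1 0 θ * f θ ∂circ) * cs 1 0 φ +
      Real.pi⁻¹ * (∫ θ, cs 1 1 θ * f θ ∂circ) * cs 1 1 φ := by
  have h1 := hasSum_wirtinger hf hp h
  -- A sum of nonnegative terms (n² - 1)|f_n|² which vanishes leaves only the frequencies n = 1 and
  -- n = -1, the mode n = 0 being excluded by `h0`.
  have h2 : 2 * Real.pi * (∫ φ, p φ ^ 2 ∂circ - ∫ φ, f φ ^ 2 ∂circ) + (∫ φ, f φ ∂circ) ^ 2 = 0 := by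
    have h3 := wirtinger hf hp h
    rw [h0] at h3 ⊢
    have : ∫ φ, p φ ^ 2 ∂circ = ∫ φ, f φ ^ 2 ∂circ := le_antisymm he (by simpa using h3)
    rw [this]; ring
  rw [h2] at h1
  have h3 := (hasSum_zero_iff_of_nonneg
    fun n => wirtinger_term_nonneg n (by positivity)).1 h1
  have hmode : ∀ n : ℤ, n ≠ 1 → n ≠ -1 → ∫ φ, cs n 0 φ * f φ ∂circ = 0 ∧
      ∫ φ, cs n 1 φ * f φ ∂circ = 0 := by
    intro n hn1 hn2
    by_cases hn : n = 0
    · subst hn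
      have e0 : ∀ φ, cs 0 0 φ = 1 := fun φ => by simp [cs]
      have e1 : ∀ φ, cs 0 1 φ = 0 := fun φ => by simp [cs]
      simp [e0, e1, h0]
    · have h4 := congrFun h3 n
      simp only [hn, if_false, Pi.zero_apply, mul_eq_zero] at h4
      rcases h4 with h4 | h4
      · exfalso
        have h5 : (n : ℝ) ^ 2 = 1 := by linarith
        have h6 : n ^ 2 = 1 := by exact_mod_cast h5
        rcases (show n = 1 ∨ n = -1 by
          have : (n - 1) * (n + 1) = 0 := by linarith
          rcases mul_eq_zero.1 this with h | h <;> [left; right] <;> lia) with h | h <;> contradiction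
      · constructor <;> nlinarith [sq_nonneg (∫ φ, cs n 0 φ * f φ ∂circ),
          sq_nonneg (∫ φ, cs n 1 φ * f φ ∂circ)]
  set A := ∫ θ, cs 1 0 θ * f θ ∂circ with hA
  set B := ∫ θ, cs 1 1 θ * f θ ∂circ with hB
  have hcs : ∀ n j, MemLp (cs n j) 2 circ := fun n j =>
    MemLp.of_bound (continuous_cs n j).aestronglyMeasurable 1
      (Eventually.of_forall fun φ => by simpa using abs_cs_le n j φ)
  have hg : MemLp (fun φ => f φ - (Real.pi⁻¹ * A * cs 1 0 φ + Real.pi⁻¹ * B * cs 1 1 φ)) 2 circ :=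
    hf.sub (((hcs 1 0).const_mul _).add ((hcs 1 1).const_mul _))
  -- The difference of f and its first harmonic has no modes at all. The factor π⁻¹ normalizes ∫
  -- cos² = ∫ sin² = π.
  have hmz : ∀ n : ℤ, ∀ j : ℤ, (j = 0 ∨ j = 1) → ∫ φ, cs n j φ *
      (f φ - (Real.pi⁻¹ * A * cs 1 0 φ + Real.pi⁻¹ * B * cs 1 1 φ)) ∂circ = 0 := by
    intro n j hj
    have e : ∀ φ, cs n j φ * (f φ - (Real.pi⁻¹ * A * cs 1 0 φ + Real.pi⁻¹ * B * cs 1 1 φ)) =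
      cs n j φ * f φ - (Real.pi⁻¹ * A * (cs n j φ * cs 1 0 φ) +
        Real.pi⁻¹ * B * (cs n j φ * cs 1 1 φ)) := fun φ => by ring
    simp only [e]
    have i0 := integrable_cs_mul n j (MemLp.integrable_circ (hcs 1 0))
    have i1 := integrable_cs_mul n j (MemLp.integrable_circ (hcs 1 1))
    have i2 : Integrable (fun φ => Real.pi⁻¹ * A * (cs n j φ * cs 1 0 φ) +
        Real.pi⁻¹ * B * (cs n j φ * cs 1 1 φ)) circ := (i0.const_mul _).add (i1.const_mul _)
    rw [integral_sub (integrable_cs_mul n j (MemLp.integrable_circ hf)) i2, integral_add (i0.const_mul _) (i1.const_mul _),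
      integral_const_mul, integral_const_mul, integral_cs_mul_cs, integral_cs_mul_cs]
    have hpi := Real.pi_ne_zero
    have c0 : Real.cos (Real.pi / 2) = 0 := Real.cos_pi_div_two
    have c2 : Real.cos (2 * (Real.pi / 2)) = -1 := by
      rw [show 2 * (Real.pi / 2) = Real.pi by ring, Real.cos_pi]
    by_cases hn1 : n = 1
    · subst hn1
      rcases hj with rfl | rfl
      · simp [← hA, c0]; field_simp; ring
      · simp [← hB, c0]; field_simp; ring
    by_cases hn2 : n = -1
    · subst hn2
      have hs0 : ∀ φ, cs (-1) 0 φ = cs 1 0 φ := fun φ => by simp [cs_zero]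
      have hs1 : ∀ φ, cs (-1) 1 φ = - cs 1 1 φ := fun φ => by simp [cs_one]
      rcases hj with rfl | rfl
      · simp [hs0, ← hA, c0]; field_simp; ring
      · simp [hs1, integral_neg, ← hB, c0, one_add_one_eq_two, c2]; field_simp; ring
    · have g1 : n + 1 ≠ 0 := by lia
      have g2 : n - 1 ≠ 0 := by lia
      simp only [g1, g2, if_false, add_zero, zero_div, mul_zero, sub_zero]
      rcases hj with rfl | rfl
      · exact (hmode n hn1 hn2).1
      · exact (hmode n hn1 hn2).2
  have H := hasSum_sq_cs hg
  have h5 : ∀ n : ℤ, (∫ φ, cs n 0 φ * (f φ - (Real.pi⁻¹ * A * cs 1 0 φ +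
      Real.pi⁻¹ * B * cs 1 1 φ)) ∂circ) ^ 2 + (∫ φ, cs n 1 φ * (f φ - (Real.pi⁻¹ * A * cs 1 0 φ +
      Real.pi⁻¹ * B * cs 1 1 φ)) ∂circ) ^ 2 = 0 := fun n => by
    rw [hmz n 0 (Or.inl rfl), hmz n 1 (Or.inr rfl)]; simp
  simp only [h5] at H
  have h6 : ∫ φ, (f φ - (Real.pi⁻¹ * A * cs 1 0 φ + Real.pi⁻¹ * B * cs 1 1 φ)) ^ 2 ∂circ = 0 := by
    rcases mul_eq_zero.1 (H.unique hasSum_zero) with h | h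
    · exact absurd h two_pi_pos.ne'
    · exact h
  have h7 := (integral_eq_zero_iff_of_nonneg (fun φ => sq_nonneg _) hg.integrable_sq).1 h6
  filter_upwards [h7] with φ hφ
  have h8 : f φ - (Real.pi⁻¹ * A * cs 1 0 φ + Real.pi⁻¹ * B * cs 1 1 φ) = 0 := by simpa using hφ
  linarith

/-- A function whose weak derivative vanishes is constant. -/
theorem ae_eq_mean_of_deriv_zero {f p : ℝ → ℝ} (hf : MemLp f 2 circ) 
    (h : IsWeakDerivCirc f p) (hp : p =ᵐ[circ] 0) :
    f =ᵐ[circ] fun _ => (2 * Real.pi)⁻¹ * ∫ θ, f θ ∂circ := by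
  set m := (2 * Real.pi)⁻¹ * ∫ θ, f θ ∂circ with hm
  have hg : MemLp (fun φ => f φ - m) 2 circ := hf.sub (memLp_const m)
  have : (fun φ => f φ - m) =ᵐ[circ] 0 := by
    refine ae_eq_zero_of_cs hg fun n j => ?_
    have hic : Integrable (cs n j) circ := 
      (continuous_cs n j).integrableOn_Icc.mono_set Ioc_subset_Icc_self
    simp only [mul_sub]
    rw [integral_sub (integrable_cs_mul n j (MemLp.integrable_circ hf)) (hic.mul_const m),
      integral_mul_const, integral_cs]
    by_cases hn : n = 0
    · subst hn
      simp only [if_true, cs, Int.cast_zero, zero_mul, zero_add]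
      rw [integral_const_mul, hm]
      have := two_pi_pos.ne'
      field_simp
      ring
    · rw [if_neg hn, zero_mul, sub_zero]
      -- A nonzero mode of f is, up to the factor -n, a mode of the derivative p, which vanishes.
      have h1 := h n (j - 1)
      rw [sub_add_cancel] at h1
      have h2 : ∫ φ, cs n (j - 1) φ * p φ ∂circ = 0 := by
        rw [integral_congr_ae (g := fun _ => (0 : ℝ))]
        · simp
        · filter_upwards [hp] with φ hφ
          simp [hφ]
      rw [h2] at h1
      have hn' : (n : ℝ) ≠ 0 := Int.cast_ne_zero.2 hn
      have h3 : (n : ℝ) * ∫ φ, cs n j φ * f φ ∂circ = 0 := by linarith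
      exact (mul_eq_zero.1 h3).resolve_left hn'
  filter_upwards [this] with φ hφ
  have h8 : f φ - m = 0 := by simpa using hφ
  linarith

end AxialMaps

/-! ### Rotations, geometry of the surface, and its area measure in coordinates -/

namespace AxialMaps

@[simp] theorem axialRot_zero_apply (φ : ℝ) (v : E3) :
    axialRot φ v 0 = Real.cos φ * v 0 - Real.sin φ * v 1 := rfl

@[simp] theorem axialRot_one_apply (φ : ℝ) (v : E3) :
    axialRot φ v 1 = Real.sin φ * v 0 + Real.cos φ * v 1 := rfl

@[simp] theorem axialRot_two_apply (φ : ℝ) (v : E3) : axialRot φ v 2 = v 2 := rfl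

theorem E3.ext' {v w : E3} (h0 : v 0 = w 0) (h1 : v 1 = w 1) (h2 : v 2 = w 2) : v = w := by
  ext i
  fin_cases i <;> assumption

theorem axialRot_add (φ ψ : ℝ) (v : E3) : axialRot (φ + ψ) v = axialRot φ (axialRot ψ v) := by
  apply E3.ext' <;> simp [Real.cos_add, Real.sin_add] <;> ring

theorem axialRot_zero (v : E3) : axialRot 0 v = v := by
  apply E3.ext' <;> simp

theorem axialRot_neg_axialRot (φ : ℝ) (v : E3) : axialRot (-φ) (axialRot φ v) = v := by
  rw [← axialRot_add, neg_add_cancel, axialRot_zero]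

theorem axialRot_axialRot_neg (φ : ℝ) (v : E3) : axialRot φ (axialRot (-φ) v) = v := by
  rw [← axialRot_add, add_neg_cancel, axialRot_zero]

theorem E3.norm_sq (v : E3) : ‖v‖ ^ 2 = v 0 ^ 2 + v 1 ^ 2 + v 2 ^ 2 := by
  simp [EuclideanSpace.norm_sq_eq, Fin.sum_univ_three]

theorem E3.inner_eq (v w : E3) : inner ℝ v w = v 0 * w 0 + v 1 * w 1 + v 2 * w 2 := by
  simp [PiLp.inner_apply, Fin.sum_univ_three, mul_comm]

theorem axialRot_perp_sq (φ : ℝ) (v : E3) :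
    axialRot φ v 0 ^ 2 + axialRot φ v 1 ^ 2 = v 0 ^ 2 + v 1 ^ 2 := by
  simp only [axialRot_zero_apply, axialRot_one_apply]
  nlinarith [Real.sin_sq_add_cos_sq φ]

theorem norm_sq_axialRot (φ : ℝ) (v : E3) : ‖axialRot φ v‖ ^ 2 = ‖v‖ ^ 2 := by
  rw [E3.norm_sq, E3.norm_sq, axialRot_perp_sq, axialRot_two_apply]

theorem norm_axialRot (φ : ℝ) (v : E3) : ‖axialRot φ v‖ = ‖v‖ := by
  have := norm_sq_axialRot φ v
  exact (sq_eq_sq₀ (norm_nonneg _) (norm_nonneg _)).1 this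

theorem inner_axialRot (φ : ℝ) (v w : E3) :
    inner ℝ (axialRot φ v) (axialRot φ w) = (inner ℝ v w : ℝ) := by
  simp only [E3.inner_eq, axialRot_zero_apply, axialRot_one_apply, axialRot_two_apply]
  linear_combination (v 0 * w 0 + v 1 * w 1) * Real.sin_sq_add_cos_sq φ

theorem continuous_coord (i : Fin 3) : Continuous fun v : E3 => v i :=
  (EuclideanSpace.proj (𝕜 := ℝ) i).continuous

theorem continuous_E3 {X : Type*} [TopologicalSpace X] {f g h : X → ℝ} (hf : Continuous f)
    (hg : Continuous g) (hh : Continuous h) : Continuous fun x => (!₂[f x, g x, h x] : E3) := by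
  refine (PiLp.continuous_toLp 2 _).comp (continuous_pi fun i => ?_)
  fin_cases i <;> assumption

theorem continuous_axialRot : Continuous fun p : ℝ × E3 => axialRot p.1 p.2 := by
  have h0 := (continuous_coord 0).comp (continuous_snd (X := ℝ) (Y := E3))
  have h1 := (continuous_coord 1).comp (continuous_snd (X := ℝ) (Y := E3))
  have h2 := (continuous_coord 2).comp (continuous_snd (X := ℝ) (Y := E3))
  have hc := Real.continuous_cos.comp (continuous_fst (X := ℝ) (Y := E3))
  have hs := Real.continuous_sin.comp (continuous_fst (X := ℝ) (Y := E3))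
  exact continuous_E3 ((hc.mul h0).sub (hs.mul h1)) ((hs.mul h0).add (hc.mul h1)) h2

theorem axialRot_add_two_pi (φ : ℝ) (v : E3) : axialRot (φ + 2 * Real.pi) v = axialRot φ v := by
  apply E3.ext' <;> simp

theorem norm_sq_crossE3 (v : E3) : ‖crossE3 v‖ ^ 2 = v 0 ^ 2 + v 1 ^ 2 := by
  rw [E3.norm_sq]; simp [crossE3]; ring

namespace RevSurface

variable (S : RevSurface)

theorem param_eq (φ t : ℝ) :
    S.param φ t = !₂[Real.cos φ * S.x t, Real.sin φ * S.x t, S.z t] := by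
  apply E3.ext' <;> simp [param, curve]

@[simp] theorem param_apply_zero (φ t : ℝ) : S.param φ t 0 = Real.cos φ * S.x t := by
  rw [param_eq]; rfl

@[simp] theorem param_apply_one (φ t : ℝ) : S.param φ t 1 = Real.sin φ * S.x t := by
  rw [param_eq]; rfl

@[simp] theorem param_apply_two (φ t : ℝ) : S.param φ t 2 = S.z t := by
  rw [param_eq]; rfl

theorem axialRot_param (ψ φ t : ℝ) : axialRot ψ (S.param φ t) = S.param (ψ + φ) t := by
  rw [param, param, axialRot_add]

theorem param_add_two_pi (φ t : ℝ) : S.param (φ + 2 * Real.pi) t = S.param φ t :=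
  axialRot_add_two_pi _ _

theorem param_zero (t : ℝ) : S.param 0 t = S.curve t := axialRot_zero _

theorem param_mem (φ : ℝ) {t : ℝ} (ht : t ∈ Icc S.a S.b) : S.param φ t ∈ S.carrier :=
  ⟨φ, t, ht, rfl⟩

theorem continuous_x : Continuous S.x := S.contDiff_x.continuous

theorem continuous_z : Continuous S.z := S.contDiff_z.continuous

theorem continuous_param : Continuous fun p : ℝ × ℝ => S.param p.1 p.2 := by
  simp only [param_eq]
  have hx := S.continuous_x.comp (continuous_snd (X := ℝ) (Y := ℝ))
  have hz := S.continuous_z.comp (continuous_snd (X := ℝ) (Y := ℝ))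
  exact continuous_E3 ((Real.continuous_cos.comp continuous_fst).mul hx)
    ((Real.continuous_sin.comp continuous_fst).mul hx) hz

theorem carrier_eq_image :
    S.carrier = (fun p : ℝ × ℝ => S.param p.1 p.2) '' (Icc 0 (2 * Real.pi) ×ˢ Icc S.a S.b) := by
  ext ξ
  constructor
  · rintro ⟨φ, t, ht, rfl⟩
    obtain ⟨y, hy, hye⟩ := (show Function.Periodic (fun φ => S.param φ t) (2 * Real.pi) from
      fun φ => S.param_add_two_pi φ t).exists_mem_Ico₀ two_pi_pos φ
    exact ⟨(y, t), ⟨Ico_subset_Icc_self hy, ht⟩, hye.symm⟩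
  · rintro ⟨⟨φ, t⟩, ⟨-, ht⟩, rfl⟩
    exact ⟨φ, t, ht, rfl⟩

theorem isCompact_carrier : IsCompact S.carrier := by
  rw [carrier_eq_image]
  exact (isCompact_Icc.prod isCompact_Icc).image S.continuous_param

theorem isClosed_carrier : IsClosed S.carrier := S.isCompact_carrier.isClosed

theorem axialRot_mem {v : E3} (hv : v ∈ S.carrier) (φ : ℝ) : axialRot φ v ∈ S.carrier := by
  obtain ⟨ψ, t, ht, rfl⟩ := hv
  rw [axialRot_param]
  exact S.param_mem _ ht

theorem exists_bound_carrier : ∃ B, 0 ≤ B ∧ ∀ v ∈ S.carrier, ‖v‖ ≤ B := by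
  obtain ⟨B, hB⟩ := S.isCompact_carrier.isBounded.exists_norm_le
  exact ⟨max B 0, le_max_right _ _, fun v hv => (hB v hv).trans (le_max_left _ _)⟩

/-- An interior zero would be a minimum of x, so x' = 0 there. The curve meets the axis
perpendicularly, so z' = 0 as well, against regularity. -/
theorem x_pos {t : ℝ} (ht : t ∈ Ioo S.a S.b) : 0 < S.x t := by
  have htI := Ioo_subset_Icc_self ht
  refine (S.nonneg t htI).lt_of_ne fun h0 => ?_
  have hmin : IsLocalMin S.x t := by
    filter_upwards [Ioo_mem_nhds ht.1 ht.2] with s hs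
    rw [← h0]
    exact S.nonneg s (Ioo_subset_Icc_self hs)
  exact S.regular t htI ⟨hmin.deriv_eq_zero, S.axis_perp t htI h0.symm⟩

/-- Only endpoints of the generating curve lie on the axis. Used for the target, this leaves at most
two possible heights for limits at the axis. -/
theorem axis_z {v : E3} (hv : v ∈ S.carrier) (h0 : v 0 = 0) (h1 : v 1 = 0) :
    v 2 ∈ ({S.z S.a, S.z S.b} : Set ℝ) := by
  obtain ⟨φ, t, ht, rfl⟩ := hv
  simp only [param_apply_zero, param_apply_one] at h0 h1
  have hx : S.x t = 0 := by
    have : S.x t ^ 2 = 0 := by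
      have := Real.sin_sq_add_cos_sq φ
      linear_combination (-S.x t ^ 2) * this + Real.cos φ * S.x t * h0 + Real.sin φ * S.x t * h1
    exact pow_eq_zero_iff (two_ne_zero) |>.1 this
  rw [param_apply_two]
  have hn : t ∉ Ioo S.a S.b := fun h => (S.x_pos h).ne' hx
  rcases ht.1.eq_or_lt with h | h
  · left; rw [h]
  · rcases ht.2.eq_or_lt with h' | h'
    · right; rw [h']; rfl
    · exact absurd ⟨h, h'⟩ hn

theorem speed_pos {t : ℝ} (ht : t ∈ Icc S.a S.b) : 0 < S.speed t := by
  refine Real.sqrt_pos.2 ((by positivity : (0:ℝ) ≤ _).lt_of_ne fun h => S.regular t ht ?_)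
  constructor <;> nlinarith [sq_nonneg (deriv S.x t), sq_nonneg (deriv S.z t)]

theorem continuous_speed : Continuous S.speed :=
  (((S.contDiff_x.continuous_deriv le_rfl).pow 2).add
    ((S.contDiff_z.continuous_deriv le_rfl).pow 2)).sqrt

theorem exists_weight_bounds : ∃ c C : ℝ, 0 < c ∧ 0 < C ∧ ∀ t ∈ Icc S.a S.b,
    c ≤ S.speed t ∧ S.speed t ≤ C ∧ S.x t ≤ C := by
  have hne : (Icc S.a S.b).Nonempty := nonempty_Icc.2 S.lt.le
  obtain ⟨t0, ht0, h0⟩ := isCompact_Icc.exists_isMinOn hne S.continuous_speed.continuousOn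
  obtain ⟨t1, ht1, h1⟩ := isCompact_Icc.exists_isMaxOn hne S.continuous_speed.continuousOn
  obtain ⟨t2, ht2, h2⟩ := isCompact_Icc.exists_isMaxOn hne S.continuous_x.continuousOn
  exact ⟨S.speed t0, max (S.speed t1) (S.x t2), S.speed_pos ht0,
    (S.speed_pos ht1).trans_le (le_max_left _ _), fun t ht => ⟨h0 ht,
    (h1 ht).trans (le_max_left _ _), (h2 ht).trans (le_max_right _ _)⟩⟩

theorem exists_x_lipschitz : ∃ C : ℝ, ∀ s ∈ Icc S.a S.b, ∀ t ∈ Icc S.a S.b,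
    |S.x t - S.x s| ≤ C * |t - s| := by
  obtain ⟨C, hC⟩ := (isCompact_Icc (a := S.a) (b := S.b)).exists_bound_of_continuousOn
    (S.contDiff_x.continuous_deriv le_rfl).continuousOn
  refine ⟨C, fun s hs t ht => ?_⟩
  exact (convex_Icc S.a S.b).norm_image_sub_le_of_norm_deriv_le
    (fun x _ => S.contDiff_x.differentiable one_ne_zero x) hC hs ht

theorem x_eq_of_param_eq {φ ψ s t : ℝ} (hs : s ∈ Icc S.a S.b) (ht : t ∈ Icc S.a S.b)
    (h : S.param φ s = S.param ψ t) : S.x s = S.x t ∧ S.z s = S.z t ∧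
      (S.x s = 0 ∨ (Real.cos φ = Real.cos ψ ∧ Real.sin φ = Real.sin ψ)) := by
  have h0 : Real.cos φ * S.x s = Real.cos ψ * S.x t := by
    simpa using congrArg (fun v : E3 => v 0) h
  have h1 : Real.sin φ * S.x s = Real.sin ψ * S.x t := by
    simpa using congrArg (fun v : E3 => v 1) h
  have h2 : S.z s = S.z t := by simpa using congrArg (fun v : E3 => v 2) h
  have hx2 : S.x s ^ 2 = S.x t ^ 2 := by
    have e1 := Real.sin_sq_add_cos_sq φ
    have e2 := Real.sin_sq_add_cos_sq ψ
    linear_combination (-S.x s ^ 2) * e1 + S.x t ^ 2 * e2 +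
      (Real.cos φ * S.x s + Real.cos ψ * S.x t) * h0 +
      (Real.sin φ * S.x s + Real.sin ψ * S.x t) * h1
  have hx : S.x s = S.x t := (sq_eq_sq₀ (S.nonneg s hs) (S.nonneg t ht)).1 hx2
  refine ⟨hx, h2, ?_⟩
  by_cases hz : S.x s = 0
  · exact Or.inl hz
  · right
    rw [← hx] at h0 h1
    exact ⟨mul_right_cancel₀ hz h0, mul_right_cancel₀ hz h1⟩

theorem t_eq_of_param_eq {φ ψ s t : ℝ} (hs : s ∈ Icc S.a S.b) (ht : t ∈ Icc S.a S.b)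
    (h : S.param φ s = S.param ψ t) :
    s = t ∨ (S.IsLoop ∧ ((s = S.a ∧ t = S.b) ∨ (s = S.b ∧ t = S.a))) := by
  obtain ⟨hx, hz, -⟩ := S.x_eq_of_param_eq hs ht h
  have hloop : ∀ {s t}, s = S.a → t = S.b → S.x s = S.x t → S.z s = S.z t → S.IsLoop := by
    rintro s t rfl rfl hx hz
    simp [IsLoop, curve, hx, hz]
  rcases lt_trichotomy s t with hlt | heq | hgt
  · obtain ⟨h1, h2⟩ := S.simple s hs t ht hlt hx hz
    exact Or.inr ⟨hloop h1 h2 hx hz, Or.inl ⟨h1, h2⟩⟩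
  · exact Or.inl heq
  · obtain ⟨h1, h2⟩ := S.simple t ht s hs hgt hx.symm hz.symm
    exact Or.inr ⟨hloop h1 h2 hx.symm hz.symm, Or.inr ⟨h2, h1⟩⟩

/-- The common endpoint of a loop is off the axis, because endpoints on the axis have different
heights. So no weight degenerates on a torus. -/
theorem IsLoop.x_pos {S : RevSurface} (h : S.IsLoop) {t : ℝ} (ht : t ∈ Icc S.a S.b) :
    0 < S.x t := by
  have h0 : S.x S.a = S.x S.b := by simpa [curve] using congrArg (fun v : E3 => v 0) h
  have h2 : S.z S.a = S.z S.b := by simpa [curve] using congrArg (fun v : E3 => v 2) h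
  have ha : S.x S.a ≠ 0 := fun hz => S.axis_ne hz (h0 ▸ hz) h2
  refine (S.nonneg t ht).lt_of_ne fun hz => ?_
  rcases ht.1.eq_or_lt with e | e
  · exact ha (e ▸ hz.symm)
  · rcases ht.2.eq_or_lt with e' | e'
    · exact ha (h0 ▸ e' ▸ hz.symm)
    · exact (S.x_pos ⟨e, e'⟩).ne hz

theorem eq_of_cos_eq_sin_eq {φ ψ : ℝ} (hφ : φ ∈ Ioc 0 (2 * Real.pi))
    (hψ : ψ ∈ Ioc 0 (2 * Real.pi)) (hc : Real.cos φ = Real.cos ψ) (hs : Real.sin φ = Real.sin ψ) :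
    φ = ψ := by
  have h := Real.Angle.cos_sin_inj hc hs
  rw [Real.Angle.angle_eq_iff_two_pi_dvd_sub] at h
  obtain ⟨k, hk⟩ := h
  have h1 := hφ.1; have h2 := hφ.2; have h3 := hψ.1; have h4 := hψ.2
  have hk0 : k = 0 := by
    have hp := two_pi_pos
    have : (k : ℝ) < 1 := by
      by_contra hcon
      rw [not_lt] at hcon
      nlinarith
    have h' : (-1 : ℝ) < k := by
      by_contra hcon
      rw [not_lt] at hcon
      nlinarith
    have a1 : k < 1 := by exact_mod_cast this
    have a2 : -1 < k := by exact_mod_cast h'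
    lia
  rw [hk0, Int.cast_zero, mul_zero] at hk
  linarith

/-- Lebesgue measure on the open parameter interval. -/
noncomputable abbrev mI : Measure ℝ := volume.restrict (Ioo S.a S.b)

/-- Lebesgue measure on the chart. -/
noncomputable abbrev mC : Measure (ℝ × ℝ) := circ.prod S.mI

theorem restrict_chart : volume.restrict S.chart = S.mC := by
  rw [chart, Measure.volume_eq_prod, ← Measure.prod_restrict, mC, mI,
    Measure.restrict_congr_set (Ioo_ae_eq_Icc (μ := volume) (a := S.a) (b := S.b))]

/-- The chart without its boundary circles. -/
def openChart : Set (ℝ × ℝ) := Ioc 0 (2 * Real.pi) ×ˢ Ioo S.a S.b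

theorem measurableSet_openChart : MeasurableSet S.openChart :=
  measurableSet_Ioc.prod measurableSet_Ioo

theorem mC_eq : S.mC = volume.restrict S.openChart := by
  rw [openChart, Measure.volume_eq_prod, ← Measure.prod_restrict]

theorem ae_mC_mem : ∀ᵐ p ∂S.mC, p ∈ S.openChart := by
  rw [mC_eq]; exact ae_restrict_mem S.measurableSet_openChart

theorem injOn_param : InjOn (fun p : ℝ × ℝ => S.param p.1 p.2) S.openChart := by
  rintro ⟨φ, s⟩ ⟨hφ, hs⟩ ⟨ψ, t⟩ ⟨hψ, ht⟩ h
  have hsI := Ioo_subset_Icc_self hs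
  have htI := Ioo_subset_Icc_self ht
  have h1 : s = t := by
    rcases S.t_eq_of_param_eq hsI htI h with h | ⟨-, ⟨h, -⟩ | ⟨h, -⟩⟩
    · exact h
    · exact absurd h hs.1.ne'
    · exact absurd h hs.2.ne
  obtain ⟨-, -, hz | ⟨hc, hsn⟩⟩ := S.x_eq_of_param_eq hsI htI h
  · exact absurd hz (S.x_pos hs).ne'
  · exact Prod.ext (eq_of_cos_eq_sin_eq hφ hψ hc hsn) h1

/-- An injective continuous map on a Borel set is a measurable embedding. This allows integrals to
be transported to the chart without any measurability of the integrand. -/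
theorem measurableEmbedding_param :
    MeasurableEmbedding (S.openChart.domRestrict fun p : ℝ × ℝ => S.param p.1 p.2) :=
  S.continuous_param.continuousOn.measurableEmbedding S.measurableSet_openChart S.injOn_param

theorem continuous_areaDensity : Continuous S.areaDensity := S.continuous_x.mul S.continuous_speed

theorem areaDensity_pos {t : ℝ} (ht : t ∈ Ioo S.a S.b) : 0 < S.areaDensity t :=
  mul_pos (S.x_pos ht) (S.speed_pos (Ioo_subset_Icc_self ht))

/-- The area measure in coordinates. -/
noncomputable def chartArea : Measure (ℝ × ℝ) :=
  S.mC.withDensity fun p => ENNReal.ofReal (S.areaDensity p.2)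

theorem measurable_density : Measurable fun p : ℝ × ℝ => ENNReal.ofReal (S.areaDensity p.2) :=
  ENNReal.measurable_ofReal.comp (S.continuous_areaDensity.measurable.comp measurable_snd)

theorem chartArea_restrict : S.chartArea.restrict S.openChart = S.chartArea := by
  rw [chartArea, restrict_withDensity S.measurableSet_openChart, mC_eq, Measure.restrict_restrict
    S.measurableSet_openChart, inter_self]

theorem area_eq_map : S.area = Measure.map (S.openChart.domRestrict fun p : ℝ × ℝ =>
    S.param p.1 p.2) (S.chartArea.comap Subtype.val) := by
  have h1 : S.openChart.domRestrict (fun p : ℝ × ℝ => S.param p.1 p.2) =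
    (fun p : ℝ × ℝ => S.param p.1 p.2) ∘ Subtype.val := rfl
  rw [h1, ← Measure.map_map S.continuous_param.measurable measurable_subtype_coe,
    map_comap_subtype_coe S.measurableSet_openChart, chartArea_restrict, area, restrict_chart]
  rfl

theorem lintegral_area (h : E3 → ℝ≥0∞) : ∫⁻ ξ, h ξ ∂S.area =
    ∫⁻ p, h (S.param p.1 p.2) * ENNReal.ofReal (S.areaDensity p.2) ∂S.mC := by
  rw [area_eq_map, S.measurableEmbedding_param.lintegral_map]
  have := lintegral_subtype_comap (μ := S.chartArea) S.measurableSet_openChart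
    (fun p => h (S.param p.1 p.2))
  simp only [domRestrict_apply]
  rw [this, chartArea_restrict, chartArea,
    lintegral_withDensity_eq_lintegral_mul_non_measurable _ S.measurable_density
      (Eventually.of_forall fun _ => ENNReal.ofReal_lt_top)]
  simp only [Pi.mul_apply, mul_comm]

/-- The area density is positive off the boundary circles, so the null sets are those of Lebesgue
measure on the chart. -/
theorem ae_chartArea_iff {p : ℝ × ℝ → Prop} : (∀ᵐ q ∂S.chartArea, p q) ↔ ∀ᵐ q ∂S.mC, p q := by
  rw [chartArea, ae_withDensity_iff S.measurable_density]
  refine eventually_congr ?_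
  filter_upwards [S.ae_mC_mem] with q hq
  have : ENNReal.ofReal (S.areaDensity q.2) ≠ 0 := by
    rw [Ne, ENNReal.ofReal_eq_zero, not_le]
    exact S.areaDensity_pos hq.2
  simp [this]

theorem ae_area_iff {p : E3 → Prop} :
    (∀ᵐ ξ ∂S.area, p ξ) ↔ ∀ᵐ q ∂S.mC, p (S.param q.1 q.2) := by
  rw [← ae_chartArea_iff, area_eq_map, S.measurableEmbedding_param.ae_map_iff]
  simp only [domRestrict_apply]
  have h2 : S.chartArea = Measure.map Subtype.val (S.chartArea.comap
      (Subtype.val : S.openChart → ℝ × ℝ)) := by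
    rw [map_comap_subtype_coe S.measurableSet_openChart, chartArea_restrict]
  conv_rhs => rw [h2]
  rw [(MeasurableEmbedding.subtype_coe S.measurableSet_openChart).ae_map_iff]

theorem aestronglyMeasurable_area_iff {m : E3 → E3} : AEStronglyMeasurable m S.area ↔
    AEStronglyMeasurable (fun p : ℝ × ℝ => m (S.param p.1 p.2)) S.mC := by
  have hac : S.mC ≪ S.chartArea := fun s hs => by
    have : ∀ᵐ q ∂S.chartArea, q ∉ s := by simpa [ae_iff] using hs
    rw [ae_chartArea_iff] at this
    simpa [ae_iff] using this
  have hac' : S.chartArea ≪ S.mC := withDensity_absolutelyContinuous _ _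
  constructor
  · intro h
    have h1 : S.area = Measure.map (fun p : ℝ × ℝ => S.param p.1 p.2) S.chartArea := by
      rw [area, restrict_chart]; rfl
    rw [h1] at h
    exact (h.comp_measurable S.continuous_param.measurable).mono_ac hac
  · intro h
    rw [area_eq_map, S.measurableEmbedding_param.aestronglyMeasurable_map_iff]
    have h2 : AEStronglyMeasurable (fun p : ℝ × ℝ => m (S.param p.1 p.2))
        (Measure.map Subtype.val (S.chartArea.comap (Subtype.val : S.openChart → ℝ × ℝ))) := by
      rw [map_comap_subtype_coe S.measurableSet_openChart, chartArea_restrict]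
      exact h.mono_ac hac'
    exact h2.comp_measurable measurable_subtype_coe

instance : IsFiniteMeasure circ := inferInstance

instance : IsFiniteMeasure S.area := by
  refine ⟨?_⟩
  obtain ⟨c, C, hc, hC, hb⟩ := S.exists_weight_bounds
  rw [← lintegral_one, lintegral_area]
  have : ∫⁻ p, 1 * ENNReal.ofReal (S.areaDensity p.2) ∂S.mC ≤
      ∫⁻ p, ENNReal.ofReal (C * C) ∂S.mC := by
    refine lintegral_mono_ae ?_
    filter_upwards [S.ae_mC_mem] with p hp
    rw [one_mul]
    have := hb p.2 (Ioo_subset_Icc_self hp.2)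
    exact ENNReal.ofReal_le_ofReal (mul_le_mul this.2.2 this.2.1
      (hc.le.trans this.1) hC.le)
  refine this.trans_lt ?_
  rw [lintegral_const]
  exact ENNReal.mul_lt_top ENNReal.ofReal_lt_top (measure_lt_top _ _)

theorem periodic_comp_param (m : E3 → E3) (t : ℝ) :
    Function.Periodic (fun φ => m (S.param φ t)) (2 * Real.pi) := fun φ => by
  simp only [param_add_two_pi]

/-- The average over a full period does not depend on the starting angle. -/
theorem circleMean_param (m : E3 → E3) (φ t : ℝ) :
    circleMean m (S.param φ t) = (2 * Real.pi)⁻¹ • ∫ θ, m (S.param θ t) ∂circ := by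
  rw [circleMean]
  congr 1
  simp only [axialRot_param]
  rw [intervalIntegral.integral_comp_add_right (fun θ => m (S.param θ t)), zero_add, add_comm,
    (S.periodic_comp_param m t).intervalIntegral_add_eq φ 0, zero_add,
    intervalIntegral.integral_of_le two_pi_pos.le]

end RevSurface

end AxialMaps

/-! ### Weak gradients on the chart and their Fourier modes -/

namespace AxialMaps

/-- The variance of f about its mean is nonnegative. -/
theorem sq_integral_le {X : Type*} [MeasurableSpace X] {μ : Measure X} [IsFiniteMeasure μ]
    {f : X → ℝ} (hf : MemLp f 2 μ) : (∫ x, f x ∂μ) ^ 2 ≤ μ.real univ * ∫ x, f x ^ 2 ∂μ := by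
  have hfi : Integrable f μ := hf.integrable one_le_two
  rcases eq_or_ne (μ.real univ) 0 with h0 | h0
  · have : μ = 0 := by
      rw [measureReal_eq_zero_iff] at h0
      exact Measure.measure_univ_eq_zero.1 h0
    simp [this]
  · have hpos : 0 < μ.real univ := measureReal_nonneg.lt_of_ne' h0
    set I := ∫ x, f x ∂μ with hI
    set m := I / μ.real univ with hm
    have h1 : 0 ≤ ∫ x, (f x - m) ^ 2 ∂μ := integral_nonneg fun x => sq_nonneg _
    have h2 : ∀ x, (f x - m) ^ 2 = f x ^ 2 - (2 * m * f x - m ^ 2) := fun x => by ring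
    have hi : Integrable (fun x => 2 * m * f x - m ^ 2) μ :=
      (hfi.const_mul _).sub (integrable_const _)
    simp only [h2] at h1
    rw [integral_sub hf.integrable_sq hi, integral_sub (hfi.const_mul _) (integrable_const _),
      integral_const_mul, integral_const, smul_eq_mul, ← hI] at h1
    have h3 : m * μ.real univ = I := by rw [hm]; field_simp
    nlinarith

/-- The set where f = 0 need not be measurable, so Fubini for null sets is applied to a measurable
representative. -/
theorem ae_prod_of_ae_ae_swap {X Y : Type*} [MeasurableSpace X] [MeasurableSpace Y]
    {μ : Measure X} {ν : Measure Y} [SFinite μ] [SFinite ν] {f : X × Y → ℝ}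
    (hf : AEStronglyMeasurable f (μ.prod ν)) (h : ∀ᵐ y ∂ν, ∀ᵐ x ∂μ, f (x, y) = 0) :
    ∀ᵐ q ∂μ.prod ν, f q = 0 := by
  have h1 := hf.ae_eq_mk
  have hm : MeasurableSet {q : X × Y | hf.mk f q = 0} :=
    hf.stronglyMeasurable_mk.measurable (measurableSet_singleton 0)
  have h2 : ∀ᵐ y ∂ν, ∀ᵐ x ∂μ, f (x, y) = hf.mk f (x, y) := by
    have := (Measure.measurePreserving_swap (μ := ν) (ν := μ)).quasiMeasurePreserving.ae h1
    exact Measure.ae_ae_of_ae_prod this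
  have h3 : ∀ᵐ y ∂ν, ∀ᵐ x ∂μ, hf.mk f (x, y) = 0 := by
    filter_upwards [h, h2] with y hy1 hy2
    filter_upwards [hy1, hy2] with x hx1 hx2
    rw [← hx2, hx1]
  have h4 : ∀ᵐ x ∂μ, ∀ᵐ y ∂ν, hf.mk f (x, y) = 0 :=
    (Measure.ae_ae_comm (p := fun x y => hf.mk f (x, y) = 0) hm).2 h3
  have h5 : ∀ᵐ q ∂μ.prod ν, hf.mk f q = 0 := (Measure.ae_prod_iff_ae_ae hm).2 h4
  filter_upwards [h1, h5] with q hq1 hq2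
  rw [hq1, hq2]

namespace RevSurface

variable (S : RevSurface)

/-- `p` and `q` are the weak partial derivatives of the bounded function `u` on the chart. -/
structure ScalarWG (u p q : ℝ × ℝ → ℝ) : Prop where
  aesm : AEStronglyMeasurable u S.mC
  bdd : ∃ B, ∀ᵐ r ∂S.mC, |u r| ≤ B
  aesm_left : AEStronglyMeasurable p S.mC
  aesm_right : AEStronglyMeasurable q S.mC
  int_left : Integrable (fun r => p r ^ 2) S.mC
  int_right : Integrable (fun r => S.x r.2 * q r ^ 2) S.mC
  weak_left : ∀ ψ, S.IsTest ψ →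
    ∫ r, fderiv ℝ ψ r (1, 0) * u r ∂S.mC = - ∫ r, ψ r * p r ∂S.mC
  weak_right : ∀ ψ, S.IsTest ψ →
    ∫ r, fderiv ℝ ψ r (0, 1) * u r ∂S.mC = - ∫ r, ψ r * q r ∂S.mC

theorem hasFDerivAt_cs_mul (n j : ℤ) {τ : ℝ → ℝ} (hτ : Differentiable ℝ τ) (r : ℝ × ℝ) :
    fderiv ℝ (fun r : ℝ × ℝ => cs n j r.1 * τ r.2) r (1, 0) = n * cs n (j + 1) r.1 * τ r.2 ∧
    fderiv ℝ (fun r : ℝ × ℝ => cs n j r.1 * τ r.2) r (0, 1) = cs n j r.1 * deriv τ r.2 := by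
  have h1 := (hasDerivAt_cs n j r.1).hasFDerivAt.comp r (hasFDerivAt_fst (𝕜 := ℝ) (E := ℝ) (F := ℝ))
  have h2 := (hτ r.2).hasDerivAt.hasFDerivAt.comp r (hasFDerivAt_snd (𝕜 := ℝ) (E := ℝ) (F := ℝ))
  have h3 := (h1.mul h2).fderiv
  have h4 : (fun r : ℝ × ℝ => cs n j r.1 * τ r.2) = ((cs n j ∘ Prod.fst) * (τ ∘ Prod.snd)) := rfl
  rw [h4, h3]
  exact ⟨by simp; ring, by simp⟩

theorem isTest_cs_mul (n j : ℤ) {τ : ℝ → ℝ} (hτ : IsBump S.a S.b τ) :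
    S.IsTest fun r => cs n j r.1 * τ r.2 := by
  obtain ⟨hsm, c, d, hac, -, hdb, hs⟩ := hτ
  refine ⟨((contDiff_cs n j).comp contDiff_fst).mul (hsm.comp contDiff_snd), fun φ t => ?_,
    Or.inl ⟨c, d, hac, hdb, fun φ t h => hs t (right_ne_zero_of_mul h)⟩⟩
  simp only [cs_periodic n j φ]

/-- On a torus, test functions need not vanish near the cut. Those which are constant in t express
that a map closes up there. -/
theorem isTest_cs (n j : ℤ) (hS : S.IsLoop) :
    S.IsTest fun r => cs n j r.1 * (1 : ℝ) := by
  refine ⟨((contDiff_cs n j).comp contDiff_fst).mul contDiff_const, fun φ t => ?_,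
    Or.inr ⟨hS, fun φ t => rfl⟩⟩
  simp only [cs_periodic n j φ]

variable {S}

/-- By Young's inequality 2|kq| ≤ k²/x + x q². The meridional derivative q is square integrable only
for the weight x, so it can be paired only with functions that are small at the axis. -/
theorem integrable_mul_of_weight {q : ℝ × ℝ → ℝ} (hq : AEStronglyMeasurable q S.mC)
    (hi : Integrable (fun r => S.x r.2 * q r ^ 2) S.mC) {k : ℝ × ℝ → ℝ}
    (hk : AEStronglyMeasurable k S.mC) {K : ℝ} (hK : ∀ᵐ r ∂S.mC, k r ^ 2 ≤ K * S.x r.2) :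
    Integrable (fun r => k r * q r) S.mC := by
  refine Integrable.mono' ((integrable_const K).add hi) (hk.mul hq) ?_
  filter_upwards [hK, S.ae_mC_mem] with r hr hm
  have hx := S.x_pos hm.2
  rw [Real.norm_eq_abs, Pi.add_apply, abs_le]
  have e1 : k r ^ 2 / S.x r.2 ≤ K := by rwa [div_le_iff₀ hx]
  have e2 : k r ^ 2 / S.x r.2 + S.x r.2 * q r ^ 2 - 2 * (k r * q r) =
    (k r - S.x r.2 * q r) ^ 2 / S.x r.2 := by field_simp; ring
  have e3 : k r ^ 2 / S.x r.2 + S.x r.2 * q r ^ 2 + 2 * (k r * q r) =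
    (k r + S.x r.2 * q r) ^ 2 / S.x r.2 := by field_simp; ring
  have p0 : 0 ≤ k r ^ 2 / S.x r.2 + S.x r.2 * q r ^ 2 := by positivity
  have p1 : 0 ≤ (k r - S.x r.2 * q r) ^ 2 / S.x r.2 := by positivity
  have p2 : 0 ≤ (k r + S.x r.2 * q r) ^ 2 / S.x r.2 := by positivity
  constructor <;> linarith

namespace ScalarWG

variable {u p q : ℝ × ℝ → ℝ}

theorem integrable (h : S.ScalarWG u p q) : Integrable u S.mC := by
  obtain ⟨B, hB⟩ := h.bdd
  exact Integrable.of_bound h.aesm B (by simpa using hB)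

theorem integrable_left (h : S.ScalarWG u p q) : Integrable p S.mC :=
  ((memLp_two_iff_integrable_sq h.aesm_left).2 h.int_left).integrable one_le_two

theorem integrable_mul_right (h : S.ScalarWG u p q) {k : ℝ × ℝ → ℝ}
    (hk : AEStronglyMeasurable k S.mC) {K : ℝ} (hK : ∀ᵐ r ∂S.mC, k r ^ 2 ≤ K * S.x r.2) :
    Integrable (fun r => k r * q r) S.mC :=
  integrable_mul_of_weight h.aesm_right h.int_right hk hK

end ScalarWG

theorem exists_x_lower {c d : ℝ} (hc : S.a < c) (hd : d < S.b) :
    ∃ e, 0 < e ∧ ∀ t ∈ Icc c d, e ≤ S.x t := by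
  rcases le_or_gt c d with hcd | hcd
  · obtain ⟨t0, ht0, h0⟩ := isCompact_Icc.exists_isMinOn (nonempty_Icc.2 hcd)
      S.continuous_x.continuousOn
    exact ⟨S.x t0, S.x_pos ⟨hc.trans_le ht0.1, ht0.2.trans_lt hd⟩, fun t ht => h0 ht⟩
  · exact ⟨1, one_pos, fun t ht => absurd (ht.1.trans ht.2) (not_le.2 hcd)⟩

theorem IsLoop.exists_x_lower (h : S.IsLoop) : ∃ e, 0 < e ∧ ∀ t ∈ Icc S.a S.b, e ≤ S.x t := by
  obtain ⟨t0, ht0, h0⟩ := isCompact_Icc.exists_isMinOn (nonempty_Icc.2 S.lt.le)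
      S.continuous_x.continuousOn
  exact ⟨S.x t0, h.x_pos ht0, fun t ht => h0 ht⟩

namespace ScalarWG

variable {u p q : ℝ × ℝ → ℝ}

theorem integrable_indicator (h : S.ScalarWG u p q) {c d : ℝ} (hc : S.a < c) (hd : d < S.b) :
    Integrable (fun r => (Icc c d).indicator (fun _ => (1 : ℝ)) r.2 * q r) S.mC := by
  obtain ⟨e, he, hx⟩ := S.exists_x_lower hc hd
  refine h.integrable_mul_right (K := e⁻¹) ?_ ?_
  · exact ((measurable_const.indicator measurableSet_Icc).comp
      measurable_snd).aestronglyMeasurable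
  · filter_upwards [S.ae_mC_mem] with r hr
    by_cases hr' : r.2 ∈ Icc c d
    · simp only [hr', indicator_of_mem, one_pow]
      have := hx _ hr'
      rw [inv_mul_eq_div, le_div_iff₀ he]; linarith
    · simp only [hr', not_false_eq_true, indicator_of_notMem]
      have := S.x_pos hr.2
      rw [zero_pow two_ne_zero]
      positivity

theorem integrable_right_loop (h : S.ScalarWG u p q) (hS : S.IsLoop) : Integrable q S.mC := by
  obtain ⟨e, he, hx⟩ := hS.exists_x_lower
  have := h.integrable_mul_right (k := fun _ => 1) (K := e⁻¹) aestronglyMeasurable_const ?_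
  · simpa using this
  · filter_upwards [S.ae_mC_mem] with r hr
    have := hx _ (Ioo_subset_Icc_self hr.2)
    rw [one_pow, inv_mul_eq_div, le_div_iff₀ he]; linarith

theorem integrable_sq_indicator (h : S.ScalarWG u p q) {c d : ℝ} (hc : S.a < c) (hd : d < S.b) :
    Integrable (fun r => (Icc c d).indicator (fun _ => (1 : ℝ)) r.2 * q r ^ 2) S.mC := by
  obtain ⟨e, he, hx⟩ := S.exists_x_lower hc hd
  refine Integrable.mono' (h.int_right.const_mul e⁻¹) ?_ ?_
  · exact ((measurable_const.indicator measurableSet_Icc).comp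
      measurable_snd).aestronglyMeasurable.mul (h.aesm_right.pow 2)
  · filter_upwards [S.ae_mC_mem] with r hr
    have hxr := S.x_pos hr.2
    by_cases hr' : r.2 ∈ Icc c d
    · simp only [hr', indicator_of_mem, one_mul, norm_pow, Real.norm_eq_abs, sq_abs]
      have := hx _ hr'
      rw [inv_mul_eq_div, le_div_iff₀ he, mul_comm]
      exact mul_le_mul_of_nonneg_right this (sq_nonneg _)
    · simp only [hr', not_false_eq_true, indicator_of_notMem, zero_mul, norm_zero]
      positivity

theorem integrable_sq_loop (h : S.ScalarWG u p q) (hS : S.IsLoop) :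
    Integrable (fun r => q r ^ 2) S.mC := by
  obtain ⟨e, he, hx⟩ := hS.exists_x_lower
  refine Integrable.mono' (h.int_right.const_mul e⁻¹) (h.aesm_right.pow 2) ?_
  filter_upwards [S.ae_mC_mem] with r hr
  have := hx _ (Ioo_subset_Icc_self hr.2)
  rw [norm_pow, Real.norm_eq_abs, sq_abs, inv_mul_eq_div, le_div_iff₀ he, mul_comm]
  exact mul_le_mul_of_nonneg_right this (sq_nonneg _)

end ScalarWG

theorem integrable_cs_mul_chart (n j : ℤ) {f : ℝ × ℝ → ℝ} {μ : Measure (ℝ × ℝ)}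
    (hf : Integrable f μ) : Integrable (fun r => cs n j r.1 * f r) μ :=
  hf.bdd_mul ((continuous_cs n j).comp continuous_fst).aestronglyMeasurable (c := 1)
    (Eventually.of_forall fun r => by simpa using abs_cs_le n j r.1)

/-- The trigonometric modes of a function on the chart. -/
noncomputable def mode (n j : ℤ) (f : ℝ × ℝ → ℝ) (t : ℝ) : ℝ := ∫ φ, cs n j φ * f (φ, t) ∂circ

theorem integrable_mode (n j : ℤ) {f : ℝ × ℝ → ℝ} (hf : Integrable f S.mC) :
    Integrable (mode n j f) S.mI :=
  (integrable_cs_mul_chart n j hf).integral_prod_right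

theorem integral_cs_mul_chart (n j : ℤ) {f : ℝ × ℝ → ℝ} {τ : ℝ → ℝ}
    (hf : Integrable (fun r : ℝ × ℝ => τ r.2 * f r) S.mC) :
    ∫ r, cs n j r.1 * τ r.2 * f r ∂S.mC = ∫ t, τ t * mode n j f t ∂S.mI := by
  have h1 := integrable_cs_mul_chart n j hf
  have h2 : ∀ r : ℝ × ℝ, cs n j r.1 * τ r.2 * f r = cs n j r.1 * (τ r.2 * f r) := fun r => by ring
  simp only [h2]
  rw [mC, integral_prod_symm _ h1]
  refine integral_congr_ae (Eventually.of_forall fun t => ?_)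
  simp only [mode]
  rw [← integral_const_mul]
  refine integral_congr_ae (Eventually.of_forall fun φ => ?_)
  ring

namespace ScalarWG

variable {u p q : ℝ × ℝ → ℝ}

theorem integrableOn_mode_right (h : S.ScalarWG u p q) (n j : ℤ) {c d : ℝ} (hc : S.a < c)
    (hd : d < S.b) : IntegrableOn (mode n j q) (Icc c d) := by
  have h1 := integrable_mode n j (h.integrable_indicator hc hd)
  have h2 : mode n j (fun r => (Icc c d).indicator (fun _ => (1 : ℝ)) r.2 * q r) =
      (Icc c d).indicator (mode n j q) := by
    funext t
    by_cases ht : t ∈ Icc c d <;> simp [mode, ht]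
  rw [h2, integrable_indicator_iff measurableSet_Icc, IntegrableOn,
    Measure.restrict_restrict measurableSet_Icc,
    inter_eq_left.2 (show Icc c d ⊆ Ioo S.a S.b from
      fun t ht => ⟨hc.trans_le ht.1, ht.2.trans_lt hd⟩)] at h1
  exact h1

theorem locallyIntegrableOn_mode_right (h : S.ScalarWG u p q) (n j : ℤ) :
    LocallyIntegrableOn (mode n j q) (Ioo S.a S.b) :=
  locallyIntegrableOn_Ioo fun _ _ hc _ hd => h.integrableOn_mode_right n j hc hd

theorem integrable_bump_mul_right (h : S.ScalarWG u p q) {τ : ℝ → ℝ} (hτ : IsBump S.a S.b τ) :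
    Integrable (fun r : ℝ × ℝ => τ r.2 * q r) S.mC := by
  obtain ⟨hsm, c, d, hac, -, hdb, hs⟩ := hτ
  obtain ⟨C, hC⟩ := (isCompact_Icc (a := S.a) (b := S.b)).exists_bound_of_continuousOn
    hsm.continuous.continuousOn
  have h1 := (h.integrable_indicator hac hdb).bdd_mul
    (f := fun r => τ r.2) (hsm.continuous.comp continuous_snd).aestronglyMeasurable (c := C) (by
      filter_upwards [S.ae_mC_mem] with r hr
      exact hC _ (Ioo_subset_Icc_self hr.2))
  refine h1.congr (Eventually.of_forall fun r => ?_)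
  by_cases hr : r.2 ∈ Icc c d
  · simp [hr]
  · have : τ r.2 = 0 := by by_contra hne; exact hr (hs _ hne)
    simp [this]

theorem integrable_continuous_mul {f : ℝ × ℝ → ℝ} (hf : Integrable f S.mC) {τ : ℝ → ℝ}
    (hτ : Continuous τ) : Integrable (fun r : ℝ × ℝ => τ r.2 * f r) S.mC := by
  obtain ⟨C, hC⟩ := (isCompact_Icc (a := S.a) (b := S.b)).exists_bound_of_continuousOn
    hτ.continuousOn
  exact hf.bdd_mul (hτ.comp continuous_snd).aestronglyMeasurable (c := C) (by
      filter_upwards [S.ae_mC_mem] with r hr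
      exact hC _ (Ioo_subset_Icc_self hr.2))

/-- Testing with the product of a trigonometric monomial and a bump reduces the weak derivative in t
to one variable, where the lemma of du Bois-Reymond applies to every mode. -/
theorem weak_mode_right (h : S.ScalarWG u p q) (n j : ℤ) {τ : ℝ → ℝ} (hτ : IsBump S.a S.b τ) :
    ∫ t in Ioo S.a S.b, deriv τ t * mode n j u t = - ∫ t in Ioo S.a S.b, τ t * mode n j q t := by
  have h1 := h.weak_right _ (S.isTest_cs_mul n j hτ)
  have hd : Differentiable ℝ τ := hτ.1.differentiable (by simp)
  simp only [(hasFDerivAt_cs_mul n j hd _).2] at h1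
  rwa [integral_cs_mul_chart n j (integrable_continuous_mul h.integrable hτ.deriv.1.continuous),
    integral_cs_mul_chart n j (h.integrable_bump_mul_right hτ)] at h1

theorem exists_isPrim_mode (h : S.ScalarWG u p q) (n j : ℤ) :
    ∃ A, IsPrim S.a S.b A (mode n j q) ∧ ∀ᵐ t ∂S.mI, mode n j u t = A t := by
  have h1 : IntegrableOn (mode n j u) (Ioo S.a S.b) := integrable_mode n j h.integrable
  obtain ⟨A, hA, he⟩ := exists_isPrim_of_weak S.lt h1.locallyIntegrableOn
    (h.locallyIntegrableOn_mode_right n j) (fun τ hτ => h.weak_mode_right n j hτ)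
  exact ⟨A, hA, (ae_restrict_iff' measurableSet_Ioo).2 he⟩

/-- The test function is constant in t, so the left-hand side of the weak formulation vanishes. -/
theorem integral_mode_right_loop (h : S.ScalarWG u p q) (hS : S.IsLoop) (n j : ℤ) :
    ∫ t, mode n j q t ∂S.mI = 0 := by
  have h1 := h.weak_right _ (S.isTest_cs n j hS)
  have h2 := fun r => (hasFDerivAt_cs_mul n j (differentiable_const (1 : ℝ)) r).2
  simp only [h2, deriv_const, mul_zero, zero_mul, integral_zero] at h1
  have h3 := integral_cs_mul_chart n j (τ := fun _ => 1) (f := q) (S := S)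
    (by simpa using h.integrable_right_loop hS)
  simp only [one_mul] at h3
  linarith [h1.trans (congrArg _ h3)]

/-- The bump in the t-variable is arbitrary, so the weak formulation in φ localizes to almost every
circle of latitude. There are countably many modes, hence one exceptional null set for all of them
in `ae_slice`. -/
theorem ae_mode_left (h : S.ScalarWG u p q) (n j : ℤ) :
    ∀ᵐ t ∂S.mI, mode n j p t = - (n * mode n (j + 1) u t) := by
  have hp : Integrable (mode n j p) S.mI := integrable_mode n j h.integrable_left
  have hu : Integrable (mode n (j + 1) u) S.mI := integrable_mode n (j + 1) h.integrable
  have h1 : IntegrableOn (fun t => mode n j p t + n * mode n (j + 1) u t) (Ioo S.a S.b) :=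
    hp.add (hu.const_mul _)
  have h2 := ae_eq_zero_of_forall_isBump S.lt h1.locallyIntegrableOn ?_
  · filter_upwards [(ae_restrict_iff' measurableSet_Ioo).2 h2] with t ht
    linarith
  · intro τ hτ
    have h3 := h.weak_left _ (S.isTest_cs_mul n j hτ)
    have hd : Differentiable ℝ τ := hτ.1.differentiable (by simp)
    simp only [(hasFDerivAt_cs_mul n j hd _).1] at h3
    rw [integral_cs_mul_chart n j (integrable_continuous_mul h.integrable_left hτ.1.continuous)]
      at h3
    have h4 : ∀ r : ℝ × ℝ, n * cs n (j + 1) r.1 * τ r.2 * u r =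
      n * (cs n (j + 1) r.1 * τ r.2 * u r) := fun r => by ring
    simp only [h4] at h3
    rw [integral_const_mul, integral_cs_mul_chart n (j + 1)
      (integrable_continuous_mul h.integrable hτ.1.continuous)] at h3
    have h5 : ∀ t, τ t * (mode n j p t + n * mode n (j + 1) u t) =
      τ t * mode n j p t + n * (τ t * mode n (j + 1) u t) := fun t => by ring
    simp only [h5]
    have i1 := hτ.integrableOn_mul (IntegrableOn.locallyIntegrableOn (s := Ioo S.a S.b) hp)
    have i2 := hτ.integrableOn_mul (IntegrableOn.locallyIntegrableOn (s := Ioo S.a S.b) hu)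
    rw [integral_add i1 (i2.const_mul _), integral_const_mul]
    linarith

end ScalarWG

theorem ae_aestronglyMeasurable_slice {f : ℝ × ℝ → ℝ} (hf : AEStronglyMeasurable f S.mC) :
    ∀ᵐ t ∂S.mI, AEStronglyMeasurable (fun φ => f (φ, t)) circ :=
  hf.prod_swap.prodMk_left

theorem ae_memLp_slice {f : ℝ × ℝ → ℝ} (hf : AEStronglyMeasurable f S.mC)
    (hi : Integrable (fun r => f r ^ 2) S.mC) : ∀ᵐ t ∂S.mI, MemLp (fun φ => f (φ, t)) 2 circ := by
  filter_upwards [ae_aestronglyMeasurable_slice hf, hi.prod_left_ae] with t h1 h2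
  exact (memLp_two_iff_integrable_sq h1).2 h2

namespace ScalarWG

variable {u p q : ℝ × ℝ → ℝ}

theorem integrable_sq (h : S.ScalarWG u p q) : Integrable (fun r => u r ^ 2) S.mC := by
  obtain ⟨B, hB⟩ := h.bdd
  refine Integrable.of_bound (h.aesm.pow 2) (B ^ 2) ?_
  filter_upwards [hB] with r hr
  rw [norm_pow, Real.norm_eq_abs]
  exact pow_le_pow_left₀ (abs_nonneg _) hr 2

theorem ae_slice (h : S.ScalarWG u p q) : ∀ᵐ t ∂S.mI, MemLp (fun φ => u (φ, t)) 2 circ ∧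
    MemLp (fun φ => p (φ, t)) 2 circ ∧ IsWeakDerivCirc (fun φ => u (φ, t)) fun φ => p (φ, t) := by
  filter_upwards [ae_memLp_slice h.aesm h.integrable_sq, ae_memLp_slice h.aesm_left h.int_left,
    ae_all_iff.2 fun n => ae_all_iff.2 fun j => h.ae_mode_left n j] with t h1 h2 h3
  exact ⟨h1, h2, h3⟩

theorem ae_slice_right (h : S.ScalarWG u p q) :
    ∀ᵐ t ∂S.mI, MemLp (fun φ => q (φ, t)) 2 circ := by
  filter_upwards [ae_aestronglyMeasurable_slice h.aesm_right, h.int_right.prod_left_ae,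
    ae_restrict_mem measurableSet_Ioo] with t h1 h2 ht
  refine (memLp_two_iff_integrable_sq h1).2 ?_
  have hx := (S.x_pos ht).ne'
  simpa [hx] using h2.const_mul (S.x t)⁻¹

/-- The function u determines all modes of its weak derivative on almost every circle. Together with
`ae_eq_right` this shows that the weak gradient is unique, so the infimum in the Dirichlet energy is
over one value. -/
theorem ae_eq_left (h : S.ScalarWG u p q) {p' q' : ℝ × ℝ → ℝ} (h' : S.ScalarWG u p' q') :
    p =ᵐ[S.mC] p' := by
  have := ae_prod_of_ae_ae_swap (h.aesm_left.sub h'.aesm_left) (by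
    filter_upwards [h.ae_slice, h'.ae_slice] with t h1 h2
    refine ae_eq_zero_of_cs (h1.2.1.sub h2.2.1) fun n j => ?_
    simp only [Pi.sub_apply, mul_sub]
    rw [integral_sub (integrable_cs_mul n j (MemLp.integrable_circ h1.2.1))
      (integrable_cs_mul n j (MemLp.integrable_circ h2.2.1)), h1.2.2, h2.2.2, sub_self])
  filter_upwards [this] with r hr
  exact sub_eq_zero.1 hr

theorem ae_eq_right (h : S.ScalarWG u p q) {p' q' : ℝ × ℝ → ℝ} (h' : S.ScalarWG u p' q') :
    q =ᵐ[S.mC] q' := by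
  have hm : ∀ n j, ∀ᵐ t ∂S.mI, mode n j q t - mode n j q' t = 0 := by
    intro n j
    refine (ae_restrict_iff' measurableSet_Ioo).2 (ae_eq_zero_of_forall_isBump S.lt
      ((h.locallyIntegrableOn_mode_right n j).sub (h'.locallyIntegrableOn_mode_right n j))
      fun τ hτ => ?_)
    simp only [mul_sub]
    rw [integral_sub (hτ.integrableOn_mul (h.locallyIntegrableOn_mode_right n j))
      (hτ.integrableOn_mul (h'.locallyIntegrableOn_mode_right n j))]
    have h1 := h.weak_mode_right n j hτ
    have h2 := h'.weak_mode_right n j hτ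
    linarith
  have := ae_prod_of_ae_ae_swap (h.aesm_right.sub h'.aesm_right) (by
    filter_upwards [h.ae_slice_right, h'.ae_slice_right,
      ae_all_iff.2 fun n => ae_all_iff.2 fun j => hm n j] with t h1 h2 h3
    refine ae_eq_zero_of_cs (h1.sub h2) fun n j => ?_
    simp only [Pi.sub_apply, mul_sub]
    rw [integral_sub (integrable_cs_mul n j (MemLp.integrable_circ h1))
      (integrable_cs_mul n j (MemLp.integrable_circ h2))]
    exact h3 n j)
  filter_upwards [this] with r hr
  exact sub_eq_zero.1 hr

end ScalarWG
end RevSurface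

end AxialMaps

/-! ### Absolute continuity along almost every meridian -/

namespace AxialMaps
namespace RevSurface

variable {S : RevSurface}

/-- The oriented integral is a difference of parameter integrals over two measurable sets, one for
each order of c and the upper limit. -/
theorem stronglyMeasurable_primitive {q : ℝ × ℝ → ℝ} (hq : StronglyMeasurable q) (c : ℝ) :
    StronglyMeasurable fun r : ℝ × ℝ => ∫ s in c..r.2, q (r.1, s) := by
  have key : ∀ E : Set ((ℝ × ℝ) × ℝ), MeasurableSet E → StronglyMeasurable fun r : ℝ × ℝ =>
      ∫ s, E.indicator (fun x : (ℝ × ℝ) × ℝ => q (x.1.1, x.2)) (r, s) := by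
    intro E hE
    refine StronglyMeasurable.integral_prod_right ?_
    exact (hq.comp_measurable (measurable_fst.fst.prodMk measurable_snd)).indicator hE
  have m1 : MeasurableSet {x : (ℝ × ℝ) × ℝ | c < x.2 ∧ x.2 ≤ x.1.2} :=
    (measurableSet_lt measurable_const measurable_snd).inter
      (measurableSet_le measurable_snd measurable_fst.snd)
  have m2 : MeasurableSet {x : (ℝ × ℝ) × ℝ | x.1.2 < x.2 ∧ x.2 ≤ c} :=
    (measurableSet_lt measurable_fst.snd measurable_snd).inter
      (measurableSet_le measurable_snd measurable_const)
  convert! (key _ m1).sub (key _ m2) using 1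
  funext r
  simp only [intervalIntegral, Pi.sub_apply]
  congr 1
  · rw [← integral_indicator measurableSet_Ioc]; rfl
  · rw [← integral_indicator measurableSet_Ioc]; rfl

namespace ScalarWG

variable {u p q : ℝ × ℝ → ℝ}

theorem congr (h : S.ScalarWG u p q) {u' p' q' : ℝ × ℝ → ℝ} (hu : u =ᵐ[S.mC] u')
    (hp : p =ᵐ[S.mC] p') (hq : q =ᵐ[S.mC] q') : S.ScalarWG u' p' q' where
  aesm := h.aesm.congr hu
  bdd := by
    obtain ⟨B, hB⟩ := h.bdd
    exact ⟨B, by filter_upwards [hB, hu] with r h1 h2; rwa [← h2]⟩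
  aesm_left := h.aesm_left.congr hp
  aesm_right := h.aesm_right.congr hq
  int_left := h.int_left.congr (by filter_upwards [hp] with r hr; rw [hr])
  int_right := h.int_right.congr (by filter_upwards [hq] with r hr; rw [hr])
  weak_left ψ hψ := by
    rw [integral_congr_ae (g := fun r => fderiv ℝ ψ r (1, 0) * u r)
      (by filter_upwards [hu] with r hr; rw [hr]), h.weak_left ψ hψ]
    congr 1
    exact integral_congr_ae (by filter_upwards [hp] with r hr; rw [hr])
  weak_right ψ hψ := by
    rw [integral_congr_ae (g := fun r => fderiv ℝ ψ r (0, 1) * u r)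
      (by filter_upwards [hu] with r hr; rw [hr]), h.weak_right ψ hψ]
    congr 1
    exact integral_congr_ae (by filter_upwards [hq] with r hr; rw [hr])

theorem integrable_restrict (h : S.ScalarWG u p q) {c d : ℝ} (hc : S.a < c) (hd : d < S.b) :
    Integrable q (circ.prod (volume.restrict (Icc c d))) ∧
      Integrable (fun r => q r ^ 2) (circ.prod (volume.restrict (Icc c d))) := by
  have hsub : Icc c d ⊆ Ioo S.a S.b := fun t ht => ⟨hc.trans_le ht.1, ht.2.trans_lt hd⟩
  have hm : MeasurableSet (univ ×ˢ Icc c d : Set (ℝ × ℝ)) := MeasurableSet.univ.prod measurableSet_Icc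
  have hr : circ.prod (volume.restrict (Icc c d)) = S.mC.restrict (univ ×ˢ Icc c d) := by
    rw [mC, ← Measure.prod_restrict, Measure.restrict_univ, Measure.restrict_restrict
      measurableSet_Icc, inter_eq_left.2 hsub]
  have e : ∀ f : ℝ × ℝ → ℝ, (fun r : ℝ × ℝ => (Icc c d).indicator (fun _ => (1 : ℝ)) r.2 * f r) =
      (univ ×ˢ Icc c d : Set (ℝ × ℝ)).indicator f := by
    intro f; funext r
    by_cases hr : r.2 ∈ Icc c d <;> simp [indicator, hr]
  have h1 := h.integrable_indicator hc hd
  have h2 := h.integrable_sq_indicator hc hd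
  rw [e] at h1
  rw [e (fun r => q r ^ 2)] at h2
  rw [hr]
  exact ⟨(integrable_indicator_iff hm).1 h1, (integrable_indicator_iff hm).1 h2⟩

/-- A sequence of compact intervals exhausting the open parameter interval. -/
theorem exists_exhaustion (a b : ℝ) (hab : a < b) : ∃ c d : ℕ → ℝ, (∀ n, a < c n ∧ d n < b) ∧
    ∀ s ∈ Ioo a b, ∀ t ∈ Ioo a b, ∃ n, s ∈ Icc (c n) (d n) ∧ t ∈ Icc (c n) (d n) := by
  have hl : 0 < b - a := sub_pos.2 hab
  refine ⟨fun n => a + (b - a) / (n + 2), fun n => b - (b - a) / (n + 2), fun n => ?_,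
    fun s hs t ht => ?_⟩
  · have : 0 < (b - a) / ((n : ℝ) + 2) := by positivity
    constructor <;> linarith
  · have hε : 0 < min (min (s - a) (t - a)) (min (b - s) (b - t)) := by
      simp only [lt_min_iff, sub_pos]; exact ⟨⟨hs.1, ht.1⟩, hs.2, ht.2⟩
    obtain ⟨n, hn⟩ := exists_nat_gt ((b - a) / min (min (s - a) (t - a)) (min (b - s) (b - t)))
    have h1 : (b - a) / ((n : ℝ) + 2) ≤ min (min (s - a) (t - a)) (min (b - s) (b - t)) := by
      rw [div_lt_iff₀ hε] at hn
      rw [div_le_iff₀ (by positivity)]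
      nlinarith
    simp only [le_min_iff] at h1
    refine ⟨n, ⟨?_, ?_⟩, ?_, ?_⟩ <;> linarith [h1.1.1, h1.1.2, h1.2.1, h1.2.2]

/-- Exhausting the parameter interval by countably many compact intervals makes the exceptional set
of angles independent of s and t. -/
theorem ae_intervalIntegrable (h : S.ScalarWG u p q) : ∀ᵐ φ ∂circ, ∀ s ∈ Ioo S.a S.b,
    ∀ t ∈ Ioo S.a S.b, IntervalIntegrable (fun r => q (φ, r)) volume s t := by
  obtain ⟨c, d, hcd, hex⟩ := exists_exhaustion S.a S.b S.lt
  have : ∀ᵐ φ ∂circ, ∀ n, IntegrableOn (fun r => q (φ, r)) (Icc (c n) (d n)) :=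
    ae_all_iff.2 fun n => (h.integrable_restrict (hcd n).1 (hcd n).2).1.prod_right_ae
  filter_upwards [this] with φ hφ s hs t ht
  obtain ⟨n, hsn, htn⟩ := hex s hs t ht
  rw [intervalIntegrable_iff']
  exact (hφ n).mono_set ((ordConnected_Icc).uIcc_subset hsn htn)

/-- Cauchy-Schwarz in the meridional variable gives square integrability, Fubini the modes. Between
c and t the weight x is bounded below. -/
theorem memLp_primitive (h : S.ScalarWG u p q) (hq : StronglyMeasurable q) {c t : ℝ}
    (hc : c ∈ Ioo S.a S.b) (ht : t ∈ Ioo S.a S.b) :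
    MemLp (fun φ => ∫ s in c..t, q (φ, s)) 2 circ ∧
      ∀ n j, ∫ φ, cs n j φ * (∫ s in c..t, q (φ, s)) ∂circ = ∫ s in c..t, mode n j q s := by
  have hcd : S.a < min c t ∧ max c t < S.b := ⟨lt_min hc.1 ht.1, max_lt hc.2 ht.2⟩
  obtain ⟨hi, hi2⟩ := h.integrable_restrict hcd.1 hcd.2
  have hsub : uIoc c t ⊆ Icc (min c t) (max c t) := Ioc_subset_Icc_self
  have hac : circ.prod (volume.restrict (uIoc c t)) ≤
      circ.prod (volume.restrict (Icc (min c t) (max c t))) :=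
    Measure.prod_mono le_rfl (Measure.restrict_mono hsub le_rfl)
  have hi' := hi.mono_measure hac
  have hi2' := hi2.mono_measure hac
  have : IsFiniteMeasure (volume.restrict (uIoc c t)) := by rw [uIoc]; infer_instance
  have hmeas : StronglyMeasurable fun φ => ∫ s in c..t, q (φ, s) :=
    (stronglyMeasurable_primitive hq c).comp_measurable (measurable_id.prodMk measurable_const)
  constructor
  · rw [memLp_two_iff_integrable_sq hmeas.aestronglyMeasurable]
    refine Integrable.mono' (hi2'.integral_prod_left.const_mul
      ((volume.restrict (uIoc c t)).real univ)) (hmeas.aestronglyMeasurable.pow 2) ?_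
    filter_upwards [hi2'.prod_right_ae] with φ hφ
    have hm : AEStronglyMeasurable (fun s => q (φ, s)) (volume.restrict (uIoc c t)) :=
      (hq.comp_measurable measurable_prodMk_left).aestronglyMeasurable
    have := sq_integral_le ((memLp_two_iff_integrable_sq hm).2 hφ)
    rw [norm_pow, intervalIntegral.norm_intervalIntegral_eq, Real.norm_eq_abs, sq_abs]
    exact this
  · intro n j
    have key : ∀ E : Set ℝ, E ⊆ Icc (min c t) (max c t) →
        ∫ φ, cs n j φ * (∫ s in E, q (φ, s)) ∂circ = ∫ s in E, mode n j q s := by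
      intro E hE
      have hi'' := hi.mono_measure (Measure.prod_mono (le_refl circ)
        (Measure.restrict_mono hE le_rfl))
      simp only [← integral_const_mul, mode]
      exact integral_integral_swap (f := fun φ s => cs n j φ * q (φ, s))
        (integrable_cs_mul_chart n j hi'')
    rcases le_total c t with hle | hle
    · simp only [intervalIntegral.integral_of_le hle]
      exact key _ (by rw [min_eq_left hle, max_eq_right hle]; exact Ioc_subset_Icc_self)
    · simp only [intervalIntegral.integral_of_ge hle, mul_neg, integral_neg]
      rw [key _ (by rw [min_eq_right hle, max_eq_left hle]; exact Ioc_subset_Icc_self)]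

/-- Let N be the primitive of q along the meridians. The modes of u - N do not depend on t, so by
completeness of the trigonometric system u - N is, for almost every t, the same function of φ.
Exchanging the quantifiers gives the claim on almost every meridian. -/
theorem ae_slice_isPrim_aux (h : S.ScalarWG u p q) (hu : StronglyMeasurable u)
    (hq : StronglyMeasurable q) : ∀ᵐ φ ∂circ, ∃ k, IsPrim S.a S.b k (fun t => q (φ, t)) ∧
      ∀ᵐ t ∂S.mI, u (φ, t) = k t := by
  obtain ⟨c, hac, hcb⟩ := exists_between S.lt
  have hc : c ∈ Ioo S.a S.b := ⟨hac, hcb⟩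
  choose A hA hAe using h.exists_isPrim_mode
  set N : ℝ × ℝ → ℝ := fun r => ∫ s in c..r.2, q (r.1, s) with hN
  have hNm : StronglyMeasurable N := stronglyMeasurable_primitive hq c
  have hgood : ∀ᵐ t ∂S.mI, t ∈ Ioo S.a S.b ∧ MemLp (fun φ => u (φ, t)) 2 circ ∧
      ∀ n j, mode n j u t = A n j t := by
    filter_upwards [ae_restrict_mem measurableSet_Ioo, h.ae_slice,
      ae_all_iff.2 fun n => ae_all_iff.2 fun j => hAe n j] with t h1 h2 h3
    exact ⟨h1, h2.1, h3⟩
  have hne : (ae S.mI).NeBot := by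
    rw [ae_neBot]
    intro h0
    have := congrArg (fun μ => μ univ) h0
    simp at this
    linarith [S.lt]
  -- The constants of integration are taken at a good height t0. The values of u on the base circle
  -- t = c are not controlled.
  obtain ⟨t0, ht0, hu0, hA0⟩ := hgood.exists
  have hmode : ∀ {t}, t ∈ Ioo S.a S.b → MemLp (fun φ => u (φ, t)) 2 circ →
      (∀ n j, mode n j u t = A n j t) → ∀ n j,
      ∫ φ, cs n j φ * (u (φ, t) - N (φ, t)) ∂circ = A n j c := by
    intro t ht hut hAt n j
    obtain ⟨h1, h2⟩ := h.memLp_primitive hq hc ht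
    simp only [mul_sub]
    rw [integral_sub (integrable_cs_mul n j (MemLp.integrable_circ hut))
      (integrable_cs_mul n j (MemLp.integrable_circ h1)), h2, ← (hA n j).sub c hc t ht]
    have : ∫ φ, cs n j φ * u (φ, t) ∂circ = A n j t := hAt n j
    rw [this]; ring
  have hswap : ∀ᵐ t ∂S.mI, ∀ᵐ φ ∂circ, u (φ, t) = N (φ, t) + (u (φ, t0) - N (φ, t0)) := by
    filter_upwards [hgood] with t ⟨ht, hut, hAt⟩
    have h1 := (h.memLp_primitive hq hc ht).1
    have h0 := (h.memLp_primitive hq hc ht0).1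
    have d1 : MemLp (fun φ => u (φ, t) - N (φ, t)) 2 circ := hut.sub h1
    have d0 : MemLp (fun φ => u (φ, t0) - N (φ, t0)) 2 circ := hu0.sub h0
    have hz := ae_eq_zero_of_cs ((hut.sub h1).sub (hu0.sub h0)) fun n j => by
      simp only [Pi.sub_apply]
      have e : ∀ φ, cs n j φ * (u (φ, t) - (∫ s in c..t, q (φ, s)) - (u (φ, t0) -
        ∫ s in c..t0, q (φ, s))) = cs n j φ * (u (φ, t) - N (φ, t)) -
          cs n j φ * (u (φ, t0) - N (φ, t0)) := fun φ => by simp only [hN]; ring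
      simp only [e]
      rw [integral_sub (integrable_cs_mul n j (MemLp.integrable_circ d1))
        (integrable_cs_mul n j (MemLp.integrable_circ d0)), hmode ht hut hAt,
        hmode ht0 hu0 hA0, sub_self]
    filter_upwards [hz] with φ hφ
    simp only [Pi.sub_apply, Pi.zero_apply] at hφ
    simp only [hN]
    linarith
  have hKm : StronglyMeasurable fun r : ℝ × ℝ => u (r.1, t0) - N (r.1, t0) :=
    (hu.sub hNm).comp_measurable (measurable_fst.prodMk measurable_const)
  have hms : MeasurableSet {r : ℝ × ℝ | u r = N r + (u (r.1, t0) - N (r.1, t0))} :=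
    measurableSet_eq_fun hu.measurable (hNm.add hKm).measurable
  have := (Measure.ae_ae_comm (p := fun φ t => u (φ, t) = N (φ, t) + (u (φ, t0) - N (φ, t0)))
    hms).2 hswap
  filter_upwards [this, h.ae_intervalIntegrable] with φ h1 h2
  refine ⟨fun t => N (φ, t) + (u (φ, t0) - N (φ, t0)), ⟨h2, fun s hs t ht => ?_⟩, h1⟩
  simp only [hN]
  rw [add_sub_add_right_eq_sub, intervalIntegral.integral_interval_sub_left (h2 c hc t ht)
    (h2 c hc s hs)]

/-- As a function of φ the integral is square integrable, and all of its modes vanish by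
`integral_mode_right_loop`. -/
theorem ae_slice_integral_loop (h : S.ScalarWG u p q) (hS : S.IsLoop) :
    ∀ᵐ φ ∂circ, ∫ t, q (φ, t) ∂S.mI = 0 := by
  have hi := h.integrable_right_loop hS
  have hi2 := h.integrable_sq_loop hS
  have hm : AEStronglyMeasurable (fun φ => ∫ t, q (φ, t) ∂S.mI) circ :=
    hi.integral_prod_left.aestronglyMeasurable
  refine ae_eq_zero_of_cs ((memLp_two_iff_integrable_sq hm).2 ?_) fun n j => ?_
  · refine Integrable.mono' (hi2.integral_prod_left.const_mul (S.mI.real univ)) (hm.pow 2) ?_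
    filter_upwards [hi2.prod_right_ae, h.aesm_right.prodMk_left] with φ h1 h2
    rw [norm_pow, Real.norm_eq_abs, sq_abs]
    exact sq_integral_le ((memLp_two_iff_integrable_sq h2).2 h1)
  · rw [← h.integral_mode_right_loop hS n j]
    simp only [← integral_const_mul, mode]
    exact integral_integral_swap (f := fun φ s => cs n j φ * q (φ, s))
        (integrable_cs_mul_chart n j hi)

/-- Almost every slice of a function with a weak gradient is locally absolutely continuous. -/
theorem ae_slice_isPrim (h : S.ScalarWG u p q) : ∀ᵐ φ ∂circ,
    ∃ k, IsPrim S.a S.b k (fun t => q (φ, t)) ∧ ∀ᵐ t ∂S.mI, u (φ, t) = k t := by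
  have h1 := (h.congr h.aesm.ae_eq_mk (ae_eq_refl p) h.aesm_right.ae_eq_mk).ae_slice_isPrim_aux
    h.aesm.stronglyMeasurable_mk h.aesm_right.stronglyMeasurable_mk
  filter_upwards [h1, Measure.ae_ae_of_ae_prod h.aesm.ae_eq_mk,
    Measure.ae_ae_of_ae_prod h.aesm_right.ae_eq_mk] with φ ⟨k, hk, hke⟩ h2 h3
  have h4 : ∀ s ∈ Ioo S.a S.b, ∀ t ∈ Ioo S.a S.b,
      ∀ᵐ r ∂volume.restrict (uIoc s t), h.aesm_right.mk q (φ, r) = q (φ, r) := by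
    intro s hs t ht
    have hsub : uIoc s t ⊆ Ioo S.a S.b := uIoc_subset_uIcc.trans (uIcc_subset_Ioo' hs ht)
    filter_upwards [ae_restrict_of_ae_restrict_of_subset hsub h3] with r hr
    exact hr.symm
  refine ⟨k, ⟨fun s hs t ht => (hk.int s hs t ht).congr_ae (h4 s hs t ht), fun s hs t ht => ?_⟩, ?_⟩
  · rw [hk.sub s hs t ht]
    exact intervalIntegral.integral_congr_ae_restrict (h4 s hs t ht)
  · filter_upwards [h2, hke] with t h5 h6
    rw [h5, h6]

end ScalarWG
end RevSurface

end AxialMaps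

/-! ### Test functions and separated functions with weak gradients -/

namespace AxialMaps
namespace RevSurface

variable {S : RevSurface}

theorem exists_bound_chart {F : ℝ × ℝ → ℝ} (hF : Continuous F) : ∃ C, 0 ≤ C ∧ ∀ᵐ r ∂S.mC, |F r| ≤ C := by
  obtain ⟨C, hC⟩ := ((isCompact_Icc (a := (0 : ℝ)) (b := 2 * Real.pi)).prod
    (isCompact_Icc (a := S.a) (b := S.b))).exists_bound_of_continuousOn hF.continuousOn
  refine ⟨max C 0, le_max_right _ _, ?_⟩
  filter_upwards [S.ae_mC_mem] with r hr
  exact (hC r ⟨Ioc_subset_Icc_self hr.1, Ioo_subset_Icc_self hr.2⟩).trans (le_max_left _ _)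

namespace IsTest

variable {ψ : ℝ × ℝ → ℝ}

theorem continuous_fderiv_apply (hψ : S.IsTest ψ) (v : ℝ × ℝ) :
    Continuous fun r => fderiv ℝ ψ r v :=
  (hψ.1.continuous_fderiv (by simp)).clm_apply continuous_const

/-- Either ψ is supported away from the axis, or the surface is a torus and x is bounded below
everywhere. -/
theorem exists_weight (hψ : S.IsTest ψ) : ∃ K, ∀ᵐ r ∂S.mC, ψ r ^ 2 ≤ K * S.x r.2 := by
  obtain ⟨C, hC0, hC⟩ := exists_bound_chart (S := S) hψ.1.continuous
  have key : ∀ {e : ℝ} {r : ℝ × ℝ}, 0 < e → e ≤ S.x r.2 → |ψ r| ≤ C →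
      ψ r ^ 2 ≤ (C ^ 2 / e) * S.x r.2 := by
    intro e r he hx hr
    have h1 : ψ r ^ 2 ≤ C ^ 2 := sq_le_sq' (neg_le_of_abs_le hr) (le_of_abs_le hr)
    refine h1.trans ?_
    rw [div_mul_eq_mul_div, le_div_iff₀ he]
    exact mul_le_mul_of_nonneg_left hx (sq_nonneg _)
  rcases hψ.2.2 with ⟨c, d, hc, hd, hs⟩ | ⟨hS, -⟩
  · obtain ⟨e, he, hx⟩ := exists_x_lower hc hd
    refine ⟨C ^ 2 / e, ?_⟩
    filter_upwards [S.ae_mC_mem, hC] with r hr hCr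
    by_cases h0 : ψ r = 0
    · have := S.x_pos hr.2
      rw [h0, zero_pow two_ne_zero]
      positivity
    · exact key he (hx _ (hs r.1 r.2 h0)) hCr
  · obtain ⟨e, he, hx⟩ := hS.exists_x_lower
    refine ⟨C ^ 2 / e, ?_⟩
    filter_upwards [S.ae_mC_mem, hC] with r hr hCr
    exact key he (hx _ (Ioo_subset_Icc_self hr.2)) hCr

theorem integrable_fderiv_mul (hψ : S.IsTest ψ) (v : ℝ × ℝ) {f : ℝ × ℝ → ℝ}
    (hf : Integrable f S.mC) : Integrable (fun r => fderiv ℝ ψ r v * f r) S.mC := by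
  obtain ⟨C, -, hC⟩ := exists_bound_chart (S := S) (hψ.continuous_fderiv_apply v)
  exact hf.bdd_mul (hψ.continuous_fderiv_apply v).aestronglyMeasurable hC

theorem integrable_mul (hψ : S.IsTest ψ) {f : ℝ × ℝ → ℝ}
    (hf : Integrable f S.mC) : Integrable (fun r => ψ r * f r) S.mC := by
  obtain ⟨C, -, hC⟩ := exists_bound_chart (S := S) hψ.1.continuous
  exact hf.bdd_mul hψ.1.continuous.aestronglyMeasurable hC

theorem integrable_mul_of_weight (hψ : S.IsTest ψ) {q : ℝ × ℝ → ℝ}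
    (hq : AEStronglyMeasurable q S.mC) (hi : Integrable (fun r => S.x r.2 * q r ^ 2) S.mC) :
    Integrable (fun r => ψ r * q r) S.mC := by
  obtain ⟨K, hK⟩ := hψ.exists_weight
  exact RevSurface.integrable_mul_of_weight hq hi hψ.1.continuous.aestronglyMeasurable hK

theorem hasDerivAt_left (hψ : S.IsTest ψ) (φ t : ℝ) :
    HasDerivAt (fun s => ψ (s, t)) (fderiv ℝ ψ (φ, t) (1, 0)) φ :=
  ((hψ.1.differentiable (by simp) (φ, t)).hasFDerivAt).comp_hasDerivAt φ
    ((hasDerivAt_id φ).prodMk (hasDerivAt_const φ t))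

theorem hasDerivAt_right (hψ : S.IsTest ψ) (φ t : ℝ) :
    HasDerivAt (fun s => ψ (φ, s)) (fderiv ℝ ψ (φ, t) (0, 1)) t :=
  ((hψ.1.differentiable (by simp) (φ, t)).hasFDerivAt).comp_hasDerivAt t
    ((hasDerivAt_const t φ).prodMk (hasDerivAt_id t))

theorem contDiff_right (hψ : S.IsTest ψ) (φ : ℝ) : ContDiff ℝ ∞ fun s => ψ (φ, s) :=
  hψ.1.comp (contDiff_const.prodMk contDiff_id)

end IsTest

theorem integrable_of_weight_loop (hS : S.IsLoop) {h : ℝ → ℝ}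
    (hm : AEStronglyMeasurable h S.mI) (hi : Integrable (fun t => S.x t * h t ^ 2) S.mI) :
    MemLp h 2 S.mI := by
  obtain ⟨e, he, hx⟩ := hS.exists_x_lower
  rw [memLp_two_iff_integrable_sq hm]
  refine Integrable.mono' (hi.const_mul e⁻¹) (hm.pow 2) ?_
  filter_upwards [ae_restrict_mem measurableSet_Ioo] with t ht
  have := hx _ (Ioo_subset_Icc_self ht)
  rw [norm_pow, Real.norm_eq_abs, sq_abs, inv_mul_eq_div, le_div_iff₀ he, mul_comm]
  exact mul_le_mul_of_nonneg_right this (sq_nonneg _)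

theorem intervalIntegrable_of_mI {V : Type*} [NormedAddCommGroup V] {h : ℝ → V}
    (hi : Integrable h S.mI) {s t : ℝ} (hs : s ∈ Icc S.a S.b) (ht : t ∈ Icc S.a S.b) :
    IntervalIntegrable h volume s t := by
  have h1 : IntegrableOn h (Icc S.a S.b) := by rwa [integrableOn_Icc_iff_integrableOn_Ioo]
  rw [intervalIntegrable_iff']
  exact h1.mono_set ((ordConnected_Icc).uIcc_subset hs ht)

theorem integral_mI_eq {V : Type*} [NormedAddCommGroup V] [NormedSpace ℝ V] (h : ℝ → V) :
    ∫ t, h t ∂S.mI = ∫ t in S.a..S.b, h t := by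
  rw [intervalIntegral.integral_of_le S.lt.le, integral_Ioc_eq_integral_Ioo]

/-- The endpoint values of a primitive whose derivative is integrable. -/
theorem _root_.AxialMaps.IsPrim.exists_limits {V : Type*} [NormedAddCommGroup V] [NormedSpace ℝ V] {h h' : ℝ → V}
    (hp : IsPrim S.a S.b h h') (hi : Integrable h' S.mI) : ∃ la lb,
      Tendsto h (𝓝[>] S.a) (𝓝 la) ∧ Tendsto h (𝓝[<] S.b) (𝓝 lb) ∧
        lb - la = ∫ t, h' t ∂S.mI := by
  obtain ⟨c, hac, hcb⟩ := exists_between S.lt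
  have ha := intervalIntegrable_of_mI hi (left_mem_Icc.2 S.lt.le) ⟨hac.le, hcb.le⟩
  have hb := intervalIntegrable_of_mI hi ⟨hac.le, hcb.le⟩ (right_mem_Icc.2 S.lt.le)
  refine ⟨_, _, hp.tendsto_left ⟨hac, hcb⟩ ha, hp.tendsto_right ⟨hac, hcb⟩ hb, ?_⟩
  rw [integral_mI_eq, ← intervalIntegral.integral_add_adjacent_intervals ha hb]
  abel

/-- For a compactly supported test function there are no boundary terms. On a torus they cancel: ψ
is periodic in t, and the two endpoint limits of h agree because h' has integral zero. -/
theorem integral_test_mul_isPrim {ψ : ℝ × ℝ → ℝ} (hψ : S.IsTest ψ) {h h' : ℝ → ℝ}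
    (hp : IsPrim S.a S.b h h') (hm : AEStronglyMeasurable h' S.mI)
    (hi : Integrable (fun t => S.x t * h' t ^ 2) S.mI)
    (hloop : S.IsLoop → ∫ t, h' t ∂S.mI = 0) (φ : ℝ) :
    ∫ t, fderiv ℝ ψ (φ, t) (0, 1) * h t ∂S.mI = - ∫ t, ψ (φ, t) * h' t ∂S.mI := by
  have hd : ∀ t, deriv (fun s => ψ (φ, s)) t = fderiv ℝ ψ (φ, t) (0, 1) := fun t =>
    (hψ.hasDerivAt_right φ t).deriv
  rcases hψ.2.2 with ⟨c, d, hc, hdb, hs⟩ | ⟨hS, hper⟩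
  · have hb : IsBump S.a S.b fun s => ψ (φ, s) := by
      -- The support bounds of ψ may be in the wrong order (as for ψ = 0), so they are enlarged to a
      -- nondegenerate interval.
      obtain ⟨c', hac', hcb'⟩ := exists_between S.lt
      obtain ⟨d', hcd', hdb'⟩ := exists_between hcb'
      exact ⟨hψ.contDiff_right φ, min c c', max d d', lt_min hc hac',
        (min_le_right _ _).trans_lt (hcd'.trans_le (le_max_right _ _)), max_lt hdb hdb',
        fun t ht => ⟨(min_le_left _ _).trans (hs φ t ht).1, (hs φ t ht).2.trans (le_max_left _ _)⟩⟩
    have := hp.integral_deriv_bump hb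
    simpa only [hd] using this
  · have hint : Integrable h' S.mI := (integrable_of_weight_loop hS hm hi).integrable one_le_two
    obtain ⟨la, lb, hla, hlb, hl⟩ := hp.exists_limits hint
    rw [hloop hS, sub_eq_zero] at hl
    have hτ : IsPrim S.a S.b (fun s => ψ (φ, s)) (deriv fun s => ψ (φ, s)) :=
      IsPrim.of_contDiff ((hψ.contDiff_right φ).of_le (by norm_cast))
    have hcd := (hψ.contDiff_right φ).continuous_deriv (by simp)
    have hpm := hτ.mul hp
    obtain ⟨ca, hca⟩ := (isCompact_Icc (a := S.a) (b := S.b)).exists_bound_of_continuousOn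
      (hψ.contDiff_right φ).continuous.continuousOn
    have i2 : Integrable (fun t => ψ (φ, t) * h' t) S.mI :=
      hint.bdd_mul (hψ.contDiff_right φ).continuous.aestronglyMeasurable (c := ca) (by
        filter_upwards [ae_restrict_mem measurableSet_Ioo] with t ht
        exact hca t (Ioo_subset_Icc_self ht))
    have hhm : AEStronglyMeasurable h S.mI :=
      hp.continuousOn.aestronglyMeasurable measurableSet_Ioo
    have i1 : Integrable (fun t => deriv (fun s => ψ (φ, s)) t * h t) S.mI := by
      obtain ⟨cb, hcb⟩ := (isCompact_Icc (a := S.a) (b := S.b)).exists_bound_of_continuousOn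
        hcd.continuousOn
      have hbdd : Integrable h S.mI := by
        obtain ⟨c, hac, hcb⟩ := exists_between S.lt
        refine Integrable.of_bound hhm (|h c| + ∫ t, |h' t| ∂S.mI) ?_
        filter_upwards [ae_restrict_mem measurableSet_Ioo] with t ht
        rw [hp.eq_add ⟨hac, hcb⟩ ht]
        refine (norm_add_le _ _).trans (add_le_add le_rfl ?_)
        refine intervalIntegral.norm_integral_le_integral_norm_uIoc.trans ?_
        refine setIntegral_mono_set hint.norm (Eventually.of_forall fun _ => norm_nonneg _)
          (LE.le.eventuallyLE
            (uIoc_subset_uIcc.trans (uIcc_subset_Ioo' ⟨hac, hcb⟩ ht)))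
      exact hbdd.bdd_mul hcd.aestronglyMeasurable (c := cb) (by
        filter_upwards [ae_restrict_mem measurableSet_Ioo] with t ht
        exact hcb t (Ioo_subset_Icc_self ht))
    obtain ⟨ka, kb, hka, hkb, hk⟩ := hpm.exists_limits (i1.add i2)
    have hcont : Continuous fun s => ψ (φ, s) := (hψ.contDiff_right φ).continuous
    have e1 : ka = ψ (φ, S.a) * la := tendsto_nhds_unique hka
      ((hcont.tendsto S.a |>.mono_left nhdsWithin_le_nhds).mul hla)
    have e2 : kb = ψ (φ, S.b) * lb := tendsto_nhds_unique hkb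
      ((hcont.tendsto S.b |>.mono_left nhdsWithin_le_nhds).mul hlb)
    have e3 : ψ (φ, S.b) = ψ (φ, S.a) := by
      rw [← hper φ S.a]; congr 2; ring
    rw [e1, e2, e3, hl, sub_self, integral_add i1 i2] at hk
    simp only [hd] at hk
    linarith

theorem integral_test_mul_cs {ψ : ℝ × ℝ → ℝ} (hψ : S.IsTest ψ) (n j : ℤ) (t : ℝ) :
    ∫ φ, fderiv ℝ ψ (φ, t) (1, 0) * cs n j φ ∂circ =
      - ∫ φ, ψ (φ, t) * (n * cs n (j + 1) φ) ∂circ := by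
  have h1 := intervalIntegral.integral_deriv_mul_eq_sub (a := 0) (b := 2 * Real.pi)
    (u := fun φ => ψ (φ, t)) (v := cs n j) (fun φ _ => hψ.hasDerivAt_left φ t)
    (fun φ _ => hasDerivAt_cs n j φ)
    (((hψ.continuous_fderiv_apply (1, 0)).comp (by fun_prop : Continuous fun φ : ℝ =>
      (φ, t))).intervalIntegrable _ _)
    ((continuous_const.mul (continuous_cs n (j + 1))).intervalIntegrable _ _)
  have h2 := hψ.2.1 0 t
  have h3 := cs_periodic n j 0
  rw [zero_add] at h2 h3
  have c1 : Continuous fun φ => fderiv ℝ ψ (φ, t) (1, 0) :=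
    (hψ.continuous_fderiv_apply (1, 0)).comp (by fun_prop : Continuous fun φ : ℝ => (φ, t))
  have c2 : Continuous fun φ => ψ (φ, t) :=
    hψ.1.continuous.comp (by fun_prop : Continuous fun φ : ℝ => (φ, t))
  rw [h2, h3, sub_self, intervalIntegral.integral_add] at h1
  · rw [integral_circ, integral_circ]; linarith
  · exact (c1.mul (continuous_cs n j)).intervalIntegrable _ _
  · exact (c2.mul (continuous_const.mul (continuous_cs n (j + 1)))).intervalIntegrable _ _

theorem aestronglyMeasurable_snd {h : ℝ → ℝ} (hh : AEStronglyMeasurable h S.mI) :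
    AEStronglyMeasurable (fun r : ℝ × ℝ => h r.2) S.mC := hh.comp_snd

/-- Both weak identities follow from Fubini and integration by parts in one variable. Such products
are the components from which equivariant fields are built. -/
theorem scalarWG_cs_mul (n j : ℤ) {h h' : ℝ → ℝ} (hp : IsPrim S.a S.b h h')
    (hm : AEStronglyMeasurable h' S.mI) {B : ℝ} (hB : ∀ t ∈ Ioo S.a S.b, |h t| ≤ B)
    (hi : Integrable (fun t => S.x t * h' t ^ 2) S.mI)
    (hloop : S.IsLoop → ∫ t, h' t ∂S.mI = 0) :
    S.ScalarWG (fun r => cs n j r.1 * h r.2) (fun r => n * cs n (j + 1) r.1 * h r.2)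
      (fun r => cs n j r.1 * h' r.2) := by
  have hhm : AEStronglyMeasurable h S.mI := hp.continuousOn.aestronglyMeasurable measurableSet_Ioo
  have m1 := aestronglyMeasurable_snd hhm
  have m2 := aestronglyMeasurable_snd hm
  have mc : ∀ j, AEStronglyMeasurable (fun r : ℝ × ℝ => cs n j r.1) S.mC := fun j =>
    ((continuous_cs n j).comp continuous_fst).aestronglyMeasurable
  have hBh : ∀ᵐ r ∂S.mC, |h r.2| ≤ B := by
    filter_upwards [S.ae_mC_mem] with r hr using hB _ hr.2
  have hB2 : ∀ᵐ r ∂S.mC, |h r.2| ≤ |B| := hBh.mono fun r hr => hr.trans (le_abs_self _)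
  have mr : AEStronglyMeasurable (fun r : ℝ × ℝ => cs n j r.1 * h' r.2) S.mC := (mc j).mul m2
  have ir : Integrable (fun r : ℝ × ℝ => S.x r.2 * (cs n j r.1 * h' r.2) ^ 2) S.mC := by
    have := hi.comp_snd circ
    refine Integrable.mono' this
      ((S.continuous_x.comp continuous_snd).aestronglyMeasurable.mul (mr.pow 2)) ?_
    filter_upwards [S.ae_mC_mem] with r hr
    have hx := S.x_pos hr.2
    have h1 : cs n j r.1 ^ 2 ≤ 1 := by
      have := abs_cs_le n j r.1
      rw [← sq_abs]; nlinarith [abs_nonneg (cs n j r.1)]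
    rw [Real.norm_eq_abs, abs_of_nonneg (by positivity), mul_pow]
    have : 0 ≤ S.x r.2 * h' r.2 ^ 2 := by positivity
    nlinarith
  have ih : Integrable (fun r : ℝ × ℝ => h r.2) S.mC := Integrable.of_bound m1 B hBh
  refine ⟨(mc j).mul m1, ⟨|B|, ?_⟩, ((mc (j + 1)).const_mul _).mul m1, mr, ?_, ir,
    fun ψ hψ => ?_, fun ψ hψ => ?_⟩
  · filter_upwards [hB2] with r hr
    rw [abs_mul]
    exact (mul_le_of_le_one_left (abs_nonneg _) (abs_cs_le n j r.1)).trans hr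
  · refine Integrable.of_bound ((((mc (j + 1)).const_mul _).mul m1).pow 2) ((|(n : ℝ)| * |B|) ^ 2) ?_
    filter_upwards [hB2] with r hr
    rw [norm_pow, Real.norm_eq_abs, abs_mul, abs_mul]
    refine pow_le_pow_left₀ (by positivity) ?_ 2
    refine mul_le_mul (mul_le_of_le_one_right (abs_nonneg _) (abs_cs_le n (j + 1) r.1)) hr
      (abs_nonneg _) (abs_nonneg _)
  · have i1 := hψ.integrable_fderiv_mul (1, 0) (integrable_cs_mul_chart n j ih)
    have i2 := hψ.integrable_mul ((integrable_cs_mul_chart n (j + 1) ih).const_mul (n : ℝ))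
    have e2 : ∀ r : ℝ × ℝ, ψ r * (n * cs n (j + 1) r.1 * h r.2) =
      ψ r * (n * (cs n (j + 1) r.1 * h r.2)) := fun r => by ring
    simp only [e2]
    rw [mC, integral_prod_symm _ i1, integral_prod_symm _ i2, ← integral_neg]
    refine integral_congr_ae (Eventually.of_forall fun t => ?_)
    have := integral_test_mul_cs hψ n j t
    simp only [← mul_assoc] at this ⊢
    rw [integral_mul_const, integral_mul_const, this]
    ring
  · have i1 := hψ.integrable_fderiv_mul (0, 1) (integrable_cs_mul_chart n j ih)
    have i2 := hψ.integrable_mul_of_weight mr ir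
    rw [mC, integral_prod _ i1, integral_prod _ i2, ← integral_neg]
    refine integral_congr_ae (Eventually.of_forall fun φ => ?_)
    have := integral_test_mul_isPrim hψ hp hm hi hloop φ
    have e1 : ∀ t, fderiv ℝ ψ (φ, t) (0, 1) * (cs n j φ * h t) =
      cs n j φ * (fderiv ℝ ψ (φ, t) (0, 1) * h t) := fun t => by ring
    have e2 : ∀ t, ψ (φ, t) * (cs n j φ * h' t) = cs n j φ * (ψ (φ, t) * h' t) := fun t => by ring
    simp only [e1, e2]
    rw [integral_const_mul, integral_const_mul, this]
    ring

theorem ScalarWG.add {u p q u' p' q' : ℝ × ℝ → ℝ} (h : S.ScalarWG u p q)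
    (h' : S.ScalarWG u' p' q') : S.ScalarWG (fun r => u r + u' r) (fun r => p r + p' r)
      (fun r => q r + q' r) where
  aesm := h.aesm.add h'.aesm
  bdd := by
    obtain ⟨B, hB⟩ := h.bdd
    obtain ⟨B', hB'⟩ := h'.bdd
    exact ⟨B + B', by
      filter_upwards [hB, hB'] with r h1 h2 using (abs_add_le _ _).trans (add_le_add h1 h2)⟩
  aesm_left := h.aesm_left.add h'.aesm_left
  aesm_right := h.aesm_right.add h'.aesm_right
  int_left := by
    refine Integrable.mono' ((h.int_left.const_mul 2).add (h'.int_left.const_mul 2))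
      ((h.aesm_left.add h'.aesm_left).pow 2) (Eventually.of_forall fun r => ?_)
    rw [norm_pow, Real.norm_eq_abs, sq_abs]
    simp only [Pi.add_apply]
    nlinarith [sq_nonneg (p r - p' r)]
  int_right := by
    refine Integrable.mono' ((h.int_right.const_mul 2).add (h'.int_right.const_mul 2))
      ((S.continuous_x.comp continuous_snd).aestronglyMeasurable.mul
        ((h.aesm_right.add h'.aesm_right).pow 2)) ?_
    filter_upwards [S.ae_mC_mem] with r hr
    have hx := S.x_pos hr.2
    simp only [Pi.add_apply]
    rw [Real.norm_eq_abs, abs_of_nonneg (by positivity)]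
    nlinarith [mul_nonneg hx.le (sq_nonneg (q r - q' r))]
  weak_left ψ hψ := by
    simp only [mul_add]
    rw [integral_add (hψ.integrable_fderiv_mul _ h.integrable)
      (hψ.integrable_fderiv_mul _ h'.integrable), integral_add (hψ.integrable_mul h.integrable_left)
      (hψ.integrable_mul h'.integrable_left), h.weak_left ψ hψ, h'.weak_left ψ hψ]
    ring
  weak_right ψ hψ := by
    simp only [mul_add]
    rw [integral_add (hψ.integrable_fderiv_mul _ h.integrable)
      (hψ.integrable_fderiv_mul _ h'.integrable), integral_add
      (hψ.integrable_mul_of_weight h.aesm_right h.int_right)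
      (hψ.integrable_mul_of_weight h'.aesm_right h'.int_right), h.weak_right ψ hψ,
      h'.weak_right ψ hψ]
    ring

end RevSurface
end AxialMaps

/-! ### Vector-valued weak gradients, the Dirichlet energy, and profiles -/

namespace AxialMaps
namespace RevSurface

variable {S T : RevSurface}

theorem aestronglyMeasurable_coord {X : Type*} [MeasurableSpace X] {μ : Measure X} {f : X → E3}
    (hf : AEStronglyMeasurable f μ) (i : Fin 3) : AEStronglyMeasurable (fun x => f x i) μ :=
  (continuous_coord i).comp_aestronglyMeasurable hf

theorem E3.sq_coord_le (v : E3) (i : Fin 3) : v i ^ 2 ≤ ‖v‖ ^ 2 := by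
  rw [AxialMaps.E3.norm_sq]
  have h0 := sq_nonneg (v 0)
  have h1 := sq_nonneg (v 1)
  have h2 := sq_nonneg (v 2)
  fin_cases i <;> simp <;> linarith

theorem gradEnergy_eq (P Q : ℝ × ℝ → E3) : S.gradEnergy P Q = ∫⁻ p, ENNReal.ofReal
    ((‖P p‖ ^ 2 / S.x p.2 ^ 2 + ‖Q p‖ ^ 2 / S.speed p.2 ^ 2) * S.areaDensity p.2) ∂S.mC := by
  rw [gradEnergy, restrict_chart]

theorem measurable_x_snd : Measurable fun r : ℝ × ℝ => S.x r.2 :=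
  S.continuous_x.measurable.comp measurable_snd

theorem measurable_speed_snd : Measurable fun r : ℝ × ℝ => S.speed r.2 :=
  S.continuous_speed.measurable.comp measurable_snd

theorem measurable_areaDensity_snd : Measurable fun r : ℝ × ℝ => S.areaDensity r.2 :=
  S.continuous_areaDensity.measurable.comp measurable_snd

theorem aestronglyMeasurable_gradDensity {P Q : ℝ × ℝ → E3} (hP : AEStronglyMeasurable P S.mC)
    (hQ : AEStronglyMeasurable Q S.mC) : AEStronglyMeasurable (fun p : ℝ × ℝ =>
      (‖P p‖ ^ 2 / S.x p.2 ^ 2 + ‖Q p‖ ^ 2 / S.speed p.2 ^ 2) * S.areaDensity p.2) S.mC := by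
  have h1 := (hP.norm.aemeasurable.pow_const 2).div
    ((S.measurable_x_snd.pow_const 2).aemeasurable (μ := S.mC))
  have h2 := (hQ.norm.aemeasurable.pow_const 2).div
    ((S.measurable_speed_snd.pow_const 2).aemeasurable (μ := S.mC))
  exact ((h1.add h2).mul S.measurable_areaDensity_snd.aemeasurable).aestronglyMeasurable

theorem integrable_gradDensity {P Q : ℝ × ℝ → E3} (hP : AEStronglyMeasurable P S.mC)
    (hQ : AEStronglyMeasurable Q S.mC) (hfin : S.gradEnergy P Q < ⊤) :
    Integrable (fun p : ℝ × ℝ =>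
      (‖P p‖ ^ 2 / S.x p.2 ^ 2 + ‖Q p‖ ^ 2 / S.speed p.2 ^ 2) * S.areaDensity p.2) S.mC := by
  refine ⟨aestronglyMeasurable_gradDensity hP hQ, ?_⟩
  rw [hasFiniteIntegral_iff_ofReal, ← gradEnergy_eq]
  · exact hfin
  · filter_upwards [S.ae_mC_mem] with r hr
    have := S.areaDensity_pos hr.2
    positivity

/-- The angular term of the energy density is |P|² h₂/x, and h₂/x is bounded below. For the
meridional term |Q|² x/h₂ the weight x remains. -/
theorem integrable_left_of_gradEnergy {P Q : ℝ × ℝ → E3} (hP : AEStronglyMeasurable P S.mC)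
    (hQ : AEStronglyMeasurable Q S.mC) (hfin : S.gradEnergy P Q < ⊤) :
    Integrable (fun r => ‖P r‖ ^ 2) S.mC := by
  obtain ⟨c, C, hc, hC, hb⟩ := S.exists_weight_bounds
  refine Integrable.mono' ((integrable_gradDensity hP hQ hfin).const_mul (C / c)) (hP.norm.pow 2) ?_
  filter_upwards [S.ae_mC_mem] with r hr
  obtain ⟨h1, h2, h3⟩ := hb r.2 (Ioo_subset_Icc_self hr.2)
  have hx := S.x_pos hr.2
  have hs := hc.trans_le h1
  rw [norm_pow, norm_norm, areaDensity]
  have e : C / c * ((‖P r‖ ^ 2 / S.x r.2 ^ 2 + ‖Q r‖ ^ 2 / S.speed r.2 ^ 2) *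
      (S.x r.2 * S.speed r.2)) = ‖P r‖ ^ 2 * ((C / S.x r.2) * (S.speed r.2 / c)) +
      C / c * (‖Q r‖ ^ 2 * S.x r.2 / S.speed r.2) := by field_simp
  rw [e]
  have h4 : 1 ≤ C / S.x r.2 := (one_le_div hx).2 h3
  have h5 : 1 ≤ S.speed r.2 / c := (one_le_div hc).2 h1
  have h6 : 1 ≤ (C / S.x r.2) * (S.speed r.2 / c) := one_le_mul_of_one_le_of_one_le h4 h5
  have h7 : 0 ≤ C / c * (‖Q r‖ ^ 2 * S.x r.2 / S.speed r.2) := by positivity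
  nlinarith [sq_nonneg ‖P r‖]

theorem integrable_right_of_gradEnergy {P Q : ℝ × ℝ → E3} (hP : AEStronglyMeasurable P S.mC)
    (hQ : AEStronglyMeasurable Q S.mC) (hfin : S.gradEnergy P Q < ⊤) :
    Integrable (fun r => S.x r.2 * ‖Q r‖ ^ 2) S.mC := by
  obtain ⟨c, C, hc, hC, hb⟩ := S.exists_weight_bounds
  refine Integrable.mono' ((integrable_gradDensity hP hQ hfin).const_mul C)
    (S.measurable_x_snd.aestronglyMeasurable.mul (hQ.norm.pow 2)) ?_
  filter_upwards [S.ae_mC_mem] with r hr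
  obtain ⟨h1, h2, h3⟩ := hb r.2 (Ioo_subset_Icc_self hr.2)
  have hx := S.x_pos hr.2
  have hs := hc.trans_le h1
  rw [Real.norm_eq_abs, abs_of_nonneg (by positivity), areaDensity]
  have e : C * ((‖P r‖ ^ 2 / S.x r.2 ^ 2 + ‖Q r‖ ^ 2 / S.speed r.2 ^ 2) *
      (S.x r.2 * S.speed r.2)) = (S.x r.2 * ‖Q r‖ ^ 2) * (C / S.speed r.2) +
      C * (‖P r‖ ^ 2 * S.speed r.2 / S.x r.2) := by field_simp; ring
  rw [e]
  have h4 : 1 ≤ C / S.speed r.2 := (one_le_div hs).2 h2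
  have h7 : 0 ≤ C * (‖P r‖ ^ 2 * S.speed r.2 / S.x r.2) := by positivity
  have h8 : 0 ≤ S.x r.2 * ‖Q r‖ ^ 2 := by positivity
  nlinarith

theorem integrable_sq_coord_left {P : ℝ × ℝ → E3} (hP : AEStronglyMeasurable P S.mC)
    (h : Integrable (fun r => ‖P r‖ ^ 2) S.mC) (i : Fin 3) :
    Integrable (fun r => P r i ^ 2) S.mC := by
  refine Integrable.mono' h ((aestronglyMeasurable_coord hP i).pow 2)
    (Eventually.of_forall fun r => ?_)
  rw [norm_pow, Real.norm_eq_abs, sq_abs]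
  exact E3.sq_coord_le _ _

theorem integrable_sq_coord_right {Q : ℝ × ℝ → E3} (hQ : AEStronglyMeasurable Q S.mC)
    (h : Integrable (fun r => S.x r.2 * ‖Q r‖ ^ 2) S.mC) (i : Fin 3) :
    Integrable (fun r => S.x r.2 * Q r i ^ 2) S.mC := by
  refine Integrable.mono' h (S.measurable_x_snd.aestronglyMeasurable.mul
    ((aestronglyMeasurable_coord hQ i).pow 2)) ?_
  filter_upwards [S.ae_mC_mem] with r hr
  have hx := S.x_pos hr.2
  rw [Real.norm_eq_abs, abs_of_nonneg (by positivity)]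
  exact mul_le_mul_of_nonneg_left (E3.sq_coord_le _ _) hx.le

theorem integral_coord {X : Type*} [MeasurableSpace X] {μ : Measure X} {f : X → E3}
    (hf : Integrable f μ) (i : Fin 3) : (∫ x, f x ∂μ) i = ∫ x, f x i ∂μ :=
  ((EuclideanSpace.proj (𝕜 := ℝ) i).integral_comp_comm hf).symm

theorem integrable_of_coord {X : Type*} [MeasurableSpace X] {μ : Measure X} {f : X → E3}
    (hf : ∀ i, Integrable (fun x => f x i) μ) : Integrable f μ :=
  Integrable.of_eval_piLp hf

/-- The components of a weak gradient are weak gradients of the components. -/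
theorem IsWeakGradient.scalar {m : E3 → E3} {P Q : ℝ × ℝ → E3} (h : S.IsWeakGradient m P Q)
    (hm : AEStronglyMeasurable (fun r : ℝ × ℝ => m (S.param r.1 r.2)) S.mC)
    {B : ℝ} (hB : ∀ᵐ r ∂S.mC, ‖m (S.param r.1 r.2)‖ ≤ B) (i : Fin 3) :
    S.ScalarWG (fun r => m (S.param r.1 r.2) i) (fun r => P r i) (fun r => Q r i) := by
  have hP : AEStronglyMeasurable P S.mC := by rw [← restrict_chart]; exact h.aesm_left
  have hQ : AEStronglyMeasurable Q S.mC := by rw [← restrict_chart]; exact h.aesm_right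
  have iP := integrable_left_of_gradEnergy hP hQ h.finite
  have iQ := integrable_right_of_gradEnergy hP hQ h.finite
  have iM : Integrable (fun r : ℝ × ℝ => m (S.param r.1 r.2)) S.mC := Integrable.of_bound hm B hB
  have iP1 : ∀ i, Integrable (fun r => P r i) S.mC := fun i =>
    ((memLp_two_iff_integrable_sq (aestronglyMeasurable_coord hP i)).2
      (integrable_sq_coord_left hP iP i)).integrable one_le_two
  have iMi : ∀ i, Integrable (fun r : ℝ × ℝ => m (S.param r.1 r.2) i) S.mC := fun i =>
    (EuclideanSpace.proj (𝕜 := ℝ) i).integrable_comp iM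
  refine ⟨aestronglyMeasurable_coord hm i, ⟨B, ?_⟩, aestronglyMeasurable_coord hP i,
    aestronglyMeasurable_coord hQ i, integrable_sq_coord_left hP iP i,
    integrable_sq_coord_right hQ iQ i, fun ψ hψ => ?_, fun ψ hψ => ?_⟩
  · filter_upwards [hB] with r hr
    exact (PiLp.norm_apply_le _ i).trans hr
  · have := congrArg (fun v : E3 => v i) (h.weak_left ψ hψ)
    rw [restrict_chart] at this
    simp only [PiLp.neg_apply] at this
    rw [integral_coord, integral_coord] at this
    · simpa using this
    · exact integrable_of_coord fun i => hψ.integrable_mul (iP1 i)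
    · exact integrable_of_coord fun i => hψ.integrable_fderiv_mul _ (iMi i)
  · have := congrArg (fun v : E3 => v i) (h.weak_right ψ hψ)
    rw [restrict_chart] at this
    simp only [PiLp.neg_apply] at this
    rw [integral_coord, integral_coord] at this
    · simpa using this
    · exact integrable_of_coord fun i => hψ.integrable_mul_of_weight
        (aestronglyMeasurable_coord hQ i) (integrable_sq_coord_right hQ iQ i)
    · exact integrable_of_coord fun i => hψ.integrable_fderiv_mul _ (iMi i)

theorem isWeakGradient_of_scalar {m : E3 → E3} {P Q : ℝ × ℝ → E3}
    (hP : AEStronglyMeasurable P S.mC) (hQ : AEStronglyMeasurable Q S.mC)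
    (hfin : S.gradEnergy P Q < ⊤)
    (h : ∀ i, S.ScalarWG (fun r => m (S.param r.1 r.2) i) (fun r => P r i) (fun r => Q r i)) :
    S.IsWeakGradient m P Q := by
  refine ⟨by rwa [restrict_chart], by rwa [restrict_chart], hfin, fun ψ hψ => ?_, fun ψ hψ => ?_⟩
  · rw [restrict_chart]
    ext i
    rw [PiLp.neg_apply, integral_coord, integral_coord]
    · simpa using (h i).weak_left ψ hψ
    · exact integrable_of_coord fun i => hψ.integrable_mul (h i).integrable_left
    · exact integrable_of_coord fun i => hψ.integrable_fderiv_mul _ (h i).integrable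
  · rw [restrict_chart]
    ext i
    rw [PiLp.neg_apply, integral_coord, integral_coord]
    · simpa using (h i).weak_right ψ hψ
    · exact integrable_of_coord fun i => hψ.integrable_mul_of_weight (h i).aesm_right (h i).int_right
    · exact integrable_of_coord fun i => hψ.integrable_fderiv_mul _ (h i).integrable

/-- Uniqueness of weak gradients, applied to each component. -/
theorem dirichlet_eq {m : E3 → E3} {P Q : ℝ × ℝ → E3} (h : S.IsWeakGradient m P Q)
    (hm : AEStronglyMeasurable (fun r : ℝ × ℝ => m (S.param r.1 r.2)) S.mC)
    {B : ℝ} (hB : ∀ᵐ r ∂S.mC, ‖m (S.param r.1 r.2)‖ ≤ B) :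
    S.dirichlet m = S.gradEnergy P Q := by
  refine le_antisymm (iInf_le_of_le P (iInf_le_of_le Q (iInf_le_of_le h le_rfl))) ?_
  refine le_iInf fun P' => le_iInf fun Q' => le_iInf fun h' => ?_
  rw [gradEnergy_eq, gradEnergy_eq]
  refine (lintegral_congr_ae ?_).le
  have e1 : ∀ᵐ r ∂S.mC, ∀ i, P r i = P' r i := ae_all_iff.2 fun i =>
    (h.scalar hm hB i).ae_eq_left (h'.scalar hm hB i)
  have e2 : ∀ᵐ r ∂S.mC, ∀ i, Q r i = Q' r i := ae_all_iff.2 fun i =>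
    (h.scalar hm hB i).ae_eq_right (h'.scalar hm hB i)
  filter_upwards [e1, e2] with r h1 h2
  have hP : P r = P' r := by ext i; exact h1 i
  have hQ : Q r = Q' r := by ext i; exact h2 i
  rw [hP, hQ]

theorem exists_isWeakGradient_of_dirichlet_lt_top {m : E3 → E3} (h : S.dirichlet m < ⊤) :
    ∃ P Q, S.IsWeakGradient m P Q := by
  by_contra hcon
  push Not at hcon
  have : S.dirichlet m = ⊤ := by
    rw [dirichlet]
    simp only [iInf_eq_top]
    exact fun P Q hPQ => absurd hPQ (hcon P Q)
  exact h.ne this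

/-- The integrand of the energy of an axially (anti)symmetric map. -/
noncomputable def profileDensity (S : RevSurface) (f f' : ℝ → E3) (t : ℝ) : ℝ :=
  ((f t 0 ^ 2 + f t 1 ^ 2) / S.x t ^ 2 + ‖f' t‖ ^ 2 / S.speed t ^ 2) * S.areaDensity t

/-- The energy of an axially (anti)symmetric map with profile `f`. -/
noncomputable def profileEnergy (S : RevSurface) (g : ℝ → ℝ≥0) (a : E3 → E3) (f f' : ℝ → E3) :
    ℝ≥0∞ :=
  ENNReal.ofReal (2 * Real.pi) * ∫⁻ t, (ENNReal.ofReal (S.profileDensity f f' t) +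
    g (inner ℝ (f t) (a (S.curve t))) * ENNReal.ofReal (S.areaDensity t)) ∂S.mI

/-- Profiles, on the open parameter interval, of axially (anti)symmetric maps of finite Dirichlet
energy. -/
structure IsProfile (S T : RevSurface) (f f' : ℝ → E3) : Prop where
  prim : IsPrim S.a S.b f f'
  aesm : AEStronglyMeasurable f' S.mI
  mem : ∀ t ∈ Ioo S.a S.b, f t ∈ T.carrier
  loop : S.IsLoop → ∫ t, f' t ∂S.mI = 0
  fin : ∫⁻ t, ENNReal.ofReal (S.profileDensity f f' t) ∂S.mI < ⊤

/-- `m` is the field `(φ, t) ↦ Aᵀ(σ φ) f(t)`. -/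
def IsField (S : RevSurface) (σ : ℤ) (f : ℝ → E3) (m : E3 → E3) : Prop :=
  ∀ φ, ∀ t ∈ Ioo S.a S.b, m (S.param φ t) = axialRot (σ * φ) (f t)

/-- Equivariance with respect to rotations: axial symmetry for `σ = 1` and axial antisymmetry for
`σ = -1`. -/
def Equivariant (S : RevSurface) (σ : ℤ) (u : E3 → E3) : Prop :=
  ∀ φ : ℝ, ∀ ξ ∈ S.carrier, u (axialRot φ ξ) = axialRot (σ * φ) (u ξ)

theorem lintegral_snd {F : ℝ → ℝ≥0∞} (hF : AEMeasurable F S.mI) :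
    ∫⁻ r, F r.2 ∂S.mC = ENNReal.ofReal (2 * Real.pi) * ∫⁻ t, F t ∂S.mI := by
  rw [mC, lintegral_prod_symm _ hF.comp_snd]
  simp only [lintegral_const, Measure.restrict_apply_univ, Real.volume_Ioc, sub_zero]
  rw [lintegral_mul_const'' _ hF, mul_comm]

namespace IsProfile

variable {f f' : ℝ → E3}

theorem aesm_fun (h : IsProfile S T f f') : AEStronglyMeasurable f S.mI :=
  h.prim.continuousOn.aestronglyMeasurable measurableSet_Ioo

theorem aemeasurable_density (h : IsProfile S T f f') :
    AEMeasurable (S.profileDensity f f') S.mI := by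
  have hx := S.continuous_x.measurable
  have hs := S.continuous_speed.measurable
  have h0 := (aestronglyMeasurable_coord h.aesm_fun 0).aemeasurable
  have h1 := (aestronglyMeasurable_coord h.aesm_fun 1).aemeasurable
  exact ((((h0.pow_const 2).add (h1.pow_const 2)).div (hx.pow_const 2).aemeasurable).add
    ((h.aesm.norm.aemeasurable.pow_const 2).div (hs.pow_const 2).aemeasurable)).mul
      S.continuous_areaDensity.measurable.aemeasurable

theorem profileDensity_nonneg {t : ℝ} (ht : t ∈ Ioo S.a S.b) : 0 ≤ S.profileDensity f f' t := by
  have := S.areaDensity_pos ht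
  unfold profileDensity
  positivity

theorem integrable_density (h : IsProfile S T f f') : Integrable (S.profileDensity f f') S.mI := by
  refine ⟨h.aemeasurable_density.aestronglyMeasurable, ?_⟩
  rw [hasFiniteIntegral_iff_ofReal]
  · exact h.fin
  · filter_upwards [ae_restrict_mem measurableSet_Ioo] with t ht using profileDensity_nonneg ht

theorem integrable_deriv (h : IsProfile S T f f') :
    Integrable (fun t => S.x t * ‖f' t‖ ^ 2) S.mI := by
  obtain ⟨c, C, hc, hC, hb⟩ := S.exists_weight_bounds
  refine Integrable.mono' (h.integrable_density.const_mul C)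
    (S.continuous_x.aestronglyMeasurable.mul (h.aesm.norm.pow 2)) ?_
  filter_upwards [ae_restrict_mem measurableSet_Ioo] with t ht
  obtain ⟨h1, h2, h3⟩ := hb t (Ioo_subset_Icc_self ht)
  have hx := S.x_pos ht
  have hs := hc.trans_le h1
  rw [Real.norm_eq_abs, abs_of_nonneg (by positivity), profileDensity, areaDensity]
  have e : C * (((f t 0 ^ 2 + f t 1 ^ 2) / S.x t ^ 2 + ‖f' t‖ ^ 2 / S.speed t ^ 2) *
      (S.x t * S.speed t)) = (S.x t * ‖f' t‖ ^ 2) * (C / S.speed t) +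
      C * ((f t 0 ^ 2 + f t 1 ^ 2) * S.speed t / S.x t) := by field_simp; ring
  rw [e]
  have h4 : 1 ≤ C / S.speed t := (one_le_div hs).2 h2
  have h7 : 0 ≤ C * ((f t 0 ^ 2 + f t 1 ^ 2) * S.speed t / S.x t) := by positivity
  have h8 : 0 ≤ S.x t * ‖f' t‖ ^ 2 := by positivity
  nlinarith

theorem integrable_deriv_coord (h : IsProfile S T f f') (i : Fin 3) :
    Integrable (fun t => S.x t * f' t i ^ 2) S.mI := by
  refine Integrable.mono' h.integrable_deriv (S.continuous_x.aestronglyMeasurable.mul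
    ((aestronglyMeasurable_coord h.aesm i).pow 2)) ?_
  filter_upwards [ae_restrict_mem measurableSet_Ioo] with t ht
  have hx := S.x_pos ht
  rw [Real.norm_eq_abs, abs_of_nonneg (by positivity)]
  exact mul_le_mul_of_nonneg_left (E3.sq_coord_le _ _) hx.le

/-- Together with `integrable_deriv_coord` this is what forces the horizontal components of a
profile to vanish at the axis. -/
theorem integrable_perp (h : IsProfile S T f f') :
    Integrable (fun t => (f t 0 ^ 2 + f t 1 ^ 2) / S.x t) S.mI := by
  obtain ⟨c, C, hc, hC, hb⟩ := S.exists_weight_bounds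
  have h0 := (aestronglyMeasurable_coord h.aesm_fun 0).aemeasurable
  have h1 := (aestronglyMeasurable_coord h.aesm_fun 1).aemeasurable
  refine Integrable.mono' (h.integrable_density.const_mul c⁻¹)
    (((h0.pow_const 2).add (h1.pow_const 2)).div
      S.continuous_x.measurable.aemeasurable).aestronglyMeasurable ?_
  filter_upwards [ae_restrict_mem measurableSet_Ioo] with t ht
  obtain ⟨h1, h2, h3⟩ := hb t (Ioo_subset_Icc_self ht)
  have hx := S.x_pos ht
  have hs := hc.trans_le h1
  rw [Real.norm_eq_abs, abs_of_nonneg (by positivity), profileDensity, areaDensity]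
  have e : c⁻¹ * (((f t 0 ^ 2 + f t 1 ^ 2) / S.x t ^ 2 + ‖f' t‖ ^ 2 / S.speed t ^ 2) *
      (S.x t * S.speed t)) = (f t 0 ^ 2 + f t 1 ^ 2) / S.x t * (S.speed t / c) +
      c⁻¹ * (‖f' t‖ ^ 2 * S.x t / S.speed t) := by field_simp
  rw [e]
  have h4 : 1 ≤ S.speed t / c := (one_le_div hc).2 h1
  have h7 : 0 ≤ c⁻¹ * (‖f' t‖ ^ 2 * S.x t / S.speed t) := by positivity
  have h8 : 0 ≤ (f t 0 ^ 2 + f t 1 ^ 2) / S.x t := by positivity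
  nlinarith

theorem prim_coord (h : IsProfile S T f f') (i : Fin 3) :
    IsPrim S.a S.b (fun t => f t i) (fun t => f' t i) :=
  h.prim.clm (EuclideanSpace.proj (𝕜 := ℝ) i)

theorem memLp_loop (h : IsProfile S T f f') (hS : S.IsLoop) (i : Fin 3) :
    MemLp (fun t => f' t i) 2 S.mI :=
  integrable_of_weight_loop hS (aestronglyMeasurable_coord h.aesm i) (h.integrable_deriv_coord i)

theorem integrable_deriv_loop (h : IsProfile S T f f') (hS : S.IsLoop) : Integrable f' S.mI :=
  integrable_of_coord fun i => (h.memLp_loop hS i).integrable one_le_two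

theorem loop_coord (h : IsProfile S T f f') (hS : S.IsLoop) (i : Fin 3) :
    ∫ t, f' t i ∂S.mI = 0 := by
  rw [← integral_coord (h.integrable_deriv_loop hS), h.loop hS]; rfl

theorem exists_bound (h : IsProfile S T f f') :
    ∃ B, 0 ≤ B ∧ ∀ t ∈ Ioo S.a S.b, ‖f t‖ ≤ B := by
  obtain ⟨B, hB0, hB⟩ := T.exists_bound_carrier
  exact ⟨B, hB0, fun t ht => hB _ (h.mem t ht)⟩

/-- The building block `cs n j ⊗ f i`. -/
theorem scalarWG (h : IsProfile S T f f') (n j : ℤ) (i : Fin 3) :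
    S.ScalarWG (fun r => cs n j r.1 * f r.2 i) (fun r => n * cs n (j + 1) r.1 * f r.2 i)
      (fun r => cs n j r.1 * f' r.2 i) := by
  obtain ⟨B, -, hB⟩ := h.exists_bound
  exact scalarWG_cs_mul n j (h.prim_coord i) (aestronglyMeasurable_coord h.aesm i)
    (fun t ht => (PiLp.norm_apply_le _ i).trans (hB t ht)) (h.integrable_deriv_coord i)
    fun hS => h.loop_coord hS i

end IsProfile

end RevSurface
end AxialMaps

end

/-! ### The energy of equivariant fields -/

section

open Filter Topology

namespace AxialMaps

theorem cs_neg_one (n : ℤ) (φ : ℝ) : cs n (-1) φ = Real.sin (n * φ) := by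
  have h := cs_add_two n (-1) φ
  rw [show (-1 + 2 : ℤ) = 1 by norm_num, cs_one] at h
  linarith

theorem cs_two (n : ℤ) (φ : ℝ) : cs n 2 φ = - Real.cos (n * φ) := by
  have h := cs_add_two n 0 φ
  rwa [zero_add, cs_zero] at h

theorem aesm_axialRot {X : Type*} [MeasurableSpace X] {μ : Measure X} {f : X → ℝ} {v : X → E3}
    (hf : AEStronglyMeasurable f μ) (hv : AEStronglyMeasurable v μ) :
    AEStronglyMeasurable (fun x => axialRot (f x) (v x)) μ := by
  have h := continuous_axialRot.comp_aestronglyMeasurable (hf.prodMk hv)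
  exact h

theorem aesm_E3 {X : Type*} [MeasurableSpace X] {μ : Measure X} {f g h : X → ℝ}
    (hf : AEStronglyMeasurable f μ) (hg : AEStronglyMeasurable g μ)
    (hh : AEStronglyMeasurable h μ) :
    AEStronglyMeasurable (fun x => (!₂[f x, g x, h x] : E3)) μ :=
  (continuous_E3 continuous_fst continuous_snd.fst continuous_snd.snd).comp_aestronglyMeasurable
    (hf.prodMk (hg.prodMk hh))

theorem axialRot_int_mul_add (σ : ℤ) (φ ψ : ℝ) (v : E3) :
    axialRot (σ * (φ + ψ)) v = axialRot (σ * φ) (axialRot (σ * ψ) v) := by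
  rw [mul_add, axialRot_add]

namespace RevSurface

variable {S T : RevSurface}

theorem sq_eq_one_of_sign {σ : ℤ} (hσ : σ = 1 ∨ σ = -1) : (σ : ℝ) ^ 2 = 1 := by
  rcases hσ with rfl | rfl <;> norm_num

/-- The angular derivative of a field with profile `f`. -/
noncomputable def fieldDeriv (σ : ℤ) (f : ℝ → E3) (r : ℝ × ℝ) : E3 :=
  !₂[σ * cs σ 1 r.1 * f r.2 0 + σ * cs σ 2 r.1 * f r.2 1,
    σ * cs σ 0 r.1 * f r.2 0 + σ * cs σ 1 r.1 * f r.2 1, 0]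

theorem norm_sq_fieldDeriv {σ : ℤ} (hσ : σ = 1 ∨ σ = -1) (f : ℝ → E3) (r : ℝ × ℝ) :
    ‖fieldDeriv σ f r‖ ^ 2 = f r.2 0 ^ 2 + f r.2 1 ^ 2 := by
  rw [E3.norm_sq]
  simp only [fieldDeriv, PiLp.toLp_apply, Matrix.cons_val_zero, Matrix.cons_val_one,
    Matrix.cons_val, cs_zero, cs_one, cs_two]
  have h1 := sq_eq_one_of_sign hσ
  have h2 := Real.sin_sq_add_cos_sq (σ * r.1)
  linear_combination (f r.2 0 ^ 2 + f r.2 1 ^ 2) * ((σ : ℝ) ^ 2 * h2 + h1)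

theorem IsField.aesm {f : ℝ → E3} {σ : ℤ} {m : E3 → E3} (hm : S.IsField σ f m)
    (haf : AEStronglyMeasurable f S.mI) :
    AEStronglyMeasurable (fun r : ℝ × ℝ => m (S.param r.1 r.2)) S.mC := by
  have h1 : AEStronglyMeasurable (fun r : ℝ × ℝ => axialRot (σ * r.1) (f r.2)) S.mC :=
    aesm_axialRot (measurable_const.mul measurable_fst).aestronglyMeasurable haf.comp_snd
  refine h1.congr ?_
  filter_upwards [S.ae_mC_mem] with r hr
  exact (hm r.1 r.2 hr.2).symm

theorem IsField.bound {f : ℝ → E3} {σ : ℤ} {m : E3 → E3} (hm : S.IsField σ f m) {B : ℝ}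
    (hB : ∀ t ∈ Ioo S.a S.b, ‖f t‖ ≤ B) : ∀ᵐ r ∂S.mC, ‖m (S.param r.1 r.2)‖ ≤ B := by
  filter_upwards [S.ae_mC_mem] with r hr
  rw [hm r.1 r.2 hr.2, norm_axialRot]
  exact hB _ hr.2

namespace IsProfile

variable {f f' : ℝ → E3} {σ : ℤ} {m : E3 → E3}

theorem gradEnergy_field (h : IsProfile S T f f') (hσ : σ = 1 ∨ σ = -1) :
    S.gradEnergy (fieldDeriv σ f) (fun r => axialRot (σ * r.1) (f' r.2)) =
      ENNReal.ofReal (2 * Real.pi) * ∫⁻ t, ENNReal.ofReal (S.profileDensity f f' t) ∂S.mI := by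
  rw [gradEnergy_eq, ← lintegral_snd h.aemeasurable_density.ennreal_ofReal]
  simp only [norm_sq_fieldDeriv hσ, norm_axialRot, profileDensity]

theorem aesm_rot_deriv (h : IsProfile S T f f') (σ : ℤ) :
    AEStronglyMeasurable (fun r : ℝ × ℝ => axialRot (σ * r.1) (f' r.2)) S.mC :=
  aesm_axialRot (measurable_const.mul measurable_fst).aestronglyMeasurable h.aesm.comp_snd

theorem aesm_fieldDeriv (h : IsProfile S T f f') (σ : ℤ) :
    AEStronglyMeasurable (fieldDeriv σ f) S.mC := by
  have hc : ∀ j, AEStronglyMeasurable (fun r : ℝ × ℝ => (σ : ℝ) * cs σ j r.1) S.mC := fun j =>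
    (continuous_const.mul ((continuous_cs σ j).comp continuous_fst)).aestronglyMeasurable
  have hv : ∀ i : Fin 3, AEStronglyMeasurable (fun r : ℝ × ℝ => f r.2 i) S.mC := fun i =>
    (aestronglyMeasurable_coord h.aesm_fun i).comp_snd
  exact aesm_E3 (((hc 1).mul (hv 0)).add ((hc 2).mul (hv 1)))
    (((hc 0).mul (hv 0)).add ((hc 1).mul (hv 1))) aestronglyMeasurable_const

/-- Each horizontal component of the field is a sum of two products of a trigonometric monomial of
frequency σ and a component of f. The vertical component has frequency zero. -/
theorem isWeakGradient (h : IsProfile S T f f') (hσ : σ = 1 ∨ σ = -1) (hm : S.IsField σ f m) :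
    S.IsWeakGradient m (fieldDeriv σ f) (fun r => axialRot (σ * r.1) (f' r.2)) := by
  refine isWeakGradient_of_scalar (h.aesm_fieldDeriv σ) (h.aesm_rot_deriv σ) ?_ fun i => ?_
  · rw [h.gradEnergy_field hσ]
    exact ENNReal.mul_lt_top ENNReal.ofReal_lt_top h.fin
  · fin_cases i
    · refine ((h.scalarWG σ 0 0).add (h.scalarWG σ 1 1)).congr ?_ ?_ ?_
      · filter_upwards [S.ae_mC_mem] with r hr
        simp only [Fin.zero_eta, hm r.1 r.2 hr.2, axialRot_zero_apply, cs_zero, cs_one]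
        ring
      · refine Eventually.of_forall fun r => ?_
        simp only [fieldDeriv, zero_add, Fin.zero_eta]; rfl
      · refine Eventually.of_forall fun r => ?_
        simp only [Fin.zero_eta, axialRot_zero_apply, cs_zero, cs_one]
        ring
    · refine ((h.scalarWG σ (-1) 0).add (h.scalarWG σ 0 1)).congr ?_ ?_ ?_
      · filter_upwards [S.ae_mC_mem] with r hr
        simp only [Fin.mk_one, hm r.1 r.2 hr.2, axialRot_one_apply, cs_zero, cs_neg_one]
      · refine Eventually.of_forall fun r => ?_
        simp only [fieldDeriv, zero_add, Fin.mk_one, neg_add_cancel]; rfl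
      · refine Eventually.of_forall fun r => ?_
        simp only [Fin.mk_one, axialRot_one_apply, cs_zero, cs_neg_one]
    · refine (h.scalarWG 0 0 2).congr ?_ ?_ ?_
      · filter_upwards [S.ae_mC_mem] with r hr
        have e : cs 0 0 r.1 = 1 := by simp [cs]
        simp only [Fin.reduceFinMk, hm r.1 r.2 hr.2, axialRot_two_apply, e, one_mul]
      · refine Eventually.of_forall fun r => ?_
        simp [fieldDeriv]
      · refine Eventually.of_forall fun r => ?_
        have e : cs 0 0 r.1 = 1 := by simp [cs]
        simp only [Fin.reduceFinMk, axialRot_two_apply, e, one_mul]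

theorem dirichlet_field (h : IsProfile S T f f') (hσ : σ = 1 ∨ σ = -1) (hm : S.IsField σ f m) :
    S.dirichlet m =
      ENNReal.ofReal (2 * Real.pi) * ∫⁻ t, ENNReal.ofReal (S.profileDensity f f' t) ∂S.mI := by
  obtain ⟨B, -, hB⟩ := h.exists_bound
  rw [dirichlet_eq (h.isWeakGradient hσ hm) (hm.aesm h.aesm_fun) (hm.bound hB),
    h.gradEnergy_field hσ]

theorem memH1Map (h : IsProfile S T f f') (hσ : σ = 1 ∨ σ = -1) (hm : S.IsField σ f m) :
    S.MemH1Map T m := by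
  obtain ⟨B, -, hB⟩ := h.exists_bound
  refine ⟨⟨?_, _, _, h.isWeakGradient hσ hm⟩, ?_⟩
  · refine MemLp.of_bound (aestronglyMeasurable_area_iff S |>.2 (hm.aesm h.aesm_fun)) B ?_
    rw [ae_area_iff]
    exact hm.bound hB
  · rw [ae_area_iff]
    filter_upwards [S.ae_mC_mem] with r hr
    rw [hm r.1 r.2 hr.2]
    exact T.axialRot_mem (h.mem _ hr.2) _

end IsProfile

/-- The weight of the anisotropy is compatible with equivariant fields. -/
theorem inner_field {σ : ℤ} {a : E3 → E3} (ha : S.Equivariant σ a) {f : ℝ → E3} {m : E3 → E3}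
    (hm : S.IsField σ f m) (φ : ℝ) {t : ℝ} (ht : t ∈ Ioo S.a S.b) :
    (inner ℝ (m (S.param φ t)) (a (S.param φ t)) : ℝ) = inner ℝ (f t) (a (S.curve t)) := by
  have h1 := ha φ (S.param 0 t) (S.param_mem 0 (Ioo_subset_Icc_self ht))
  rw [axialRot_param, add_zero, param_zero] at h1
  rw [hm φ t ht, h1, inner_axialRot]

theorem continuousOn_comp_curve {a : E3 → E3} (ha : ∃ K : ℝ≥0, LipschitzOnWith K a S.carrier) :
    ContinuousOn (fun r : ℝ × ℝ => a (S.param r.1 r.2)) (univ ×ˢ Icc S.a S.b) := by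
  obtain ⟨K, hK⟩ := ha
  exact hK.continuousOn.comp S.continuous_param.continuousOn fun r hr => S.param_mem _ hr.2

theorem aesm_comp_param {a : E3 → E3} (ha : ∃ K : ℝ≥0, LipschitzOnWith K a S.carrier) :
    AEStronglyMeasurable (fun r : ℝ × ℝ => a (S.param r.1 r.2)) S.mC := by
  rw [mC_eq]
  exact ((continuousOn_comp_curve ha).mono fun r hr =>
    ⟨mem_univ _, Ioo_subset_Icc_self hr.2⟩).aestronglyMeasurable S.measurableSet_openChart

theorem aesm_comp_curve {a : E3 → E3} (ha : ∃ K : ℝ≥0, LipschitzOnWith K a S.carrier) :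
    AEStronglyMeasurable (fun t => a (S.curve t)) S.mI := by
  have h := (continuousOn_comp_curve ha).comp (f := fun t : ℝ => ((0 : ℝ), t)) (s := Ioo S.a S.b)
    (by fun_prop) fun t ht => ⟨mem_univ _, Ioo_subset_Icc_self ht⟩
  have h2 : ContinuousOn (fun t => a (S.curve t)) (Ioo S.a S.b) :=
    h.congr fun t _ => by simp [param_zero]
  exact h2.aestronglyMeasurable measurableSet_Ioo

theorem norm_sq_crossE3_circleMean {m : E3 → E3} {t : ℝ}
    (hi : Integrable (fun θ => m (S.param θ t)) circ) (φ : ℝ) :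
    ‖crossE3 (circleMean m (S.param φ t))‖ ^ 2 = ((2 * Real.pi)⁻¹) ^ 2 *
      ((∫ θ, m (S.param θ t) 0 ∂circ) ^ 2 + (∫ θ, m (S.param θ t) 1 ∂circ) ^ 2) := by
  rw [norm_sq_crossE3, circleMean_param, PiLp.smul_apply, PiLp.smul_apply, integral_coord hi,
    integral_coord hi]
  simp only [smul_eq_mul]
  ring

theorem integral_trig_sign {σ : ℤ} (hσ : σ = 1 ∨ σ = -1) (j : ℤ) : ∫ φ, cs σ j φ ∂circ = 0 := by
  rw [integral_cs, if_neg]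
  rcases hσ with rfl | rfl <;> norm_num

theorem integrable_cs_circ (n j : ℤ) : Integrable (cs n j) circ :=
  (continuous_cs n j).integrableOn_Icc.mono_set Ioc_subset_Icc_self

/-- The horizontal components have frequency σ ≠ 0, so their averages vanish. Hence equivariant
fields pay no penalty. -/
theorem circleMean_field {σ : ℤ} (hσ : σ = 1 ∨ σ = -1) {f : ℝ → E3} {m : E3 → E3}
    (hm : S.IsField σ f m) (φ : ℝ) {t : ℝ} (ht : t ∈ Ioo S.a S.b) :
    ‖crossE3 (circleMean m (S.param φ t))‖ ^ 2 = 0 := by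
  have hi : Integrable (fun θ => m (S.param θ t)) circ := by
    simp only [hm _ t ht]
    exact ((continuous_axialRot.comp (by fun_prop : Continuous fun θ : ℝ =>
      ((σ : ℝ) * θ, f t))).integrableOn_Icc).mono_set Ioc_subset_Icc_self
  rw [norm_sq_crossE3_circleMean hi]
  have e0 : ∀ θ, m (S.param θ t) 0 = cs σ 0 θ * f t 0 + cs σ 1 θ * f t 1 := fun θ => by
    rw [hm θ t ht, axialRot_zero_apply, cs_zero, cs_one]; ring
  have e1 : ∀ θ, m (S.param θ t) 1 = cs σ (-1) θ * f t 0 + cs σ 0 θ * f t 1 := fun θ => by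
    rw [hm θ t ht, axialRot_one_apply, cs_zero, cs_neg_one]
  simp only [e0, e1]
  rw [integral_add ((integrable_cs_circ _ _).mul_const _) ((integrable_cs_circ _ _).mul_const _),
    integral_add ((integrable_cs_circ _ _).mul_const _) ((integrable_cs_circ _ _).mul_const _)]
  simp only [integral_mul_const, integral_trig_sign hσ]
  ring

theorem penalty_field {σ : ℤ} (hσ : σ = 1 ∨ σ = -1) {f : ℝ → E3} {m : E3 → E3}
    (hm : S.IsField σ f m) (ω : E3 → ℝ≥0) : S.penalty ω m = 0 := by
  rw [penalty, lintegral_area, lintegral_eq_zero_of_ae_eq_zero]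
  filter_upwards [S.ae_mC_mem] with r hr
  rw [circleMean_field hσ hm r.1 hr.2]
  simp

theorem anisotropy_eq (g : ℝ → ℝ≥0) (a m : E3 → E3) : S.anisotropy g a m =
    ∫⁻ r, g (inner ℝ (m (S.param r.1 r.2)) (a (S.param r.1 r.2))) *
      ENNReal.ofReal (S.areaDensity r.2) ∂S.mC := by
  rw [anisotropy, lintegral_area]

theorem IsProfile.aemeasurable_aniso {f f' : ℝ → E3} (h : IsProfile S T f f') {g : ℝ → ℝ≥0}
    (hg : ∃ K : ℝ≥0, LipschitzWith K g) {a : E3 → E3}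
    (ha : ∃ K : ℝ≥0, LipschitzOnWith K a S.carrier) :
    AEMeasurable (fun t => (g (inner ℝ (f t) (a (S.curve t))) : ℝ≥0∞) *
      ENNReal.ofReal (S.areaDensity t)) S.mI := by
  obtain ⟨K, hK⟩ := hg
  have h1 : AEStronglyMeasurable (fun t => (inner ℝ (f t) (a (S.curve t)) : ℝ)) S.mI :=
    h.aesm_fun.inner (aesm_comp_curve ha)
  exact (hK.continuous.measurable.comp_aemeasurable h1.aemeasurable).coe_nnreal_ennreal.mul
    (ENNReal.measurable_ofReal.comp S.continuous_areaDensity.measurable).aemeasurable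

theorem IsProfile.anisotropy_field {f f' : ℝ → E3} (h : IsProfile S T f f') {σ : ℤ} {g : ℝ → ℝ≥0}
    (hg : ∃ K : ℝ≥0, LipschitzWith K g) {a : E3 → E3}
    (ha : ∃ K : ℝ≥0, LipschitzOnWith K a S.carrier) (hae : S.Equivariant σ a) {m : E3 → E3}
    (hm : S.IsField σ f m) : S.anisotropy g a m = ENNReal.ofReal (2 * Real.pi) *
      ∫⁻ t, g (inner ℝ (f t) (a (S.curve t))) * ENNReal.ofReal (S.areaDensity t) ∂S.mI := by
  rw [anisotropy_eq, ← lintegral_snd (h.aemeasurable_aniso hg ha)]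
  refine lintegral_congr_ae ?_
  filter_upwards [S.ae_mC_mem] with r hr
  rw [inner_field hae hm r.1 hr.2]

/-- The reduction to one variable: the circle integrals contribute the factor 2π and the penalty
drops out. -/
theorem IsProfile.energy_field {f f' : ℝ → E3} (h : IsProfile S T f f') {σ : ℤ}
    (hσ : σ = 1 ∨ σ = -1) {g : ℝ → ℝ≥0}
    (hg : ∃ K : ℝ≥0, LipschitzWith K g) {a : E3 → E3}
    (ha : ∃ K : ℝ≥0, LipschitzOnWith K a S.carrier) (hae : S.Equivariant σ a) {m : E3 → E3}
    (hm : S.IsField σ f m) (ω : E3 → ℝ≥0) : S.energy ω g a m = S.profileEnergy g a f f' := by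
  rw [energy, h.dirichlet_field hσ hm, h.anisotropy_field hg ha hae hm, penalty_field hσ hm,
    add_zero, profileEnergy, lintegral_add_left' h.aemeasurable_density.ennreal_ofReal, mul_add]

end RevSurface
end AxialMaps

/-! ### Boundary values of profiles, and fields with a given profile -/

namespace AxialMaps

theorem tendsto_E3 {X : Type*} {l : Filter X} {f : X → E3} {a b c : ℝ}
    (h0 : Tendsto (fun x => f x 0) l (𝓝 a)) (h1 : Tendsto (fun x => f x 1) l (𝓝 b))
    (h2 : Tendsto (fun x => f x 2) l (𝓝 c)) : Tendsto f l (𝓝 !₂[a, b, c]) := by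
  have h := (PiLp.continuous_toLp 2 (fun _ : Fin 3 => ℝ)).tendsto ![a, b, c]
  have h3 : Tendsto (fun x => ![f x 0, f x 1, f x 2]) l (𝓝 ![a, b, c]) := by
    rw [tendsto_pi_nhds]
    intro i
    fin_cases i <;> assumption
  refine (h.comp h3).congr fun x => ?_
  exact E3.ext' rfl rfl rfl

namespace RevSurface

variable {S T : RevSurface}

theorem exists_x_lower_left (ha : 0 < S.x S.a) {c : ℝ} (hc : c < S.b) :
    ∃ e, 0 < e ∧ ∀ t ∈ Icc S.a c, e ≤ S.x t := by
  rcases le_or_gt S.a c with hac | hac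
  · obtain ⟨t0, ht0, h0⟩ := isCompact_Icc.exists_isMinOn (nonempty_Icc.2 hac)
      S.continuous_x.continuousOn
    refine ⟨S.x t0, ?_, fun t ht => h0 ht⟩
    rcases ht0.1.eq_or_lt with h | h
    · rwa [← h]
    · exact S.x_pos ⟨h, ht0.2.trans_lt hc⟩
  · exact ⟨1, one_pos, fun t ht => absurd (ht.1.trans ht.2) (not_le.2 hac)⟩

theorem exists_x_lower_right (hb : 0 < S.x S.b) {c : ℝ} (hc : S.a < c) :
    ∃ e, 0 < e ∧ ∀ t ∈ Icc c S.b, e ≤ S.x t := by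
  rcases le_or_gt c S.b with hcb | hcb
  · obtain ⟨t0, ht0, h0⟩ := isCompact_Icc.exists_isMinOn (nonempty_Icc.2 hcb)
      S.continuous_x.continuousOn
    refine ⟨S.x t0, ?_, fun t ht => h0 ht⟩
    rcases ht0.2.eq_or_lt with h | h
    · rwa [h]
    · exact S.x_pos ⟨hc.trans_le ht0.1, h⟩
  · exact ⟨1, one_pos, fun t ht => absurd (ht.1.trans ht.2) (not_le.2 hcb)⟩

/-- A derivative which is square integrable for the weight `x` is integrable where `x` is bounded
below. -/
theorem integrableOn_of_weight {V : Type*} [NormedAddCommGroup V] {f' : ℝ → V}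
    (hm : AEStronglyMeasurable f' S.mI) (hi : Integrable (fun t => S.x t * ‖f' t‖ ^ 2) S.mI)
    {E : Set ℝ} (hE : MeasurableSet E) (hEs : E ⊆ Ioo S.a S.b) {e : ℝ} (he : 0 < e)
    (hx : ∀ t ∈ E, e ≤ S.x t) : IntegrableOn f' E := by
  have hm' : AEStronglyMeasurable f' (volume.restrict E) := hm.mono_set hEs
  have hi' : IntegrableOn (fun t => S.x t * ‖f' t‖ ^ 2) E :=
    hi.mono_measure (Measure.restrict_mono hEs le_rfl)
  have hfin : volume E ≠ ⊤ := ((measure_mono hEs).trans_lt (by simp)).ne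
  have h1 : IntegrableOn (fun _ : ℝ => (1 : ℝ)) E := integrableOn_const hfin
  refine Integrable.mono' (h1.add (hi'.const_mul e⁻¹)) hm' ?_
  filter_upwards [ae_restrict_mem hE] with t ht
  have h2 : ‖f' t‖ ^ 2 ≤ e⁻¹ * (S.x t * ‖f' t‖ ^ 2) := by
    rw [inv_mul_eq_div, le_div_iff₀ he, mul_comm]
    exact mul_le_mul_of_nonneg_right (hx t ht) (sq_nonneg _)
  simp only [Pi.add_apply]
  nlinarith [sq_nonneg (‖f' t‖ - 1), norm_nonneg (f' t)]

/-- The weight x is bounded below on compact subintervals, so weighted square integrability supplies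
the local integrability which the identity for differences alone does not contain. -/
theorem isPrim_of_weight {V : Type*} [NormedAddCommGroup V] [NormedSpace ℝ V] {f f' : ℝ → V}
    (hm : AEStronglyMeasurable f' S.mI) (hi : Integrable (fun t => S.x t * ‖f' t‖ ^ 2) S.mI)
    (hsub : ∀ s ∈ Ioo S.a S.b, ∀ t ∈ Ioo S.a S.b, f t - f s = ∫ r in s..t, f' r) :
    IsPrim S.a S.b f f' := by
  refine IsPrim.of_integrableOn (fun c d hc _ hd => ?_) hsub
  obtain ⟨e, he, hx⟩ := S.exists_x_lower hc hd
  exact integrableOn_of_weight hm hi measurableSet_Icc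
    (fun t ht => ⟨hc.trans_le ht.1, ht.2.trans_lt hd⟩) he hx

/-- A curve in a surface of revolution which approaches the axis converges. -/
theorem exists_tendsto_of_perp_zero {l : Filter ℝ} [l.NeBot] {f : ℝ → E3}
    (hl : ∀ s ∈ l, ∃ u ∈ l, u ⊆ s ∧ IsPreconnected u ∧ ContinuousOn (fun t => f t 2) u)
    (hT : ∀ᶠ t in l, f t ∈ T.carrier) (h0 : Tendsto (fun t => f t 0) l (𝓝 0))
    (h1 : Tendsto (fun t => f t 1) l (𝓝 0)) : ∃ c, Tendsto f l (𝓝 !₂[0, 0, c]) := by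
  obtain ⟨B, -, hB⟩ := T.exists_bound_carrier
  obtain ⟨c, hc⟩ := exists_tendsto_of_finite_values (F := {T.z T.a, T.z T.b}) (by simp) hl (B := B)
    (hT.mono fun t ht => (PiLp.norm_apply_le (f t) 2).trans (hB _ ht)) fun c hfr => by
      -- If the height takes the value c frequently, then (0, 0, c) is a limit of points of the
      -- closed surface T. It lies on the axis, which leaves two values for c.
      have h3 : Tendsto (fun t => (!₂[f t 0, f t 1, c] : E3)) l (𝓝 !₂[0, 0, c]) :=
        tendsto_E3 h0 h1 tendsto_const_nhds
      have h4 : ∃ᶠ t in l, (!₂[f t 0, f t 1, c] : E3) ∈ T.carrier := by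
        refine (hfr.and_eventually hT).mono fun t ⟨e, ht⟩ => ?_
        have : (!₂[f t 0, f t 1, c] : E3) = f t := E3.ext' rfl rfl e.symm
        rwa [this]
      exact T.axis_z (T.isClosed_carrier.mem_of_frequently_of_tendsto h4 h3) rfl rfl
  exact ⟨c, tendsto_E3 h0 h1 hc⟩

namespace IsProfile

variable {f f' : ℝ → E3}

theorem integrable_sq_div (h : IsProfile S T f f') :
    IntegrableOn (fun t => f t 0 ^ 2 / S.x t) (Ioo S.a S.b) ∧
      IntegrableOn (fun t => f t 1 ^ 2 / S.x t) (Ioo S.a S.b) := by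
  have hm : ∀ i, AEStronglyMeasurable (fun t => f t i ^ 2 / S.x t) S.mI := fun i =>
    (((aestronglyMeasurable_coord h.aesm_fun i).aemeasurable.pow_const 2).div
      S.continuous_x.measurable.aemeasurable).aestronglyMeasurable
  constructor <;>
  · refine Integrable.mono' h.integrable_perp (hm _) ?_
    filter_upwards [ae_restrict_mem measurableSet_Ioo] with t ht
    have hx := S.x_pos ht
    rw [Real.norm_eq_abs, abs_of_nonneg (by positivity)]
    refine div_le_div_of_nonneg_right ?_ hx.le
    nlinarith [sq_nonneg (f t 0), sq_nonneg (f t 1)]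

/-- If the curve of S starts on the axis, x grows at most linearly, the horizontal components tend
to zero, and the height then converges. Otherwise x is bounded below near the endpoint and the
derivative is integrable up to it. -/
theorem exists_limit_left (h : IsProfile S T f f') :
    ∃ l, Tendsto f (𝓝[>] S.a) (𝓝 l) ∧ (S.x S.a = 0 → l 0 = 0 ∧ l 1 = 0) := by
  rcases (S.nonneg _ (left_mem_Icc.2 S.lt.le)).eq_or_lt with hx | hx
  · obtain ⟨C, hC⟩ := S.exists_x_lipschitz
    have hC' : ∀ t ∈ Ioo S.a S.b, S.x t ≤ C * (t - S.a) := fun t ht => by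
      have := hC _ (left_mem_Icc.2 S.lt.le) t (Ioo_subset_Icc_self ht)
      rw [← hx, sub_zero, abs_of_pos (sub_pos.2 ht.1)] at this
      exact (le_abs_self _).trans this
    have key := fun i h1 => (h.prim_coord i).tendsto_zero_left S.lt (fun t ht => S.x_pos ht) hC'
      (aestronglyMeasurable_coord h.aesm i) h1 (h.integrable_deriv_coord i)
    obtain ⟨c, hc⟩ := exists_tendsto_of_perp_zero (T := T) (exists_connected_nhdsGT S.lt
      (h.prim_coord 2).continuousOn) (by
        filter_upwards [Ioo_mem_nhdsGT S.lt] with t ht using h.mem t ht)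
      (key 0 h.integrable_sq_div.1) (key 1 h.integrable_sq_div.2)
    exact ⟨_, hc, fun _ => ⟨rfl, rfl⟩⟩
  · obtain ⟨c, hac, hcb⟩ := exists_between S.lt
    obtain ⟨e, he, hxe⟩ := S.exists_x_lower_left hx hcb
    have hi : IntervalIntegrable f' volume S.a c := by
      rw [intervalIntegrable_iff_integrableOn_Ioo_of_le hac.le]
      exact integrableOn_of_weight h.aesm h.integrable_deriv measurableSet_Ioo
        (Ioo_subset_Ioo_right hcb.le) he fun t ht => hxe t (Ioo_subset_Icc_self ht)
    exact ⟨_, h.prim.tendsto_left ⟨hac, hcb⟩ hi, fun h0 => absurd h0 hx.ne'⟩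

theorem exists_limit_right (h : IsProfile S T f f') :
    ∃ l, Tendsto f (𝓝[<] S.b) (𝓝 l) ∧ (S.x S.b = 0 → l 0 = 0 ∧ l 1 = 0) := by
  rcases (S.nonneg _ (right_mem_Icc.2 S.lt.le)).eq_or_lt with hx | hx
  · obtain ⟨C, hC⟩ := S.exists_x_lipschitz
    have hC' : ∀ t ∈ Ioo S.a S.b, S.x t ≤ C * (S.b - t) := fun t ht => by
      have := hC _ (right_mem_Icc.2 S.lt.le) t (Ioo_subset_Icc_self ht)
      rw [← hx, sub_zero, abs_sub_comm, abs_of_pos (sub_pos.2 ht.2)] at this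
      exact (le_abs_self _).trans this
    have key := fun i h1 => (h.prim_coord i).tendsto_zero_right S.lt (fun t ht => S.x_pos ht) hC'
      (aestronglyMeasurable_coord h.aesm i) h1 (h.integrable_deriv_coord i)
    obtain ⟨c, hc⟩ := exists_tendsto_of_perp_zero (T := T) (exists_connected_nhdsLT S.lt
      (h.prim_coord 2).continuousOn) (by
        filter_upwards [Ioo_mem_nhdsLT S.lt] with t ht using h.mem t ht)
      (key 0 h.integrable_sq_div.1) (key 1 h.integrable_sq_div.2)
    exact ⟨_, hc, fun _ => ⟨rfl, rfl⟩⟩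
  · obtain ⟨c, hac, hcb⟩ := exists_between S.lt
    obtain ⟨e, he, hxe⟩ := S.exists_x_lower_right hx hac
    have hi : IntervalIntegrable f' volume c S.b := by
      rw [intervalIntegrable_iff_integrableOn_Ioo_of_le hcb.le]
      exact integrableOn_of_weight h.aesm h.integrable_deriv measurableSet_Ioo
        (Ioo_subset_Ioo_left hac.le) he fun t ht => hxe t (Ioo_subset_Icc_self ht)
    exact ⟨_, h.prim.tendsto_right ⟨hac, hcb⟩ hi, fun h0 => absurd h0 hx.ne'⟩

theorem lintegral_deriv_lt_top (h : IsProfile S T f f') :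
    (∫⁻ t in Icc S.a S.b, ENNReal.ofReal (S.x t * ‖f' t‖ ^ 2)) < ⊤ := by
  rw [← Measure.restrict_congr_set (Ioo_ae_eq_Icc (μ := volume) (a := S.a) (b := S.b))]
  have h1 := h.integrable_deriv.2
  rwa [hasFiniteIntegral_iff_ofReal] at h1
  filter_upwards [ae_restrict_mem measurableSet_Ioo] with t ht
  have := S.x_pos ht
  positivity

theorem congr (h : IsProfile S T f f') {F : ℝ → E3} (hF : EqOn F f (Ioo S.a S.b)) :
    IsProfile S T F f' where
  prim := ⟨h.prim.int, fun s hs t ht => by rw [hF hs, hF ht, h.prim.sub s hs t ht]⟩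
  aesm := h.aesm
  mem t ht := by rw [hF ht]; exact h.mem t ht
  loop := h.loop
  fin := by
    rw [lintegral_congr_ae (g := fun t => ENNReal.ofReal (S.profileDensity f f' t))]
    · exact h.fin
    · filter_upwards [ae_restrict_mem measurableSet_Ioo] with t ht
      rw [profileDensity, hF ht, profileDensity]

/-- A profile extends continuously to the closed parameter interval. -/
theorem exists_extension (h : IsProfile S T f f') : ∃ F, EqOn F f (Ioo S.a S.b) ∧
    S.MemH1IMap T F ∧ (∀ t ∈ Icc S.a S.b, S.x t = 0 → F t 0 = 0 ∧ F t 1 = 0) ∧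
      (S.IsLoop → F S.a = F S.b) := by
  obtain ⟨la, hla, hla0⟩ := h.exists_limit_left
  obtain ⟨lb, hlb, hlb0⟩ := h.exists_limit_right
  obtain ⟨F, hF⟩ : ∃ F, F = extendFrom (Ioo S.a S.b) f := ⟨_, rfl⟩
  have hFa : F S.a = la := by
    rw [hF]; exact eq_lim_at_left_extendFrom_Ioo S.lt hla
  have hFb : F S.b = lb := by
    rw [hF]; exact eq_lim_at_right_extendFrom_Ioo S.lt hlb
  have hFc : ContinuousOn F (Icc S.a S.b) := by
    rw [hF]; exact continuousOn_Icc_extendFrom_Ioo h.prim.continuousOn hla hlb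
  have hFe : EqOn F f (Ioo S.a S.b) := fun t ht => by
    rw [hF]; exact extendFrom_extends h.prim.continuousOn t ht
  refine ⟨F, hFe, ⟨⟨hFc, f', ?_, h.lintegral_deriv_lt_top, fun s hs t ht => ?_⟩, fun t ht => ?_⟩,
    fun t ht h0 => ?_, fun hS => ?_⟩
  · rw [← Measure.restrict_congr_set (Ioo_ae_eq_Icc (μ := volume) (a := S.a) (b := S.b))]
    exact h.aesm
  · rw [hFe hs, hFe ht, h.prim.sub s hs t ht]
  · rw [← closure_Ioo S.lt.ne] at ht
    have hmaps : MapsTo F (Ioo S.a S.b) T.carrier := fun t ht => by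
      rw [hFe ht]; exact h.mem t ht
    have := hmaps.closure_of_continuousOn (by rwa [closure_Ioo S.lt.ne])
    rw [T.isClosed_carrier.closure_eq] at this
    exact this ht
  · rcases ht.1.eq_or_lt with e | e
    · rw [← e, hFa]; exact hla0 (e ▸ h0)
    · rcases ht.2.eq_or_lt with e' | e'
      · rw [e', hFb]; exact hlb0 (e' ▸ h0)
      · exact absurd h0 (S.x_pos ⟨e, e'⟩).ne'
  · obtain ⟨ka, kb, hka, hkb, hk⟩ := h.prim.exists_limits (h.integrable_deriv_loop hS)
    rw [h.loop hS, sub_eq_zero] at hk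
    rw [hFa, hFb, tendsto_nhds_unique hla hka, tendsto_nhds_unique hlb hkb, hk]

end IsProfile

theorem MemH1I.exists_deriv {V : Type} [NormedAddCommGroup V]
    [NormedSpace ℝ V] {f : ℝ → V} (hf : S.MemH1I f) : ∃ f' : ℝ → V,
    AEStronglyMeasurable f' S.mI ∧ Integrable (fun t => S.x t * ‖f' t‖ ^ 2) S.mI ∧
      IsPrim S.a S.b f f' := by
  obtain ⟨-, f', hm, hfin, hsub⟩ := hf
  rw [← Measure.restrict_congr_set (Ioo_ae_eq_Icc (μ := volume) (a := S.a) (b := S.b))] at hm hfin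
  have hi : Integrable (fun t => S.x t * ‖f' t‖ ^ 2) S.mI := by
    refine ⟨S.continuous_x.aestronglyMeasurable.mul (hm.norm.pow 2), ?_⟩
    rw [hasFiniteIntegral_iff_ofReal]
    · exact hfin
    · filter_upwards [ae_restrict_mem measurableSet_Ioo] with t ht
      have := S.x_pos ht
      positivity
  exact ⟨f', hm, hi, isPrim_of_weight hm hi hsub⟩

theorem continuous_axialRot_coord (φ : ℝ) (i : Fin 3) : Continuous fun v : E3 => axialRot φ v i := by
  have h : Continuous fun v : E3 => (φ, v) := continuous_const.prodMk continuous_id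
  have h1 := continuous_axialRot.comp h
  exact (continuous_coord i).comp h1

theorem integral_sq_field (σ : ℤ) (v : E3) :
    (∫ θ, axialRot (σ * θ) v 0 ^ 2 ∂circ) + ∫ θ, axialRot (σ * θ) v 1 ^ 2 ∂circ =
      2 * Real.pi * (v 0 ^ 2 + v 1 ^ 2) := by
  have hc : ∀ i : Fin 3, Integrable (fun θ => axialRot (σ * θ) v i ^ 2) circ := fun i => by
    have h : Continuous fun θ : ℝ => ((σ : ℝ) * θ, v) := by fun_prop
    have h1 := continuous_axialRot.comp h
    have h2 := (continuous_coord i).comp h1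
    exact (h2.pow 2).integrableOn_Icc.mono_set Ioc_subset_Icc_self
  rw [← integral_add (hc 0) (hc 1)]
  simp only [axialRot_perp_sq]
  simp [two_pi_pos.le]

theorem MemH1IMap.aesm {f : ℝ → E3} (hf : S.MemH1IMap T f) : AEStronglyMeasurable f S.mI :=
  (hf.1.1.mono Ioo_subset_Icc_self).aestronglyMeasurable measurableSet_Ioo

instance circ_neBot : (ae circ).NeBot := by
  rw [ae_neBot]
  intro h0
  have := congrArg (fun μ => μ univ) h0
  simp [Real.pi_pos.not_ge] at this

/-- The profile of a weakly differentiable field on a torus closes up. -/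
theorem IsField.loop {f f' : ℝ → E3} {σ : ℤ} {m : E3 → E3} (hm : S.IsField σ f m)
    (hfp : IsPrim S.a S.b f f') (hfi' : Integrable f' S.mI) (hS : S.IsLoop) {P Q : ℝ × ℝ → E3}
    (hsc : ∀ i, ScalarWG S (fun r => m (S.param r.1 r.2) i) (fun r => P r i) (fun r => Q r i)) :
    ∫ t, f' t ∂S.mI = 0 := by
  -- One good meridian suffices: there the rotated profile is absolutely continuous with derivative
  -- of integral zero, so the rotated endpoint limits agree, and the rotation is invertible.
  obtain ⟨φ, hφ1, hφ2, hφ3⟩ := ((ae_all_iff.2 fun i => (hsc i).ae_slice_isPrim).and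
    ((ae_all_iff.2 fun i => (hsc i).ae_slice_integral_loop hS).and
      (ae_all_iff.2 fun i => ((hsc i).integrable_right_loop hS).prod_right_ae))).exists
  obtain ⟨la, lb, hla, hlb, hl⟩ := hfp.exists_limits hfi'
  rw [← hl, sub_eq_zero]
  have key : ∀ i, axialRot (σ * φ) lb i = axialRot (σ * φ) la i := by
    intro i
    obtain ⟨k, hk, hke⟩ := hφ1 i
    obtain ⟨ka, kb, hka, hkb, hkl⟩ := hk.exists_limits (hφ3 i)
    rw [hφ2 i, sub_eq_zero] at hkl
    have hc := continuous_axialRot_coord (σ * φ) i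
    have hco : ContinuousOn (fun t => axialRot (σ * φ) (f t) i) (Ioo S.a S.b) :=
      hc.comp_continuousOn hfp.continuousOn
    have heq : EqOn (fun t => axialRot (σ * φ) (f t) i) k (Ioo S.a S.b) := by
      refine Measure.eqOn_open_of_ae_eq (μ := volume) ?_ isOpen_Ioo hco hk.continuousOn
      filter_upwards [hke, ae_restrict_mem measurableSet_Ioo] with t h1 h2
      rw [← h1, hm φ t h2]
    have e1 : ka = axialRot (σ * φ) la i := tendsto_nhds_unique hka
      (((hc.tendsto la).comp hla).congr' (by
        filter_upwards [Ioo_mem_nhdsGT S.lt] with t ht using heq ht))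
    have e2 : kb = axialRot (σ * φ) lb i := tendsto_nhds_unique hkb
      (((hc.tendsto lb).comp hlb).congr' (by
        filter_upwards [Ioo_mem_nhdsLT S.lt] with t ht using heq ht))
    rw [← e1, ← e2, hkl]
  have h3 : axialRot (σ * φ) lb = axialRot (σ * φ) la := by ext i; exact key i
  have h4 := congrArg (axialRot (-(σ * φ))) h3
  rwa [axialRot_neg_axialRot, axialRot_neg_axialRot] at h4

theorem integral_field_zero {f : ℝ → E3} {σ : ℤ} (hσ : σ = 1 ∨ σ = -1) {m : E3 → E3}
    (hm : S.IsField σ f m) {t : ℝ} (ht : t ∈ Ioo S.a S.b) :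
    ∫ φ, m (S.param φ t) 0 ∂circ = 0 := by
  have e0 : ∀ θ, m (S.param θ t) 0 = cs σ 0 θ * f t 0 + cs σ 1 θ * f t 1 := fun θ => by
    rw [hm θ t ht, axialRot_zero_apply, cs_zero, cs_one]; ring
  simp only [e0]
  rw [integral_add ((integrable_cs_circ _ _).mul_const _)
    ((integrable_cs_circ _ _).mul_const _)]
  simp only [integral_mul_const, integral_trig_sign hσ]; ring

theorem integral_field_one {f : ℝ → E3} {σ : ℤ} (hσ : σ = 1 ∨ σ = -1) {m : E3 → E3}
    (hm : S.IsField σ f m) {t : ℝ} (ht : t ∈ Ioo S.a S.b) :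
    ∫ φ, m (S.param φ t) 1 ∂circ = 0 := by
  have e1 : ∀ θ, m (S.param θ t) 1 = cs σ (-1) θ * f t 0 + cs σ 0 θ * f t 1 := fun θ => by
    rw [hm θ t ht, axialRot_one_apply, cs_zero, cs_neg_one]
  simp only [e1]
  rw [integral_add ((integrable_cs_circ _ _).mul_const _)
    ((integrable_cs_circ _ _).mul_const _)]
  simp only [integral_mul_const, integral_trig_sign hσ]; ring

theorem integral_perp_mul_le {P Q : ℝ × ℝ → E3} {t : ℝ} (ht : t ∈ Ioo S.a S.b)
    (h0 : Integrable (fun φ => P (φ, t) 0 ^ 2) circ)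
    (h1 : Integrable (fun φ => P (φ, t) 1 ^ 2) circ)
    (hG : Integrable (fun φ => (‖P (φ, t)‖ ^ 2 / S.x t ^ 2 +
      ‖Q (φ, t)‖ ^ 2 / S.speed t ^ 2) * S.areaDensity t) circ) :
    ((∫ φ, P (φ, t) 0 ^ 2 ∂circ) + ∫ φ, P (φ, t) 1 ^ 2 ∂circ) * (S.areaDensity t / S.x t ^ 2) ≤
      ∫ φ, ((‖P (φ, t)‖ ^ 2 / S.x t ^ 2 +
        ‖Q (φ, t)‖ ^ 2 / S.speed t ^ 2) * S.areaDensity t) ∂circ := by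
  rw [← integral_add h0 h1, ← integral_mul_const]
  refine integral_mono ((h0.add h1).mul_const _) hG fun φ => ?_
  have e : (P (φ, t) 0 ^ 2 + P (φ, t) 1 ^ 2) * (S.areaDensity t / S.x t ^ 2) =
    (P (φ, t) 0 ^ 2 + P (φ, t) 1 ^ 2) / S.x t ^ 2 * S.areaDensity t := by ring
  simp only [e]
  refine mul_le_mul_of_nonneg_right ?_ (S.areaDensity_pos ht).le
  have h5 : P (φ, t) 0 ^ 2 + P (φ, t) 1 ^ 2 ≤ ‖P (φ, t)‖ ^ 2 := by
    rw [E3.norm_sq]; nlinarith [sq_nonneg (P (φ, t) 2)]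
  have h6 : 0 ≤ ‖Q (φ, t)‖ ^ 2 / S.speed t ^ 2 := by positivity
  have h7 := div_le_div_of_nonneg_right h5 (sq_nonneg (S.x t))
  linarith

/-- A profile in H¹(I, T) need not have integrable |f_⊥|²/x at the axis. For a field of finite
Dirichlet energy it does, because its horizontal means vanish and Wirtinger's inequality bounds
|f_⊥|² by the angular derivative. -/
theorem IsField.integrable_density {f f' : ℝ → E3} {σ : ℤ} (hσ : σ = 1 ∨ σ = -1) {m : E3 → E3}
    (hm : S.IsField σ f m) (haf : AEStronglyMeasurable f S.mI)
    (hfm : AEStronglyMeasurable f' S.mI) (hfi : Integrable (fun t => S.x t * ‖f' t‖ ^ 2) S.mI)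
    {P Q : ℝ × ℝ → E3}
    (hsc : ∀ i, ScalarWG S (fun r => m (S.param r.1 r.2) i) (fun r => P r i) (fun r => Q r i))
    (hG : Integrable (fun r : ℝ × ℝ => (‖P r‖ ^ 2 / S.x r.2 ^ 2 + ‖Q r‖ ^ 2 / S.speed r.2 ^ 2) *
      S.areaDensity r.2) S.mC) :
    Integrable (S.profileDensity f f') S.mI := by
  have hGi : Integrable (fun t => (2 * Real.pi)⁻¹ * ∫ φ, ((‖P (φ, t)‖ ^ 2 / S.x t ^ 2 +
      ‖Q (φ, t)‖ ^ 2 / S.speed t ^ 2) * S.areaDensity t) ∂circ) S.mI :=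
    hG.integral_prod_right.const_mul _
  obtain ⟨c, C, hc, hC, hb⟩ := S.exists_weight_bounds
  have hdom := hGi.add (hfi.const_mul c⁻¹)
  have hdm : AEMeasurable (S.profileDensity f f') S.mI := by
    have h0 := (aestronglyMeasurable_coord haf 0).aemeasurable
    have h1 := (aestronglyMeasurable_coord haf 1).aemeasurable
    exact ((((h0.pow_const 2).add (h1.pow_const 2)).div
      (S.continuous_x.measurable.pow_const 2).aemeasurable).add
      ((hfm.norm.aemeasurable.pow_const 2).div
        (S.continuous_speed.measurable.pow_const 2).aemeasurable)).mul
        S.continuous_areaDensity.measurable.aemeasurable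
  refine Integrable.mono' hdom hdm.aestronglyMeasurable ?_
  filter_upwards [ae_restrict_mem measurableSet_Ioo, (hsc 0).ae_slice, (hsc 1).ae_slice,
    hG.prod_left_ae] with t ht h0 h1 hGt
  have hx := S.x_pos ht
  have hs := hc.trans_le (hb t (Ioo_subset_Icc_self ht)).1
  have ha := S.areaDensity_pos ht
  have w0 := wirtinger h0.1 h0.2.1 h0.2.2
  have w1 := wirtinger h1.1 h1.2.1 h1.2.2
  have hsq := integral_sq_field σ (f t)
  rw [integral_field_zero hσ hm ht] at w0
  rw [integral_field_one hσ hm ht] at w1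
  simp only [hm _ t ht, zero_pow two_ne_zero, zero_div, add_zero] at w0 w1
  have hmono := integral_perp_mul_le ht h0.2.1.integrable_sq h1.2.1.integrable_sq hGt
  rw [Real.norm_eq_abs, abs_of_nonneg (IsProfile.profileDensity_nonneg ht)]
  have e1 : S.profileDensity f f' t = (f t 0 ^ 2 + f t 1 ^ 2) * (S.areaDensity t / S.x t ^ 2) +
      S.x t * ‖f' t‖ ^ 2 / S.speed t := by
    rw [profileDensity, areaDensity]; field_simp
  rw [e1]
  refine add_le_add ?_ ?_ <;> beta_reduce
  · rw [inv_mul_eq_div, le_div_iff₀ two_pi_pos]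
    have h8 : 0 ≤ S.areaDensity t / S.x t ^ 2 := by positivity
    refine le_trans ?_ hmono
    rw [mul_right_comm, mul_comm _ (2 * Real.pi), ← hsq]
    exact mul_le_mul_of_nonneg_right (by linarith) h8
  · rw [inv_mul_eq_div]
    exact div_le_div_of_nonneg_left (by positivity) hc (hb t (Ioo_subset_Icc_self ht)).1

/-- The profile of a field of finite Dirichlet energy is a profile in the sense of `IsProfile`. -/
theorem MemH1IMap.exists_isProfile {f : ℝ → E3} (hf : S.MemH1IMap T f) {σ : ℤ}
    (hσ : σ = 1 ∨ σ = -1) {m : E3 → E3} (hm : S.IsField σ f m) (hd : S.dirichlet m < ⊤) :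
    ∃ f', IsProfile S T f f' := by
  obtain ⟨f', hfm, hfi, hfp⟩ := hf.1.exists_deriv
  obtain ⟨P, Q, hPQ⟩ := exists_isWeakGradient_of_dirichlet_lt_top hd
  obtain ⟨B, hB0, hB⟩ := T.exists_bound_carrier
  have hsc := fun i => hPQ.scalar (hm.aesm hf.aesm)
    (hm.bound fun t ht => hB _ (hf.2 (Ioo_subset_Icc_self ht))) i
  have hP : AEStronglyMeasurable P S.mC := by rw [← restrict_chart]; exact hPQ.aesm_left
  have hQ : AEStronglyMeasurable Q S.mC := by rw [← restrict_chart]; exact hPQ.aesm_right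
  have hG := integrable_gradDensity hP hQ hPQ.finite
  refine ⟨f', hfp, hfm, fun t ht => hf.2 (Ioo_subset_Icc_self ht), fun hS => ?_, ?_⟩
  · obtain ⟨e, he, hx⟩ := hS.exists_x_lower
    exact hm.loop hfp (integrableOn_of_weight hfm hfi measurableSet_Ioo Subset.rfl he
      fun t ht => hx t (Ioo_subset_Icc_self ht)) hS hsc
  · have := (hm.integrable_density hσ hf.aesm hfm hfi hsc hG).2
    rwa [hasFiniteIntegral_iff_ofReal] at this
    filter_upwards [ae_restrict_mem measurableSet_Ioo] with t ht
    exact IsProfile.profileDensity_nonneg ht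

end RevSurface
end AxialMaps

/-! ### Wirtinger's inequality with a penalty on the mean -/

namespace AxialMaps

theorem isPrim_of_coord {a b : ℝ} {f f' : ℝ → E3}
    (h : ∀ i, IsPrim a b (fun t => f t i) (fun t => f' t i)) : IsPrim a b f f' where
  int c hc d hd := by
    rw [intervalIntegrable_iff]
    exact RevSurface.integrable_of_coord fun i => intervalIntegrable_iff.1 ((h i).int c hc d hd)
  sub s hs t ht := by
    have hi : IntervalIntegrable f' volume s t := by
      rw [intervalIntegrable_iff]
      exact RevSurface.integrable_of_coord fun i => intervalIntegrable_iff.1 ((h i).int s hs t ht)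
    ext i
    have h1 := (EuclideanSpace.proj (𝕜 := ℝ) i : E3 →L[ℝ] ℝ).intervalIntegral_comp_comm hi
    have h2 : (∫ r in s..t, f' r) i = ∫ r in s..t, f' r i := h1.symm
    rw [h2, PiLp.sub_apply, (h i).sub s hs t ht]

/-- The rotation about the axis as a continuous linear map. -/
noncomputable def axialRotCLM (φ : ℝ) : E3 →L[ℝ] E3 :=
  LinearMap.toContinuousLinearMap
    { toFun := axialRot φ
      map_add' := fun v w => by apply E3.ext' <;> simp <;> ring
      map_smul' := fun c v => by apply E3.ext' <;> simp <;> ring }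

theorem IsPrim.axialRot {a b : ℝ} {f f' : ℝ → E3} (h : IsPrim a b f f') (φ : ℝ) :
    IsPrim a b (fun t => axialRot φ (f t)) (fun t => axialRot φ (f' t)) :=
  h.clm (axialRotCLM φ)

/-- The exceptional set is open and of measure zero, hence empty. -/
theorem forall_mem_of_ae_mem {V : Type*} [TopologicalSpace V] {a b : ℝ} {f : ℝ → V}
    (hf : ContinuousOn f (Ioo a b)) {C : Set V} (hC : IsClosed C)
    (h : ∀ᵐ t ∂volume.restrict (Ioo a b), f t ∈ C) : ∀ t ∈ Ioo a b, f t ∈ C := by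
  have ho := hf.isOpen_inter_preimage isOpen_Ioo hC.isOpen_compl
  rw [ae_restrict_iff' measurableSet_Ioo] at h
  have h0 : volume (Ioo a b ∩ f ⁻¹' Cᶜ) = 0 := by
    refine measure_mono_null (fun t ht => ?_) h
    simp only [mem_compl_iff, mem_ofPred_eq]
    exact fun hcon => ht.2 (hcon ht.1)
  intro t ht
  by_contra hcon
  have : t ∈ Ioo a b ∩ f ⁻¹' Cᶜ := ⟨ht, hcon⟩
  rw [(ho.measure_eq_zero_iff _).1 h0] at this
  exact this

/-- Wirtinger's inequality for the first two components of a map on the circle, with a penalty on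
the mean. -/
theorem wirtinger_perp {M P : ℝ → E3} (hM : ∀ i, MemLp (fun φ => M φ i) 2 circ)
    (hP : ∀ i, MemLp (fun φ => P φ i) 2 circ)
    (hw : ∀ i, IsWeakDerivCirc (fun φ => M φ i) fun φ => P φ i) {A x : ℝ} (hA : 0 < A)
    (hx : 0 < x) {w : ℝ≥0∞} (hxw : ENNReal.ofReal (2 * Real.pi / x ^ 2) < w) :
    ENNReal.ofReal (((∫ φ, M φ 0 ^ 2 ∂circ) + ∫ φ, M φ 1 ^ 2 ∂circ) * (A / x ^ 2)) ≤
      ENNReal.ofReal ((∫ φ, ‖P φ‖ ^ 2 ∂circ) * (A / x ^ 2)) +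
        ENNReal.ofReal (((2 * Real.pi)⁻¹) ^ 2 *
          ((∫ θ, M θ 0 ∂circ) ^ 2 + (∫ θ, M θ 1 ∂circ) ^ 2)) * (w * ENNReal.ofReal A) ∧
    (ENNReal.ofReal ((∫ φ, ‖P φ‖ ^ 2 ∂circ) * (A / x ^ 2)) +
        ENNReal.ofReal (((2 * Real.pi)⁻¹) ^ 2 *
          ((∫ θ, M θ 0 ∂circ) ^ 2 + (∫ θ, M θ 1 ∂circ) ^ 2)) * (w * ENNReal.ofReal A) ≤
      ENNReal.ofReal (((∫ φ, M φ 0 ^ 2 ∂circ) + ∫ φ, M φ 1 ^ 2 ∂circ) * (A / x ^ 2)) →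
      (∫ θ, M θ 0 ∂circ = 0 ∧ ∫ φ, P φ 0 ^ 2 ∂circ ≤ ∫ φ, M φ 0 ^ 2 ∂circ) ∧
      (∫ θ, M θ 1 ∂circ = 0 ∧ ∫ φ, P φ 1 ^ 2 ∂circ ≤ ∫ φ, M φ 1 ^ 2 ∂circ) ∧
        (fun φ => P φ 2) =ᵐ[circ] 0) := by
  have hpi := two_pi_pos
  have w0 := wirtinger (hM 0) (hP 0) (hw 0)
  have w1 := wirtinger (hM 1) (hP 1) (hw 1)
  have hsum : ∫ φ, ‖P φ‖ ^ 2 ∂circ = (∫ φ, P φ 0 ^ 2 ∂circ) + (∫ φ, P φ 1 ^ 2 ∂circ) +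
      ∫ φ, P φ 2 ^ 2 ∂circ := by
    simp only [E3.norm_sq]
    have h01 : Integrable (fun φ => P φ 0 ^ 2 + P φ 1 ^ 2) circ :=
      (hP 0).integrable_sq.add (hP 1).integrable_sq
    rw [integral_add h01 (hP 2).integrable_sq, integral_add (hP 0).integrable_sq (hP 1).integrable_sq]
  have hP2 : 0 ≤ ∫ φ, P φ 2 ^ 2 ∂circ := integral_nonneg fun _ => sq_nonneg _
  have hP0 : 0 ≤ ∫ φ, P φ 0 ^ 2 ∂circ := integral_nonneg fun _ => sq_nonneg _
  have hP1 : 0 ≤ ∫ φ, P φ 1 ^ 2 ∂circ := integral_nonneg fun _ => sq_nonneg _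
  generalize hc0 : ∫ θ, M θ 0 ∂circ = c0 at *
  generalize hc1 : ∫ θ, M θ 1 ∂circ = c1 at *
  have hk : 0 < A / x ^ 2 := by positivity
  have hc : 0 ≤ (2 * Real.pi)⁻¹ ^ 2 * (c0 ^ 2 + c1 ^ 2) := by positivity
  -- The weight 2π/x² is the threshold at which the penalty equals the mean term in Wirtinger's
  -- inequality.
  have hcw : ENNReal.ofReal ((2 * Real.pi)⁻¹ ^ 2 * (c0 ^ 2 + c1 ^ 2)) *
      (ENNReal.ofReal (2 * Real.pi / x ^ 2) * ENNReal.ofReal A) =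
      ENNReal.ofReal ((c0 ^ 2 / (2 * Real.pi) + c1 ^ 2 / (2 * Real.pi)) * (A / x ^ 2)) := by
    rw [← ENNReal.ofReal_mul (by positivity), ← ENNReal.ofReal_mul hc]
    congr 1
    field_simp
  have hle : ENNReal.ofReal (((∫ φ, M φ 0 ^ 2 ∂circ) + ∫ φ, M φ 1 ^ 2 ∂circ) * (A / x ^ 2)) ≤
      ENNReal.ofReal ((∫ φ, ‖P φ‖ ^ 2 ∂circ) * (A / x ^ 2)) +
      ENNReal.ofReal ((2 * Real.pi)⁻¹ ^ 2 * (c0 ^ 2 + c1 ^ 2)) *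
      (ENNReal.ofReal (2 * Real.pi / x ^ 2) * ENNReal.ofReal A) := by
    rw [hcw, ← ENNReal.ofReal_add (by rw [hsum]; positivity) (by positivity), ← add_mul]
    refine ENNReal.ofReal_le_ofReal (mul_le_mul_of_nonneg_right ?_ hk.le)
    rw [hsum]; linarith
  refine ⟨hle.trans (by gcongr), fun heq => ?_⟩
  have h1 := heq.trans hle
  rw [ENNReal.add_le_add_iff_left ENNReal.ofReal_ne_top] at h1
  -- In the case of equality a nonzero mean could be cancelled, which would bound w by the
  -- threshold, against the strict inequality `hxw`.
  have hcc : (2 * Real.pi)⁻¹ ^ 2 * (c0 ^ 2 + c1 ^ 2) = 0 := by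
    by_contra hne
    have hpos := lt_of_le_of_ne hc (Ne.symm hne)
    rw [ENNReal.mul_le_mul_iff_right (ENNReal.ofReal_pos.2 hpos).ne' ENNReal.ofReal_ne_top,
      ENNReal.mul_le_mul_iff_left (ENNReal.ofReal_pos.2 hA).ne' ENNReal.ofReal_ne_top] at h1
    exact absurd hxw (not_lt.2 h1)
  have hs : c0 ^ 2 + c1 ^ 2 = 0 := by
    have : (2 * Real.pi)⁻¹ ^ 2 ≠ 0 := by positivity
    exact (mul_eq_zero.1 hcc).resolve_left this
  have hz0 : c0 = 0 := by nlinarith [sq_nonneg c0, sq_nonneg c1]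
  have hz1 : c1 = 0 := by nlinarith [sq_nonneg c0, sq_nonneg c1]
  subst hz0 hz1
  simp only [zero_pow two_ne_zero, zero_div, add_zero, mul_zero, ENNReal.ofReal_zero, zero_mul]
    at heq w0 w1
  have hm0 : 0 ≤ ∫ φ, M φ 0 ^ 2 ∂circ := integral_nonneg fun _ => sq_nonneg _
  have hm1 : 0 ≤ ∫ φ, M φ 1 ^ 2 ∂circ := integral_nonneg fun _ => sq_nonneg _
  -- With vanishing means, the inequality for the sum and Wirtinger's inequality for each component
  -- leave no slack anywhere, in particular none for the vertical derivative.
  rw [ENNReal.ofReal_le_ofReal_iff (by positivity), mul_le_mul_iff_left₀ hk, hsum] at heq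
  refine ⟨⟨rfl, by linarith⟩, ⟨rfl, by linarith⟩, ?_⟩
  have hz : ∫ φ, P φ 2 ^ 2 ∂circ = 0 := by linarith
  rw [integral_eq_zero_iff_of_nonneg (fun _ => sq_nonneg _) (hP 2).integrable_sq] at hz
  filter_upwards [hz] with φ h
  exact pow_eq_zero_iff two_ne_zero |>.1 h

end AxialMaps

/-! ### Energy densities and Wirtinger's inequality on the circles of latitude -/

namespace AxialMaps
namespace RevSurface

variable {S T : RevSurface}

/-- A map with values in `T`, together with its weak derivatives. -/
structure IsWeakMap (S T : RevSurface) (m : E3 → E3) (P Q : ℝ × ℝ → E3) : Prop where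
  aesm : AEStronglyMeasurable (fun r : ℝ × ℝ => m (S.param r.1 r.2)) S.mC
  mem : ∀ᵐ r ∂S.mC, m (S.param r.1 r.2) ∈ T.carrier
  grad : S.IsWeakGradient m P Q

theorem MemH1Map.exists_isWeakMap {m : E3 → E3} (h : S.MemH1Map T m) :
    ∃ P Q, IsWeakMap S T m P Q := by
  obtain ⟨⟨h1, P, Q, h2⟩, h3⟩ := h
  exact ⟨P, Q, (aestronglyMeasurable_area_iff S).1 h1.1, S.ae_area_iff.1 h3, h2⟩

/-- The angular part of the Dirichlet density. -/
noncomputable def densLeft (S : RevSurface) (P : ℝ × ℝ → E3) (r : ℝ × ℝ) : ℝ≥0∞ :=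
  ENNReal.ofReal (‖P r‖ ^ 2 / S.x r.2 ^ 2 * S.areaDensity r.2)

/-- The meridional part of the Dirichlet density. -/
noncomputable def densRight (S : RevSurface) (Q : ℝ × ℝ → E3) (r : ℝ × ℝ) : ℝ≥0∞ :=
  ENNReal.ofReal (‖Q r‖ ^ 2 / S.speed r.2 ^ 2 * S.areaDensity r.2)

/-- The density of the anisotropy energy. -/
noncomputable def densAniso (S : RevSurface) (g : ℝ → ℝ≥0) (a m : E3 → E3) (r : ℝ × ℝ) : ℝ≥0∞ :=
  g (inner ℝ (m (S.param r.1 r.2)) (a (S.param r.1 r.2))) * ENNReal.ofReal (S.areaDensity r.2)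

/-- The density of the penalty on the circle means. -/
noncomputable def densMean (S : RevSurface) (ω : E3 → ℝ≥0) (m : E3 → E3) (r : ℝ × ℝ) : ℝ≥0∞ :=
  ENNReal.ofReal (‖crossE3 (circleMean m (S.param r.1 r.2))‖ ^ 2) *
    (ω (S.param r.1 r.2) : ℝ≥0∞) ^ 2 * ENNReal.ofReal (S.areaDensity r.2)

/-- The angular part of the Dirichlet density after symmetrization. -/
noncomputable def densPerp (S : RevSurface) (m : E3 → E3) (r : ℝ × ℝ) : ℝ≥0∞ :=
  ENNReal.ofReal ((m (S.param r.1 r.2) 0 ^ 2 + m (S.param r.1 r.2) 1 ^ 2) *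
    (S.areaDensity r.2 / S.x r.2 ^ 2))

theorem continuous_param_left (S : RevSurface) (t : ℝ) : Continuous fun φ : ℝ => S.param φ t := by
  have h : Continuous fun φ : ℝ => (φ, t) := continuous_id.prodMk continuous_const
  have h1 := S.continuous_param.comp h
  exact h1

theorem lintegral_densPerp {m : E3 → E3} {t : ℝ}
    (h0 : MemLp (fun φ => m (S.param φ t) 0) 2 circ)
    (h1 : MemLp (fun φ => m (S.param φ t) 1) 2 circ) :
    ∫⁻ φ, S.densPerp m (φ, t) ∂circ = ENNReal.ofReal (((∫ φ, m (S.param φ t) 0 ^ 2 ∂circ) +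
      ∫ φ, m (S.param φ t) 1 ^ 2 ∂circ) * (S.areaDensity t / S.x t ^ 2)) := by
  have hi : Integrable (fun φ => m (S.param φ t) 0 ^ 2 + m (S.param φ t) 1 ^ 2) circ :=
    h0.integrable_sq.add h1.integrable_sq
  rw [← integral_add h0.integrable_sq h1.integrable_sq, ENNReal.ofReal_mul (by positivity),
    ofReal_integral_eq_lintegral_ofReal hi (Eventually.of_forall fun φ => by positivity),
    ← lintegral_mul_const' _ _ ENNReal.ofReal_ne_top]
  refine lintegral_congr fun φ => ?_
  rw [densPerp, ENNReal.ofReal_mul (by positivity)]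

theorem lintegral_densLeft {P : ℝ × ℝ → E3} {t : ℝ}
    (hP : ∀ i, MemLp (fun φ => P (φ, t) i) 2 circ) :
    ∫⁻ φ, S.densLeft P (φ, t) ∂circ =
      ENNReal.ofReal ((∫ φ, ‖P (φ, t)‖ ^ 2 ∂circ) * (S.areaDensity t / S.x t ^ 2)) := by
  have hi : Integrable (fun φ => ‖P (φ, t)‖ ^ 2) circ := by
    simp only [E3.norm_sq]
    exact ((hP 0).integrable_sq.add (hP 1).integrable_sq).add (hP 2).integrable_sq
  rw [ENNReal.ofReal_mul (by positivity),
    ofReal_integral_eq_lintegral_ofReal hi (Eventually.of_forall fun φ => by positivity),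
    ← lintegral_mul_const' _ _ ENNReal.ofReal_ne_top]
  refine lintegral_congr fun φ => ?_
  rw [densLeft, ← ENNReal.ofReal_mul (by positivity)]
  congr 1
  ring

theorem lintegral_densMean {ω : E3 → ℝ≥0} (hω : Measurable ω) {m : E3 → E3} (t : ℝ) {c : ℝ}
    (hc : ∀ φ, ‖crossE3 (circleMean m (S.param φ t))‖ ^ 2 = c) :
    ∫⁻ φ, S.densMean ω m (φ, t) ∂circ = ENNReal.ofReal c *
      ((∫⁻ φ, (ω (S.param φ t) : ℝ≥0∞) ^ 2 ∂circ) * ENNReal.ofReal (S.areaDensity t)) := by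
  simp only [densMean, hc]
  have hm : Measurable fun φ : ℝ => (ω (S.param φ t) : ℝ≥0∞) ^ 2 :=
    (hω.comp (S.continuous_param_left t).measurable).coe_nnreal_ennreal.pow_const 2
  rw [lintegral_mul_const _ (hm.const_mul _), lintegral_const_mul _ hm, mul_assoc]

namespace IsWeakMap

variable {m : E3 → E3} {P Q : ℝ × ℝ → E3}

theorem aesm_left (h : IsWeakMap S T m P Q) : AEStronglyMeasurable P S.mC := by
  rw [← restrict_chart]; exact h.grad.aesm_left

theorem aesm_right (h : IsWeakMap S T m P Q) : AEStronglyMeasurable Q S.mC := by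
  rw [← restrict_chart]; exact h.grad.aesm_right

theorem exists_bound (h : IsWeakMap S T m P Q) : ∃ B, ∀ᵐ r ∂S.mC, ‖m (S.param r.1 r.2)‖ ≤ B := by
  obtain ⟨B, -, hB⟩ := T.exists_bound_carrier
  exact ⟨B, h.mem.mono fun r hr => hB _ hr⟩

theorem scalar (h : IsWeakMap S T m P Q) (i : Fin 3) :
    S.ScalarWG (fun r => m (S.param r.1 r.2) i) (fun r => P r i) (fun r => Q r i) := by
  obtain ⟨B, hB⟩ := h.exists_bound
  exact h.grad.scalar h.aesm hB i

theorem aem_densLeft (h : IsWeakMap S T m P Q) : AEMeasurable (S.densLeft P) S.mC :=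
  (((h.aesm_left.norm.aemeasurable.pow_const 2).div
    ((S.continuous_x.measurable.comp measurable_snd).pow_const 2).aemeasurable).mul
    (S.continuous_areaDensity.measurable.comp measurable_snd).aemeasurable).ennreal_ofReal

theorem aem_densRight (h : IsWeakMap S T m P Q) : AEMeasurable (S.densRight Q) S.mC :=
  (((h.aesm_right.norm.aemeasurable.pow_const 2).div
    ((S.continuous_speed.measurable.comp measurable_snd).pow_const 2).aemeasurable).mul
    (S.continuous_areaDensity.measurable.comp measurable_snd).aemeasurable).ennreal_ofReal

theorem aem_densPerp (h : IsWeakMap S T m P Q) : AEMeasurable (S.densPerp m) S.mC :=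
  ((((aestronglyMeasurable_coord h.aesm 0).aemeasurable.pow_const 2).add
    ((aestronglyMeasurable_coord h.aesm 1).aemeasurable.pow_const 2)).mul
    ((S.continuous_areaDensity.measurable.comp measurable_snd).div
      ((S.continuous_x.measurable.comp measurable_snd).pow_const 2)).aemeasurable).ennreal_ofReal

theorem aem_densAniso (h : IsWeakMap S T m P Q) {g : ℝ → ℝ≥0} (hg : ∃ K : ℝ≥0, LipschitzWith K g)
    {a : E3 → E3} (ha : ∃ K : ℝ≥0, LipschitzOnWith K a S.carrier) :
    AEMeasurable (S.densAniso g a m) S.mC := by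
  obtain ⟨K, hK⟩ := hg
  have h1 : AEStronglyMeasurable (fun r : ℝ × ℝ =>
      (inner ℝ (m (S.param r.1 r.2)) (a (S.param r.1 r.2)) : ℝ)) S.mC :=
    h.aesm.inner (aesm_comp_param ha)
  exact (hK.continuous.measurable.comp_aemeasurable h1.aemeasurable).coe_nnreal_ennreal.mul
    (ENNReal.measurable_ofReal.comp
      (S.continuous_areaDensity.measurable.comp measurable_snd)).aemeasurable

theorem ae_integrable (h : IsWeakMap S T m P Q) :
    ∀ᵐ t ∂S.mI, Integrable (fun θ => m (S.param θ t)) circ := by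
  filter_upwards [ae_all_iff.2 fun i => (h.scalar i).ae_slice] with t ht
  exact integrable_of_coord fun i => MemLp.integrable_circ (ht i).1

theorem ae_norm_sq_mean (h : IsWeakMap S T m P Q) : ∀ᵐ t ∂S.mI, ∀ φ,
    ‖crossE3 (circleMean m (S.param φ t))‖ ^ 2 = ((2 * Real.pi)⁻¹) ^ 2 *
      ((∫ θ, m (S.param θ t) 0 ∂circ) ^ 2 + (∫ θ, m (S.param θ t) 1 ∂circ) ^ 2) := by
  filter_upwards [h.ae_integrable] with t ht φ
  exact norm_sq_crossE3_circleMean ht φ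

theorem aem_mean (h : IsWeakMap S T m P Q) (i : Fin 3) :
    AEMeasurable (fun t => (∫ θ, m (S.param θ t) i ∂circ) ^ 2) S.mI :=
  ((aestronglyMeasurable_coord h.aesm i).prod_swap.integral_prod_right').aemeasurable.pow_const 2

theorem aem_densMean (h : IsWeakMap S T m P Q) {ω : E3 → ℝ≥0} (hω : Measurable ω) :
    AEMeasurable (S.densMean ω m) S.mC := by
  have h1 : AEMeasurable (fun r : ℝ × ℝ => ‖crossE3 (circleMean m (S.param r.1 r.2))‖ ^ 2) S.mC := by
    -- The circle mean is formed pointwise from a given representative, but for almost every t it is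
    -- a function of t given by two parameter integrals, which is measurable.
    have h2 := ((h.aem_mean 0).add (h.aem_mean 1)).const_mul (((2 * Real.pi)⁻¹) ^ 2)
    refine (h2.comp_snd (μ := circ)).congr ?_
    have h3 : ∀ᵐ r ∂S.mC, ∀ φ, ‖crossE3 (circleMean m (S.param φ r.2))‖ ^ 2 =
        ((2 * Real.pi)⁻¹) ^ 2 * ((∫ θ, m (S.param θ r.2) 0 ∂circ) ^ 2 +
          (∫ θ, m (S.param θ r.2) 1 ∂circ) ^ 2) :=
      Measure.quasiMeasurePreserving_snd.ae h.ae_norm_sq_mean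
    filter_upwards [h3] with r hr
    exact (hr r.1).symm
  have h4 : Measurable fun r : ℝ × ℝ => (ω (S.param r.1 r.2) : ℝ≥0∞) ^ 2 :=
    (hω.comp S.continuous_param.measurable).coe_nnreal_ennreal.pow_const 2
  exact (h1.ennreal_ofReal.mul h4.aemeasurable).mul (ENNReal.measurable_ofReal.comp
      (S.continuous_areaDensity.measurable.comp measurable_snd)).aemeasurable

theorem energy_eq (h : IsWeakMap S T m P Q) (ω : E3 → ℝ≥0) (g : ℝ → ℝ≥0) (a : E3 → E3) :
    S.energy ω g a m = ∫⁻ r, S.densLeft P r ∂S.mC + ∫⁻ r, S.densRight Q r ∂S.mC +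
      ∫⁻ r, S.densAniso g a m r ∂S.mC + ∫⁻ r, S.densMean ω m r ∂S.mC := by
  obtain ⟨B, hB⟩ := h.exists_bound
  rw [energy, dirichlet_eq h.grad h.aesm hB, anisotropy_eq, penalty, lintegral_area, gradEnergy_eq,
    ← lintegral_add_left' h.aem_densLeft]
  congr 2
  refine lintegral_congr_ae ?_
  filter_upwards [S.ae_mC_mem] with r hr
  have h1 := (S.areaDensity_pos hr.2).le
  rw [densLeft, densRight, ← ENNReal.ofReal_add (by positivity) (by positivity), add_mul]

/-- On almost every circle of latitude, symmetrization does not increase the energy. -/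
theorem ae_wirtinger (h : IsWeakMap S T m P Q) {ω : E3 → ℝ≥0} (hω : Measurable ω)
    (hW : ∀ t ∈ Ioo S.a S.b, ENNReal.ofReal (2 * Real.pi / S.x t ^ 2) <
      ∫⁻ φ, (ω (S.param φ t) : ℝ≥0∞) ^ 2 ∂circ) : ∀ᵐ t ∂S.mI,
    (∫⁻ φ, S.densPerp m (φ, t) ∂circ ≤
      ∫⁻ φ, S.densLeft P (φ, t) ∂circ + ∫⁻ φ, S.densMean ω m (φ, t) ∂circ) ∧
    (∫⁻ φ, S.densLeft P (φ, t) ∂circ + ∫⁻ φ, S.densMean ω m (φ, t) ∂circ ≤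
      ∫⁻ φ, S.densPerp m (φ, t) ∂circ →
      (∫ θ, m (S.param θ t) 0 ∂circ = 0 ∧
        ∫ φ, P (φ, t) 0 ^ 2 ∂circ ≤ ∫ φ, m (S.param φ t) 0 ^ 2 ∂circ) ∧
      (∫ θ, m (S.param θ t) 1 ∂circ = 0 ∧
        ∫ φ, P (φ, t) 1 ^ 2 ∂circ ≤ ∫ φ, m (S.param φ t) 1 ^ 2 ∂circ) ∧
        (fun φ => P (φ, t) 2) =ᵐ[circ] 0) := by
  filter_upwards [ae_all_iff.2 fun i => (h.scalar i).ae_slice, h.ae_norm_sq_mean,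
    ae_restrict_mem measurableSet_Ioo] with t hs hmean ht
  have hA := S.areaDensity_pos ht
  have hx := S.x_pos ht
  have key := wirtinger_perp (M := fun φ => m (S.param φ t)) (P := fun φ => P (φ, t))
    (fun i => (hs i).1) (fun i => (hs i).2.1) (fun i => (hs i).2.2) hA hx (hW t ht)
  have e3 := lintegral_densMean hω t fun φ => hmean φ
  rw [lintegral_densPerp (hs 0).1 (hs 1).1, lintegral_densLeft fun i => (hs i).2.1, e3]
  exact key

/-- The energy of the symmetrized maps, averaged over all meridians. -/
theorem lintegral_symm_le (h : IsWeakMap S T m P Q) {ω : E3 → ℝ≥0} (hω : Measurable ω)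
    (hW : ∀ t ∈ Ioo S.a S.b, ENNReal.ofReal (2 * Real.pi / S.x t ^ 2) <
      ∫⁻ φ, (ω (S.param φ t) : ℝ≥0∞) ^ 2 ∂circ) :
    ∫⁻ r, S.densPerp m r ∂S.mC ≤ ∫⁻ r, S.densLeft P r ∂S.mC + ∫⁻ r, S.densMean ω m r ∂S.mC := by
  rw [lintegral_prod_symm _ h.aem_densPerp, lintegral_prod_symm _ h.aem_densLeft,
    lintegral_prod_symm _ (h.aem_densMean hω),
    ← lintegral_add_left' h.aem_densLeft.lintegral_prod_left']
  refine lintegral_mono_ae ?_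
  filter_upwards [h.ae_wirtinger hω hW] with t ht
  exact ht.1

/-- The inequality holds circle by circle. If the finite total is not smaller, equality holds on
almost every circle. -/
theorem ae_of_lintegral_symm_ge (h : IsWeakMap S T m P Q) {ω : E3 → ℝ≥0} (hω : Measurable ω)
    (hW : ∀ t ∈ Ioo S.a S.b, ENNReal.ofReal (2 * Real.pi / S.x t ^ 2) <
      ∫⁻ φ, (ω (S.param φ t) : ℝ≥0∞) ^ 2 ∂circ)
    (hfin : ∫⁻ r, S.densPerp m r ∂S.mC ≠ ⊤)
    (hge : ∫⁻ r, S.densLeft P r ∂S.mC + ∫⁻ r, S.densMean ω m r ∂S.mC ≤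
      ∫⁻ r, S.densPerp m r ∂S.mC) : ∀ᵐ t ∂S.mI,
      (∫ θ, m (S.param θ t) 0 ∂circ = 0 ∧
        ∫ φ, P (φ, t) 0 ^ 2 ∂circ ≤ ∫ φ, m (S.param φ t) 0 ^ 2 ∂circ) ∧
      (∫ θ, m (S.param θ t) 1 ∂circ = 0 ∧
        ∫ φ, P (φ, t) 1 ^ 2 ∂circ ≤ ∫ φ, m (S.param φ t) 1 ^ 2 ∂circ) ∧
        (fun φ => P (φ, t) 2) =ᵐ[circ] 0 := by
  have hae := h.ae_wirtinger hω hW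
  rw [lintegral_prod_symm _ h.aem_densPerp, lintegral_prod_symm _ h.aem_densLeft,
    lintegral_prod_symm _ (h.aem_densMean hω),
    ← lintegral_add_left' h.aem_densLeft.lintegral_prod_left'] at hge
  rw [lintegral_prod_symm _ h.aem_densPerp] at hfin
  have heq := ae_eq_of_ae_le_of_lintegral_le (hae.mono fun t ht => ht.1) hfin
    (h.aem_densLeft.lintegral_prod_left'.add (h.aem_densMean hω).lintegral_prod_left') hge
  filter_upwards [hae, heq] with t h1 h2
  exact h1.2 h2.ge

end IsWeakMap
end RevSurface
end AxialMaps

/-! ### Symmetrization along meridians -/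

namespace AxialMaps
namespace RevSurface

variable {S T : RevSurface}

namespace IsWeakMap

variable {m : E3 → E3} {P Q : ℝ × ℝ → E3}

theorem ae_loop (h : IsWeakMap S T m P Q) : ∀ᵐ φ ∂circ, S.IsLoop →
    ∀ i, Integrable (fun t => Q (φ, t) i) S.mI ∧ ∫ t, Q (φ, t) i ∂S.mI = 0 := by
  by_cases hS : S.IsLoop
  · filter_upwards [ae_all_iff.2 fun i => (h.scalar i).ae_slice_integral_loop hS,
      ae_all_iff.2 fun i => ((h.scalar i).integrable_right_loop hS).prod_right_ae]
      with φ h1 h2 _ i using ⟨h2 i, h1 i⟩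
  · exact Eventually.of_forall fun φ h => absurd h hS

/-- A map restricted to almost every meridian is a profile. -/
theorem ae_profile (h : IsWeakMap S T m P Q) (σ : ℤ) {a : E3 → E3} (hae : S.Equivariant σ a)
    (g : ℝ → ℝ≥0)
    (hfin : ∫⁻ r, S.densPerp m r ∂S.mC + ∫⁻ r, S.densRight Q r ∂S.mC ≠ ⊤) :
    ∀ᵐ φ ∂circ, ∃ f f', IsProfile S T f f' ∧
      (∀ᵐ t ∂S.mI, m (S.param φ t) = axialRot (σ * φ) (f t)) ∧ S.profileEnergy g a f f' =
      ENNReal.ofReal (2 * Real.pi) * ∫⁻ t, (S.densPerp m (φ, t) + S.densRight Q (φ, t) +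
        S.densAniso g a m (φ, t)) ∂S.mI := by
  have hsum : AEMeasurable (fun r => S.densPerp m r + S.densRight Q r) S.mC :=
    h.aem_densPerp.add h.aem_densRight
  rw [← lintegral_add_left' h.aem_densPerp, lintegral_prod _ hsum] at hfin
  filter_upwards [ae_all_iff.2 fun i => (h.scalar i).ae_slice_isPrim, h.ae_loop,
    Measure.ae_ae_of_ae_prod h.mem,
    ae_lt_top' hsum.lintegral_prod_right' hfin,
    h.aesm_right.prodMk_left] with φ hk hl hT hD hQ
  -- The absolutely continuous representatives of the three components form a curve K which
  -- represents m on the meridian φ. It stays in T by continuity and closedness.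
  choose k hk hke using hk
  obtain ⟨K, hK⟩ : ∃ K : ℝ → E3, ∀ t i, K t i = k i t :=
    ⟨fun t => WithLp.toLp 2 fun i => k i t, fun t i => rfl⟩
  have hKp : IsPrim S.a S.b K (fun t => Q (φ, t)) := isPrim_of_coord fun i => by
    simp only [hK]; exact hk i
  have hmK : ∀ᵐ t ∂S.mI, m (S.param φ t) = K t := by
    filter_upwards [ae_all_iff.2 hke] with t ht
    ext i
    rw [hK, ← ht i]
  have hKT : ∀ t ∈ Ioo S.a S.b, K t ∈ T.carrier :=
    forall_mem_of_ae_mem hKp.continuousOn T.isClosed_carrier (by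
      filter_upwards [hmK, hT] with t h1 h2
      rwa [← h1])
  have hdens : ∀ᵐ t ∂S.mI, ENNReal.ofReal (S.profileDensity
      (fun t => axialRot (-(σ * φ)) (K t)) (fun t => axialRot (-(σ * φ)) (Q (φ, t))) t) =
        S.densPerp m (φ, t) + S.densRight Q (φ, t) := by
    filter_upwards [hmK, ae_restrict_mem measurableSet_Ioo] with t h1 ht
    have hA := S.areaDensity_pos ht
    rw [densPerp, densRight, h1, ← ENNReal.ofReal_add (by positivity) (by positivity),
      profileDensity, axialRot_perp_sq, norm_axialRot]
    congr 1
    ring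
  -- The profile is K rotated back to the angle zero, so that its equivariant field agrees with m on
  -- the meridian φ.
  refine ⟨_, _, ⟨hKp.axialRot (-(σ * φ)), aesm_axialRot aestronglyMeasurable_const hQ,
    fun t ht => T.axialRot_mem (hKT t ht) _, fun hS => ?_, ?_⟩, ?_, ?_⟩
  · have hi : Integrable (fun t => Q (φ, t)) S.mI := integrable_of_coord fun i => (hl hS i).1
    have h0 : ∫ t, Q (φ, t) ∂S.mI = 0 := by
      ext i
      rw [integral_coord hi, (hl hS i).2]
      rfl
    have h1 := (axialRotCLM (-(σ * φ))).integral_comp_comm hi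
    rw [h0, map_zero] at h1
    exact h1
  · rw [lintegral_congr_ae hdens]
    exact hD
  · filter_upwards [hmK] with t ht
    rw [ht, axialRot_axialRot_neg]
  · rw [profileEnergy]
    congr 1
    refine lintegral_congr_ae ?_
    filter_upwards [hdens, hmK, ae_restrict_mem measurableSet_Ioo] with t h1 h2 ht
    -- Equivariance of a moves the anisotropy on the meridian φ to the generating curve.
    have h3 := hae φ (S.param 0 t) (S.param_mem 0 (Ioo_subset_Icc_self ht))
    rw [axialRot_param, add_zero, param_zero] at h3
    rw [h1, densAniso, h2, h3]
    congr 4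
    rw [← inner_axialRot (σ * φ), axialRot_axialRot_neg]

variable {ω : E3 → ℝ≥0} {g : ℝ → ℝ≥0} {a : E3 → E3}

theorem symm_energy_le (h : IsWeakMap S T m P Q) (hω : Measurable ω)
    (hW : ∀ t ∈ Ioo S.a S.b, ENNReal.ofReal (2 * Real.pi / S.x t ^ 2) <
      ∫⁻ φ, (ω (S.param φ t) : ℝ≥0∞) ^ 2 ∂circ) :
    ∫⁻ r, S.densPerp m r ∂S.mC + ∫⁻ r, S.densRight Q r ∂S.mC +
      ∫⁻ r, S.densAniso g a m r ∂S.mC ≤ S.energy ω g a m := by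
  rw [h.energy_eq]
  have := h.lintegral_symm_le hω hW
  calc _ ≤ (∫⁻ r, S.densLeft P r ∂S.mC + ∫⁻ r, S.densMean ω m r ∂S.mC) +
        ∫⁻ r, S.densRight Q r ∂S.mC + ∫⁻ r, S.densAniso g a m r ∂S.mC := by gcongr
    _ = _ := by ring

theorem lintegral_dens (h : IsWeakMap S T m P Q) (hg : ∃ K : ℝ≥0, LipschitzWith K g)
    (ha : ∃ K : ℝ≥0, LipschitzOnWith K a S.carrier) :
    ∫⁻ φ, ∫⁻ t, (S.densPerp m (φ, t) + S.densRight Q (φ, t) +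
      S.densAniso g a m (φ, t)) ∂S.mI ∂circ = ∫⁻ r, S.densPerp m r ∂S.mC +
      ∫⁻ r, S.densRight Q r ∂S.mC + ∫⁻ r, S.densAniso g a m r ∂S.mC := by
  have h1 : AEMeasurable (fun r => S.densPerp m r + S.densRight Q r) S.mC :=
    h.aem_densPerp.add h.aem_densRight
  rw [← lintegral_add_left' h.aem_densPerp, ← lintegral_add_left' h1]
  exact (lintegral_prod _ (h1.add (h.aem_densAniso hg ha))).symm

theorem circ_univ : circ univ = ENNReal.ofReal (2 * Real.pi) := by
  simp [circ]

theorem lintegral_circ_const (c : ℝ≥0∞) :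
    ∫⁻ _ : ℝ, c / ENNReal.ofReal (2 * Real.pi) ∂circ = c := by
  rw [lintegral_const, circ_univ, ENNReal.div_mul_cancel (ENNReal.ofReal_pos.2 two_pi_pos).ne'
    ENNReal.ofReal_ne_top]

/-- Symmetrization along a suitable meridian does not increase the energy. -/
theorem exists_profile_energy_le (h : IsWeakMap S T m P Q) {σ : ℤ} (hae : S.Equivariant σ a)
    (hω : Measurable ω) (hg : ∃ K : ℝ≥0, LipschitzWith K g)
    (ha : ∃ K : ℝ≥0, LipschitzOnWith K a S.carrier)
    (hW : ∀ t ∈ Ioo S.a S.b, ENNReal.ofReal (2 * Real.pi / S.x t ^ 2) <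
      ∫⁻ φ, (ω (S.param φ t) : ℝ≥0∞) ^ 2 ∂circ) (hE : S.energy ω g a m < ⊤) :
    ∃ f f', IsProfile S T f f' ∧ S.profileEnergy g a f f' ≤ S.energy ω g a m := by
  have hle := h.symm_energy_le (g := g) (a := a) hω hW
  have hfin := ((self_le_add_right _ _).trans hle).trans_lt hE
  -- If every profile cost more than m, then on almost every meridian the density would have an
  -- integral larger than the average value, and integration over the circle would contradict
  -- `symm_energy_le`.
  by_contra! hcon
  have h1 : ∀ᵐ φ ∂circ, S.energy ω g a m / ENNReal.ofReal (2 * Real.pi) <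
      ∫⁻ t, (S.densPerp m (φ, t) + S.densRight Q (φ, t) + S.densAniso g a m (φ, t)) ∂S.mI := by
    filter_upwards [h.ae_profile σ hae g hfin.ne] with φ ⟨f, f', hf, _, he⟩
    have h2 := hcon f f' hf
    rwa [he, mul_comm, ← ENNReal.div_lt_iff (Or.inl (ENNReal.ofReal_pos.2 two_pi_pos).ne')
      (Or.inl ENNReal.ofReal_ne_top)] at h2
  have h3 := lintegral_strict_mono (μ := circ) (by
    intro h0
    have := congrArg (fun μ => μ univ) h0
    simp [Real.pi_pos.not_ge] at this) ((h.aem_densPerp.add h.aem_densRight).add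
      (h.aem_densAniso hg ha)).lintegral_prod_right' (by
        rw [lintegral_circ_const]; exact hE.ne) h1
  rw [lintegral_circ_const] at h3
  exact absurd (h3.trans_le ((h.lintegral_dens hg ha).le.trans hle)) (lt_irrefl _)

/-- Minimality forces equality in Wirtinger's inequality on almost every circle of latitude. -/
theorem ae_of_minimal (h : IsWeakMap S T m P Q) {σ : ℤ} (hae : S.Equivariant σ a)
    (hω : Measurable ω) (hg : ∃ K : ℝ≥0, LipschitzWith K g)
    (ha : ∃ K : ℝ≥0, LipschitzOnWith K a S.carrier)
    (hW : ∀ t ∈ Ioo S.a S.b, ENNReal.ofReal (2 * Real.pi / S.x t ^ 2) <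
      ∫⁻ φ, (ω (S.param φ t) : ℝ≥0∞) ^ 2 ∂circ) (hE : S.energy ω g a m < ⊤)
    (hmin : ∀ f f', IsProfile S T f f' → S.energy ω g a m ≤ S.profileEnergy g a f f') :
    ∀ᵐ t ∂S.mI,
      (∫ θ, m (S.param θ t) 0 ∂circ = 0 ∧
        ∫ φ, P (φ, t) 0 ^ 2 ∂circ ≤ ∫ φ, m (S.param φ t) 0 ^ 2 ∂circ) ∧
      (∫ θ, m (S.param θ t) 1 ∂circ = 0 ∧
        ∫ φ, P (φ, t) 1 ^ 2 ∂circ ≤ ∫ φ, m (S.param φ t) 1 ^ 2 ∂circ) ∧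
        (fun φ => P (φ, t) 2) =ᵐ[circ] 0 := by
  have hle := h.symm_energy_le (g := g) (a := a) hω hW
  have hfin := ((self_le_add_right _ _).trans hle).trans_lt hE
  have h1 : ∀ᵐ φ ∂circ, S.energy ω g a m / ENNReal.ofReal (2 * Real.pi) ≤
      ∫⁻ t, (S.densPerp m (φ, t) + S.densRight Q (φ, t) + S.densAniso g a m (φ, t)) ∂S.mI := by
    filter_upwards [h.ae_profile σ hae g hfin.ne] with φ ⟨f, f', hf, _, he⟩
    have h2 := hmin f f' hf
    rwa [he, mul_comm, ← ENNReal.div_le_iff (ENNReal.ofReal_pos.2 two_pi_pos).ne'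
      ENNReal.ofReal_ne_top] at h2
  have h3 := lintegral_mono_ae h1
  rw [lintegral_circ_const, h.lintegral_dens hg ha, h.energy_eq] at h3
  rw [h.energy_eq] at hE
  refine h.ae_of_lintegral_symm_ge hω hW (ne_top_of_le_ne_top hfin.ne (self_le_add_right _ _)) ?_
  -- The meridional and anisotropy terms are the same on both sides. Being finite, they can be
  -- cancelled.
  have hR : ∫⁻ r, S.densRight Q r ∂S.mC + ∫⁻ r, S.densAniso g a m r ∂S.mC ≠ ⊤ := by
    refine ne_top_of_le_ne_top hE.ne ?_
    calc _ ≤ _ := self_le_add_right _ (∫⁻ r, S.densLeft P r ∂S.mC + ∫⁻ r, S.densMean ω m r ∂S.mC)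
      _ = _ := by ring
  rw [← ENNReal.add_le_add_iff_right hR]
  calc _ = _ := by ring
    _ ≤ _ := h3
    _ = _ := by ring

end IsWeakMap
end RevSurface
end AxialMaps

/-! ### Horizontal ellipses, circles, and line symmetry -/

namespace AxialMaps

/-- The horizontal ellipse `φ ↦ v cos φ + w sin φ` (horizontal components) at height `v₂`. -/
noncomputable def ellipse (v w : E3) (φ : ℝ) : E3 :=
  !₂[Real.cos φ * v 0 + Real.sin φ * w 0, Real.cos φ * v 1 + Real.sin φ * w 1, v 2]

theorem ellipse_zero (v w : E3) (φ : ℝ) :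
    ellipse v w φ 0 = Real.cos φ * v 0 + Real.sin φ * w 0 := rfl

theorem ellipse_one (v w : E3) (φ : ℝ) :
    ellipse v w φ 1 = Real.cos φ * v 1 + Real.sin φ * w 1 := rfl

theorem ellipse_two (v w : E3) (φ : ℝ) : ellipse v w φ 2 = v 2 := rfl

/-- The cosine coefficient of the ellipse through `k` at the angle `φ` and `l` at `ψ`. -/
noncomputable def ellipseCos (φ ψ : ℝ) (k l : E3) : E3 :=
  !₂[(Real.sin ψ * k 0 - Real.sin φ * l 0) / Real.sin (ψ - φ),
    (Real.sin ψ * k 1 - Real.sin φ * l 1) / Real.sin (ψ - φ), k 2]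

/-- The sine coefficient of the ellipse through `k` at the angle `φ` and `l` at `ψ`. -/
noncomputable def ellipseSin (φ ψ : ℝ) (k l : E3) : E3 :=
  !₂[(Real.cos φ * l 0 - Real.cos ψ * k 0) / Real.sin (ψ - φ),
    (Real.cos φ * l 1 - Real.cos ψ * k 1) / Real.sin (ψ - φ), k 2]

/-- Cramer's rule: sin(ψ - φ) is the determinant of the system which recovers the two coefficients
from the points at the angles φ and ψ. -/
theorem ellipse_ellipse {φ ψ : ℝ} (h : Real.sin (ψ - φ) ≠ 0) (v w : E3) (θ : ℝ) :
    ellipse (ellipseCos φ ψ (ellipse v w φ) (ellipse v w ψ))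
      (ellipseSin φ ψ (ellipse v w φ) (ellipse v w ψ)) θ = ellipse v w θ := by
  have hs := Real.sin_sub ψ φ
  have key : ∀ p q : ℝ, Real.cos θ * ((Real.sin ψ * (Real.cos φ * p + Real.sin φ * q) -
      Real.sin φ * (Real.cos ψ * p + Real.sin ψ * q)) / Real.sin (ψ - φ)) +
      Real.sin θ * ((Real.cos φ * (Real.cos ψ * p + Real.sin ψ * q) -
      Real.cos ψ * (Real.cos φ * p + Real.sin φ * q)) / Real.sin (ψ - φ)) =
      Real.cos θ * p + Real.sin θ * q := fun p q => by
    field_simp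
    rw [hs]
    ring
  apply E3.ext'
  · exact key (v 0) (w 0)
  · exact key (v 1) (w 1)
  · rfl

theorem continuous_ellipse : Continuous fun p : (E3 × E3) × ℝ => ellipse p.1.1 p.1.2 p.2 := by
  have hc := Real.continuous_cos.comp (continuous_snd : Continuous (Prod.snd : (E3 × E3) × ℝ → ℝ))
  have hs := Real.continuous_sin.comp (continuous_snd : Continuous (Prod.snd : (E3 × E3) × ℝ → ℝ))
  have hv := fun i => (continuous_coord i).comp
    (continuous_fst.fst : Continuous fun p : (E3 × E3) × ℝ => p.1.1)
  have hw := fun i => (continuous_coord i).comp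
    (continuous_fst.snd : Continuous fun p : (E3 × E3) × ℝ => p.1.2)
  exact continuous_E3 ((hc.mul (hv 0)).add (hs.mul (hw 0))) ((hc.mul (hv 1)).add (hs.mul (hw 1)))
    (hv 2)

theorem continuous_ellipse_angle (v w : E3) : Continuous (ellipse v w) := by
  have h : Continuous fun φ : ℝ => ((v, w), φ) := continuous_const.prodMk continuous_id
  have h1 := continuous_ellipse.comp h
  exact h1

theorem ellipse_congr {φ ψ : ℝ} (hc : Real.cos φ = Real.cos ψ) (hs : Real.sin φ = Real.sin ψ)
    (v w : E3) : ellipse v w φ = ellipse v w ψ := by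
  simp only [ellipse, hc, hs]

/-- A continuous function on the line with finitely many values is constant. -/
theorem eq_of_finite_values {F : ℝ → ℝ} (hF : Continuous F) {s : Set ℝ} (hs : s.Finite)
    (h : ∀ φ, F φ ∈ s) (φ ψ : ℝ) : F φ = F ψ := by
  have hr : (range F) ⊆ s := by rintro _ ⟨φ, rfl⟩; exact h φ
  have key : ∀ φ ψ, ¬ F φ < F ψ := fun φ ψ hlt => by
    have h1 := (isPreconnected_range hF).Icc_subset (mem_range_self φ) (mem_range_self ψ)
    exact Icc_infinite hlt (hs.subset (h1.trans hr))
  exact le_antisymm (not_lt.1 (key ψ φ)) (not_lt.1 (key φ ψ))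

namespace RevSurface

variable {S T : RevSurface}

/-- A horizontal ellipse in a surface which is nowhere flat is a circle. -/
theorem NeverFlat.ellipse_circle (hT : T.NeverFlat) {v w : E3}
    (h : ∀ φ, ellipse v w φ ∈ T.carrier) :
    v 0 * w 0 + v 1 * w 1 = 0 ∧ v 0 ^ 2 + v 1 ^ 2 = w 0 ^ 2 + w 1 ^ 2 := by
  obtain ⟨R, -, hR⟩ := hT (v 2)
  have hc := continuous_ellipse_angle v w
  have h0 := (continuous_coord 0).comp hc
  have h1 := (continuous_coord 1).comp hc
  -- The ellipse lies in one horizontal section of T, so its squared distance to the axis takes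
  -- values in a finite set and is constant by continuity.
  have hmem : ∀ φ, ellipse v w φ 0 ^ 2 + ellipse v w φ 1 ^ 2 ∈ (fun r : ℝ => r ^ 2) '' (R : Set ℝ) := by
    intro φ
    have h2 : perpProj (ellipse v w φ) ∈ perpProj '' (T.carrier ∩ {u | u 2 = v 2}) :=
      ⟨_, ⟨h φ, ellipse_two v w φ⟩, rfl⟩
    rw [hR] at h2
    simp only [mem_iUnion] at h2
    obtain ⟨r, hr, -, h3⟩ := h2
    exact ⟨r, hr, h3.symm⟩
  have hF : Continuous fun φ => ellipse v w φ 0 ^ 2 + ellipse v w φ 1 ^ 2 :=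
    (h0.pow 2).add (h1.pow 2)
  have key := eq_of_finite_values hF (R.finite_toSet.image _) hmem
  -- The angle π/2 compares the lengths of v and w, and the angle π/4 then gives their
  -- orthogonality.
  have k1 := key 0 (Real.pi / 2)
  have k2 := key 0 (Real.pi / 4)
  have h2 : (Real.sqrt 2 / 2) ^ 2 = 1 / 2 := by
    rw [div_pow, Real.sq_sqrt zero_le_two]; norm_num
  simp only [ellipse_zero, ellipse_one, Real.cos_zero, Real.sin_zero,
    Real.cos_pi_div_two, Real.sin_pi_div_two, Real.cos_pi_div_four, Real.sin_pi_div_four] at k1 k2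
  constructor
  · linear_combination (-1 : ℝ) * k2 + k1 / 2 -
      ((v 0 + w 0) ^ 2 + (v 1 + w 1) ^ 2) * h2
  · linear_combination k1

/-- A field is prescribed by compatible values in the coordinates. -/
theorem exists_field (S : RevSurface) {V : ℝ → ℝ → E3}
    (hper : ∀ φ ψ t, Real.cos φ = Real.cos ψ → Real.sin φ = Real.sin ψ → V φ t = V ψ t)
    (haxis : ∀ t ∈ Icc S.a S.b, S.x t = 0 → ∀ φ ψ, V φ t = V ψ t)
    (hloop : S.IsLoop → ∀ φ, V φ S.a = V φ S.b) :
    ∃ u : E3 → E3, ∀ φ, ∀ t ∈ Icc S.a S.b, u (S.param φ t) = V φ t := by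
  -- The three hypotheses match the three ways in which coordinates fail to be unique: periodicity
  -- of the angle, points on the axis, and the two ends of a loop.
  have key : ∀ φ ψ, ∀ s ∈ Icc S.a S.b, ∀ t ∈ Icc S.a S.b, S.param φ s = S.param ψ t →
      V φ s = V ψ t := by
    intro φ ψ s hs t ht h
    obtain ⟨-, -, h1⟩ := S.x_eq_of_param_eq hs ht h
    rcases S.t_eq_of_param_eq hs ht h with rfl | ⟨hl, ⟨rfl, rfl⟩ | ⟨rfl, rfl⟩⟩
    · rcases h1 with h1 | ⟨h1, h2⟩
      · exact haxis s hs h1 φ ψ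
      · exact hper φ ψ s h1 h2
    · rw [hloop hl]
      rcases h1 with h1 | ⟨h1, h2⟩
      · exact absurd h1 (hl.x_pos hs).ne'
      · exact hper φ ψ _ h1 h2
    · rw [← hloop hl]
      rcases h1 with h1 | ⟨h1, h2⟩
      · exact absurd h1 (hl.x_pos hs).ne'
      · exact hper φ ψ _ h1 h2
  classical
  refine ⟨fun ξ => if h : ∃ p : ℝ × ℝ, p.2 ∈ Icc S.a S.b ∧ ξ = S.param p.1 p.2 then
    V h.choose.1 h.choose.2 else 0, fun φ t ht => ?_⟩
  have h : ∃ p : ℝ × ℝ, p.2 ∈ Icc S.a S.b ∧ S.param φ t = S.param p.1 p.2 := ⟨(φ, t), ht, rfl⟩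
  beta_reduce
  rw [dif_pos h]
  exact (key φ _ t ht _ h.choose_spec.1 h.choose_spec.2).symm

theorem ellipse_add_of_rotated {v w : E3} (h0 : w 0 = -v 1) (h1 : w 1 = v 0) (φ ψ : ℝ) :
    ellipse v w (φ + ψ) = axialRot φ (ellipse v w ψ) := by
  apply E3.ext'
  · simp only [axialRot_zero_apply, ellipse_zero, ellipse_one, h0, h1, Real.cos_add, Real.sin_add]
    ring
  · simp only [axialRot_one_apply, ellipse_zero, ellipse_one, h0, h1, Real.cos_add, Real.sin_add]
    ring
  · simp only [axialRot_two_apply, ellipse_two]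

theorem ellipse_add_of_rotated_neg {v w : E3} (h0 : w 0 = v 1) (h1 : w 1 = -v 0) (φ ψ : ℝ) :
    ellipse v w (φ + ψ) = axialRot (-φ) (ellipse v w ψ) := by
  apply E3.ext'
  · simp only [axialRot_zero_apply, ellipse_zero, ellipse_one, h0, h1, Real.cos_add, Real.sin_add,
      Real.cos_neg, Real.sin_neg]
    ring
  · simp only [axialRot_one_apply, ellipse_zero, ellipse_one, h0, h1, Real.cos_add, Real.sin_add,
      Real.cos_neg, Real.sin_neg]
    ring
  · simp only [axialRot_two_apply, ellipse_two]

/-- With J the rotation by a right angle, |w - Jv|² |w + Jv|² = (|v|² - |w|²)² + 4 (v · w)² for the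
horizontal parts, so one of the two factors vanishes. -/
theorem rotated_or_of_circle {v w : E3} (h : v 0 * w 0 + v 1 * w 1 = 0)
    (h2 : v 0 ^ 2 + v 1 ^ 2 = w 0 ^ 2 + w 1 ^ 2) :
    (w 0 = -v 1 ∧ w 1 = v 0) ∨ (w 0 = v 1 ∧ w 1 = -v 0) := by
  have key : ((w 0 + v 1) ^ 2 + (w 1 - v 0) ^ 2) * ((w 0 - v 1) ^ 2 + (w 1 + v 0) ^ 2) = 0 := by
    linear_combination (4 * (v 0 * w 0 + v 1 * w 1)) * h + (v 0 ^ 2 + v 1 ^ 2 - w 0 ^ 2 - w 1 ^ 2) * h2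
  rcases mul_eq_zero.1 key with h3 | h3
  · refine Or.inl ⟨?_, ?_⟩ <;> nlinarith [sq_nonneg (w 0 + v 1), sq_nonneg (w 1 - v 0)]
  · refine Or.inr ⟨?_, ?_⟩ <;> nlinarith [sq_nonneg (w 0 - v 1), sq_nonneg (w 1 + v 0)]

/-- Fields whose circles of latitude are mapped to circles have line symmetry. -/
theorem lineSymmetric_of_ellipse {u : E3 → E3} {v w : ℝ → E3}
    (hu : ∀ φ, ∀ t ∈ Icc S.a S.b, u (S.param φ t) = ellipse (v t) (w t) φ)
    (h : ∀ t ∈ Icc S.a S.b, v t 0 * w t 0 + v t 1 * w t 1 = 0 ∧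
      v t 0 ^ 2 + v t 1 ^ 2 = w t 0 ^ 2 + w t 1 ^ 2) : S.LineSymmetric u := by
  rintro ξ ⟨ψ, t, ht, rfl⟩
  simp only [axialRot_param, hu _ t ht]
  rcases rotated_or_of_circle (h t ht).1 (h t ht).2 with ⟨h0, h1⟩ | ⟨h0, h1⟩
  · exact Or.inl fun φ => ellipse_add_of_rotated h0 h1 φ ψ
  · exact Or.inr fun φ => ellipse_add_of_rotated_neg h0 h1 φ ψ

end RevSurface
end AxialMaps

/-! ### Maps with elliptic circles of latitude and their continuous representatives -/

namespace AxialMaps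
namespace RevSurface

variable {S T : RevSurface}

section MemH1I

variable {V W : Type} [NormedAddCommGroup V] [NormedSpace ℝ V] [NormedAddCommGroup W]
  [NormedSpace ℝ W]

theorem memH1I_of_isPrim {f f' : ℝ → V} (hc : ContinuousOn f (Icc S.a S.b))
    (hm : AEStronglyMeasurable f' S.mI) (hi : Integrable (fun t => S.x t * ‖f' t‖ ^ 2) S.mI)
    (hp : IsPrim S.a S.b f f') : S.MemH1I f := by
  refine ⟨hc, f', ?_, ?_, hp.sub⟩
  · rw [← Measure.restrict_congr_set (Ioo_ae_eq_Icc (μ := volume) (a := S.a) (b := S.b))]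
    exact hm
  · rw [← Measure.restrict_congr_set (Ioo_ae_eq_Icc (μ := volume) (a := S.a) (b := S.b))]
    have h1 := hi.2
    rwa [hasFiniteIntegral_iff_ofReal] at h1
    filter_upwards [ae_restrict_mem measurableSet_Ioo] with t ht
    have := S.x_pos ht
    positivity

theorem MemH1I.clm [CompleteSpace V] [CompleteSpace W] {f : ℝ → V} (hf : S.MemH1I f) (L : V →L[ℝ] W) :
    S.MemH1I fun t => L (f t) := by
  obtain ⟨f', hm, hi, hp⟩ := hf.exists_deriv
  have hm' := L.continuous.comp_aestronglyMeasurable hm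
  refine memH1I_of_isPrim (L.continuous.comp_continuousOn hf.1) hm' ?_ (hp.clm L)
  refine Integrable.mono' (hi.const_mul (‖L‖ ^ 2))
    (S.continuous_x.aestronglyMeasurable.mul (hm'.norm.pow 2)) ?_
  filter_upwards [ae_restrict_mem measurableSet_Ioo] with t ht
  have hx := S.x_pos ht
  have h1 : ‖L (f' t)‖ ^ 2 ≤ (‖L‖ * ‖f' t‖) ^ 2 := pow_le_pow_left₀ (norm_nonneg _) (L.le_opNorm _) 2
  rw [Real.norm_eq_abs, abs_of_nonneg (by positivity)]
  calc S.x t * ‖L (f' t)‖ ^ 2 ≤ S.x t * (‖L‖ * ‖f' t‖) ^ 2 := by gcongr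
    _ = _ := by ring

theorem MemH1I.add {f g : ℝ → V} (hf : S.MemH1I f) (hg : S.MemH1I g) :
    S.MemH1I fun t => f t + g t := by
  obtain ⟨f', hfm, hfi, hfp⟩ := hf.exists_deriv
  obtain ⟨g', hgm, hgi, hgp⟩ := hg.exists_deriv
  refine memH1I_of_isPrim (hf.1.add hg.1) (hfm.add hgm) ?_ (hfp.add hgp)
  refine Integrable.mono' ((hfi.const_mul 2).add (hgi.const_mul 2))
    (S.continuous_x.aestronglyMeasurable.mul ((hfm.add hgm).norm.pow 2)) ?_
  filter_upwards [ae_restrict_mem measurableSet_Ioo] with t ht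
  have hx := S.x_pos ht
  have h1 : ‖f' t + g' t‖ ^ 2 ≤ 2 * ‖f' t‖ ^ 2 + 2 * ‖g' t‖ ^ 2 := by
    have h2 := pow_le_pow_left₀ (norm_nonneg _) (norm_add_le (f' t) (g' t)) 2
    nlinarith [sq_nonneg (‖f' t‖ - ‖g' t‖)]
  simp only [Pi.add_apply]
  rw [Real.norm_eq_abs, abs_of_nonneg (by positivity)]
  calc S.x t * ‖f' t + g' t‖ ^ 2 ≤ S.x t * (2 * ‖f' t‖ ^ 2 + 2 * ‖g' t‖ ^ 2) := by gcongr
    _ = _ := by ring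

end MemH1I

/-- The horizontal part of a vector. -/
noncomputable def horizontal : E3 →L[ℝ] EuclideanSpace ℝ (Fin 2) :=
  LinearMap.toContinuousLinearMap
    { toFun := fun v => !₂[v 0, v 1]
      map_add' := fun v w => by ext i; fin_cases i <;> simp
      map_smul' := fun c v => by ext i; fin_cases i <;> simp }

theorem horizontal_zero (v : E3) : horizontal v 0 = v 0 := rfl

theorem horizontal_one (v : E3) : horizontal v 1 = v 1 := rfl

namespace IsWeakMap

variable {m : E3 → E3} {P Q : ℝ × ℝ → E3}

/-- The hypothesis is the case of equality in Wirtinger's inequality on almost every circle: the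
horizontal components are first harmonics and the vertical one is constant. -/
theorem ae_eq_ellipse (h : IsWeakMap S T m P Q) (hmin : ∀ᵐ t ∂S.mI,
      (∫ θ, m (S.param θ t) 0 ∂circ = 0 ∧
        ∫ φ, P (φ, t) 0 ^ 2 ∂circ ≤ ∫ φ, m (S.param φ t) 0 ^ 2 ∂circ) ∧
      (∫ θ, m (S.param θ t) 1 ∂circ = 0 ∧
        ∫ φ, P (φ, t) 1 ^ 2 ∂circ ≤ ∫ φ, m (S.param φ t) 1 ^ 2 ∂circ) ∧
        (fun φ => P (φ, t) 2) =ᵐ[circ] 0) :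
    ∃ v w : ℝ → E3, ∀ᵐ r ∂S.mC, m (S.param r.1 r.2) = ellipse (v r.2) (w r.2) r.1 := by
  obtain ⟨c, hc⟩ : ∃ c : ℤ → Fin 3 → ℝ → ℝ, ∀ j i t, c j i t =
    Real.pi⁻¹ * mode 1 j (fun r => m (S.param r.1 r.2) i) t := ⟨_, fun _ _ _ => rfl⟩
  obtain ⟨e, he⟩ : ∃ e : ℝ → ℝ, ∀ t, e t =
    (2 * Real.pi)⁻¹ * mode 0 0 (fun r => m (S.param r.1 r.2) 2) t := ⟨_, fun _ => rfl⟩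
  have hcm : ∀ j i, AEStronglyMeasurable (c j i) S.mI := fun j i => by
    simp only [funext (hc j i)]
    exact ((integrable_mode 1 j (h.scalar i).integrable).aestronglyMeasurable).const_mul _
  have hem : AEStronglyMeasurable e S.mI := by
    simp only [funext he]
    exact ((integrable_mode 0 0 (h.scalar 2).integrable).aestronglyMeasurable).const_mul _
  have hcos : ∀ j, AEStronglyMeasurable (fun r : ℝ × ℝ => cs 1 j r.1) S.mC := fun j =>
    ((continuous_cs 1 j).comp continuous_fst).aestronglyMeasurable
  have hform : ∀ᵐ t ∂S.mI, ∀ᵐ φ ∂circ,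
      (m (S.param φ t) 0 = c 0 0 t * cs 1 0 φ + c 1 0 t * cs 1 1 φ) ∧
      (m (S.param φ t) 1 = c 0 1 t * cs 1 0 φ + c 1 1 t * cs 1 1 φ) ∧ m (S.param φ t) 2 = e t := by
    filter_upwards [hmin, ae_all_iff.2 fun i => (h.scalar i).ae_slice] with t ⟨⟨a0, b0⟩, ⟨a1, b1⟩, p2⟩ hs
    filter_upwards [wirtinger_eq (hs 0).1 (hs 0).2.1 (hs 0).2.2 a0 b0,
      wirtinger_eq (hs 1).1 (hs 1).2.1 (hs 1).2.2 a1 b1,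
      ae_eq_mean_of_deriv_zero (hs 2).1 (hs 2).2.2 p2] with φ h0 h1 h2
    refine ⟨?_, ?_, ?_⟩
    · rw [h0, hc, hc]; rfl
    · rw [h1, hc, hc]; rfl
    · rw [h2, he, mode]; simp [cs]
  have g0 := ae_prod_of_ae_ae_swap (μ := circ) (ν := S.mI)
    (f := fun r => m (S.param r.1 r.2) 0 - (c 0 0 r.2 * cs 1 0 r.1 + c 1 0 r.2 * cs 1 1 r.1))
    ((aestronglyMeasurable_coord h.aesm 0).sub (((hcm 0 0).comp_snd.mul (hcos 0)).add
      ((hcm 1 0).comp_snd.mul (hcos 1)))) (hform.mono fun t ht => ht.mono fun φ hφ =>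
        sub_eq_zero.2 hφ.1)
  have g1 := ae_prod_of_ae_ae_swap (μ := circ) (ν := S.mI)
    (f := fun r => m (S.param r.1 r.2) 1 - (c 0 1 r.2 * cs 1 0 r.1 + c 1 1 r.2 * cs 1 1 r.1))
    ((aestronglyMeasurable_coord h.aesm 1).sub (((hcm 0 1).comp_snd.mul (hcos 0)).add
      ((hcm 1 1).comp_snd.mul (hcos 1)))) (hform.mono fun t ht => ht.mono fun φ hφ =>
        sub_eq_zero.2 hφ.2.1)
  have g2 := ae_prod_of_ae_ae_swap (μ := circ) (ν := S.mI)
    (f := fun r => m (S.param r.1 r.2) 2 - e r.2)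
    ((aestronglyMeasurable_coord h.aesm 2).sub hem.comp_snd) (hform.mono fun t ht =>
      ht.mono fun φ hφ => sub_eq_zero.2 hφ.2.2)
  -- The signs come from `cs 1 1 = -sin`. The height of the ellipse is read from the first vector,
  -- so the last entry of the second plays no role.
  refine ⟨fun t => !₂[c 0 0 t, c 0 1 t, e t], fun t => !₂[-c 1 0 t, -c 1 1 t, 0], ?_⟩
  filter_upwards [g0, g1, g2] with r h0 h1 h2
  apply E3.ext'
  · rw [sub_eq_zero.1 h0, ellipse_zero, cs_zero, cs_one]; simp; ring
  · rw [sub_eq_zero.1 h1, ellipse_one, cs_zero, cs_one]; simp; ring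
  · rw [sub_eq_zero.1 h2, ellipse_two]; simp

end IsWeakMap

theorem countable_sin_eq_zero (φ : ℝ) : {ψ : ℝ | Real.sin (ψ - φ) = 0}.Countable := by
  refine (countable_range fun n : ℤ => n * Real.pi + φ).mono fun ψ hψ => ?_
  obtain ⟨n, hn⟩ := Real.sin_eq_zero_iff.1 hψ
  exact ⟨n, by simp only [hn]; ring⟩

theorem exists_pair_sin_ne_zero {p : ℝ → Prop} (h : ∀ᵐ φ ∂circ, p φ) :
    ∃ φ ψ, p φ ∧ p ψ ∧ Real.sin (ψ - φ) ≠ 0 := by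
  obtain ⟨φ, hφ⟩ := h.exists
  have h1 : ∀ᵐ ψ ∂circ, ψ ∉ {ψ : ℝ | Real.sin (ψ - φ) = 0} :=
    ae_restrict_of_ae ((countable_sin_eq_zero φ).ae_notMem volume)
  obtain ⟨ψ, hψ, hs⟩ := (h.and h1).exists
  exact ⟨φ, ψ, hφ, hψ, hs⟩

/-- A closed condition on a continuous `2π`-periodic function holds everywhere if it holds almost
everywhere. -/
theorem forall_mem_of_ae_circ {V : Type*} [TopologicalSpace V] {f : ℝ → V} (hf : Continuous f)
    (hper : Function.Periodic f (2 * Real.pi)) {C : Set V} (hC : IsClosed C)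
    (h : ∀ᵐ φ ∂circ, f φ ∈ C) (φ : ℝ) : f φ ∈ C := by
  have h1 : ∀ φ ∈ Ioo 0 (2 * Real.pi), f φ ∈ C := by
    refine forall_mem_of_ae_mem hf.continuousOn hC ?_
    exact ae_restrict_of_ae_restrict_of_subset Ioo_subset_Ioc_self h
  have h2 : ∀ φ ∈ Icc 0 (2 * Real.pi), f φ ∈ C := fun φ hφ => by
    rw [← closure_Ioo two_pi_pos.ne] at hφ
    have h3 : MapsTo f (Ioo 0 (2 * Real.pi)) C := h1
    have h4 := h3.closure hf
    rw [hC.closure_eq] at h4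
    exact h4 hφ
  obtain ⟨ψ, hψ, he⟩ := hper.exists_mem_Ico₀ two_pi_pos φ
  rw [he]
  exact h2 ψ (Ico_subset_Icc_self hψ)

/-- The diagonal map `(v₀, v₁, v₂) ↦ (p v₀, p v₁, q v₂)`. -/
noncomputable def axialDiag (p q : ℝ) : E3 →L[ℝ] E3 :=
  LinearMap.toContinuousLinearMap
    { toFun := fun v => !₂[p * v 0, p * v 1, q * v 2]
      map_add' := fun v w => by apply E3.ext' <;> simp <;> ring
      map_smul' := fun c v => by apply E3.ext' <;> simp <;> ring }

theorem axialDiag_apply (p q : ℝ) (v : E3) : axialDiag p q v = !₂[p * v 0, p * v 1, q * v 2] := rfl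

theorem ellipseCos_eq (φ ψ : ℝ) (k l : E3) : ellipseCos φ ψ k l =
    axialDiag (Real.sin ψ / Real.sin (ψ - φ)) 1 k +
      axialDiag (-Real.sin φ / Real.sin (ψ - φ)) 0 l := by
  rw [axialDiag_apply, axialDiag_apply, ellipseCos]
  apply E3.ext' <;> simp <;> ring

theorem ellipseSin_eq (φ ψ : ℝ) (k l : E3) : ellipseSin φ ψ k l =
    axialDiag (-Real.cos ψ / Real.sin (ψ - φ)) 1 k +
      axialDiag (Real.cos φ / Real.sin (ψ - φ)) 0 l := by
  rw [axialDiag_apply, axialDiag_apply, ellipseSin]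
  apply E3.ext' <;> simp <;> ring

theorem continuousOn_ellipse {v w : ℝ → E3} {s : Set ℝ} (hv : ContinuousOn v s)
    (hw : ContinuousOn w s) (φ : ℝ) : ContinuousOn (fun t => ellipse (v t) (w t) φ) s := by
  have h0 : ContinuousOn (fun _ : ℝ => φ) s := continuousOn_const
  have h := continuous_ellipse.comp_continuousOn ((hv.prodMk hw).prodMk h0)
  exact h

theorem ellipse_periodic (v w : E3) : Function.Periodic (ellipse v w) (2 * Real.pi) := fun φ =>
  ellipse_congr (Real.cos_add_two_pi φ) (Real.sin_add_two_pi φ) v w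

/-- A map whose circles of latitude are ellipses and whose meridians are profiles has a continuous
representative of the same form. -/
theorem exists_ellipse_rep {m : E3 → E3} {v w : ℝ → E3}
    (hm : ∀ᵐ r ∂S.mC, m (S.param r.1 r.2) = ellipse (v r.2) (w r.2) r.1)
    (hmem : ∀ᵐ r ∂S.mC, m (S.param r.1 r.2) ∈ T.carrier)
    (hprof : ∀ᵐ φ ∂circ, ∃ F : ℝ → E3, S.MemH1I F ∧
      (∀ t ∈ Icc S.a S.b, S.x t = 0 → F t 0 = 0 ∧ F t 1 = 0) ∧ (S.IsLoop → F S.a = F S.b) ∧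
      ∀ᵐ t ∂S.mI, m (S.param φ t) = F t) :
    ∃ v w : ℝ → E3, S.MemH1I v ∧ S.MemH1I w ∧
      (∀ᵐ r ∂S.mC, m (S.param r.1 r.2) = ellipse (v r.2) (w r.2) r.1) ∧
      (∀ t ∈ Icc S.a S.b, ∀ φ, ellipse (v t) (w t) φ ∈ T.carrier) ∧
      (∀ t ∈ Icc S.a S.b, S.x t = 0 → v t 0 = 0 ∧ v t 1 = 0 ∧ w t 0 = 0 ∧ w t 1 = 0) ∧
      (S.IsLoop → v S.a = v S.b ∧ w S.a = w S.b) := by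
  -- The given coefficients are merely functions defined almost everywhere. Recomputing them
  -- linearly from two good meridians with sin(ψ - φ) ≠ 0 transfers regularity, axis values and
  -- periodicity from the meridians to the coefficients.
  obtain ⟨φ, ψ, ⟨⟨F, hF, hFx, hFl, hFm⟩, hφ⟩, ⟨⟨G, hG, hGx, hGl, hGm⟩, hψ⟩, hs⟩ :=
    exists_pair_sin_ne_zero (hprof.and (Measure.ae_ae_of_ae_prod hm))
  have hvw : ∀ᵐ t ∂S.mI, F t = ellipse (v t) (w t) φ ∧ G t = ellipse (v t) (w t) ψ := by
    filter_upwards [hFm, hGm, hφ, hψ] with t h1 h2 h3 h4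
    rw [← h1, ← h2, h3, h4]
    exact ⟨rfl, rfl⟩
  have hform : ∀ᵐ r ∂S.mC, m (S.param r.1 r.2) =
      ellipse (ellipseCos φ ψ (F r.2) (G r.2)) (ellipseSin φ ψ (F r.2) (G r.2)) r.1 := by
    filter_upwards [hm, Measure.quasiMeasurePreserving_snd.ae hvw] with r h1 h2
    rw [h1, h2.1, h2.2, ellipse_ellipse hs]
  have hv : S.MemH1I fun t => ellipseCos φ ψ (F t) (G t) := by
    simp only [ellipseCos_eq]
    exact (hF.clm _).add (hG.clm _)
  have hw : S.MemH1I fun t => ellipseSin φ ψ (F t) (G t) := by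
    simp only [ellipseSin_eq]
    exact (hF.clm _).add (hG.clm _)
  refine ⟨_, _, hv, hw, hform, ?_, fun t ht hx => ?_, fun hS => ?_⟩
  · have h1 : ∀ᵐ θ ∂circ, ∀ t ∈ Icc S.a S.b, ellipse (ellipseCos φ ψ (F t) (G t))
        (ellipseSin φ ψ (F t) (G t)) θ ∈ T.carrier := by
      have h2 : ∀ᵐ r ∂S.mC, ellipse (ellipseCos φ ψ (F r.2) (G r.2))
          (ellipseSin φ ψ (F r.2) (G r.2)) r.1 ∈ T.carrier := by
        filter_upwards [hform, hmem] with r h3 h4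
        rwa [← h3]
      filter_upwards [Measure.ae_ae_of_ae_prod h2] with θ hθ t ht
      have hc := continuousOn_ellipse hv.1 hw.1 θ
      have h3 := forall_mem_of_ae_mem (hc.mono Ioo_subset_Icc_self) T.isClosed_carrier hθ
      rw [← closure_Ioo S.lt.ne] at ht hc
      have h4 := MapsTo.closure_of_continuousOn h3 hc
      rw [T.isClosed_carrier.closure_eq] at h4
      exact h4 ht
    intro t ht θ
    exact forall_mem_of_ae_circ (continuous_ellipse_angle _ _) (ellipse_periodic _ _)
      T.isClosed_carrier (h1.mono fun θ hθ => hθ t ht) θ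
  · simp [ellipseCos, ellipseSin, hFx t ht hx, hGx t ht hx]
  · simp only [hFl hS, hGl hS, and_self]


end RevSurface
end AxialMaps

/-! ### Weak compactness and lower semicontinuity in L² -/

namespace AxialMaps

/-- Bounded sequences in a separable Hilbert space have weakly convergent subsequences. -/
theorem exists_weak_subseq {H : Type*} [NormedAddCommGroup H] [InnerProductSpace ℝ H]
    [CompleteSpace H] [TopologicalSpace.SeparableSpace H] {x : ℕ → H} {C : ℝ}
    (hx : ∀ n, ‖x n‖ ≤ C) : ∃ y, ∃ ns : ℕ → ℕ, StrictMono ns ∧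
      ∀ z, Tendsto (fun k => (inner ℝ (x (ns k)) z : ℝ)) atTop (𝓝 (inner ℝ y z)) := by
  have h := WeakDual.isSeqCompact_closedBall ℝ H 0 C
  obtain ⟨l, -, ns, hns, hl⟩ := h (x := fun n =>
    StrongDual.toWeakDual (InnerProductSpace.toDual ℝ H (x n))) (fun n => by
      simpa using hx n)
  obtain ⟨y, hy⟩ := (InnerProductSpace.toDual ℝ H).surjective (WeakDual.toStrongDual l)
  refine ⟨y, ns, hns, fun z => ?_⟩
  have h1 := ((WeakDual.eval_continuous z).tendsto l).comp hl
  have h2 : l z = inner ℝ y z := by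
    have := congrArg (fun L : StrongDual ℝ H => L z) hy
    simpa using this.symm
  rw [h2] at h1
  refine h1.congr fun k => ?_
  simp [Function.comp]

/-- Testing with the limit itself, Cauchy-Schwarz gives ‖y‖² ≤ L‖y‖. -/
theorem norm_le_of_weak {H : Type*} [NormedAddCommGroup H] [InnerProductSpace ℝ H] {x : ℕ → H}
    {y : H} {L : ℝ} (hx : Tendsto (fun n => ‖x n‖) atTop (𝓝 L))
    (h : Tendsto (fun k => (inner ℝ (x k) y : ℝ)) atTop (𝓝 (inner ℝ y y))) : ‖y‖ ≤ L := by
  have h1 : inner ℝ y y ≤ L * ‖y‖ := le_of_tendsto_of_tendsto' h (hx.mul_const _) fun n =>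
    real_inner_le_norm _ _
  rw [real_inner_self_eq_norm_sq] at h1
  rcases (norm_nonneg y).eq_or_lt with h0 | h0
  · rw [← h0]
    exact ge_of_tendsto' hx fun n => norm_nonneg _
  · nlinarith

theorem inner_toLp {μ : Measure ℝ} {f g : ℝ → E3} (hf : MemLp f 2 μ) (hg : MemLp g 2 μ) :
    (inner ℝ (hf.toLp f) (hg.toLp g) : ℝ) = ∫ t, inner ℝ (f t) (g t) ∂μ := by
  rw [L2.inner_def]
  refine integral_congr_ae ?_
  filter_upwards [hf.coeFn_toLp, hg.coeFn_toLp] with t h1 h2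
  rw [h1, h2]

theorem norm_sq_toLp {μ : Measure ℝ} {f : ℝ → E3} (hf : MemLp f 2 μ) :
    ‖hf.toLp f‖ ^ 2 = ∫ t, ‖f t‖ ^ 2 ∂μ := by
  rw [← real_inner_self_eq_norm_sq, inner_toLp]
  simp only [real_inner_self_eq_norm_sq]

/-- Weak compactness in `L²`, with lower semicontinuity of the norm. -/
theorem exists_weak_limit {E : Set ℝ} {d : ℕ → ℝ → E3}
    (hd : ∀ n, MemLp (d n) 2 (volume.restrict E)) {C : ℝ}
    (hC : ∀ n, ∫ t, ‖d n t‖ ^ 2 ∂volume.restrict E ≤ C) :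
    ∃ (y : ℝ → E3) (ns : ℕ → ℕ) (L : ℝ), MemLp y 2 (volume.restrict E) ∧ StrictMono ns ∧
      Tendsto (fun k => ∫ t, ‖d (ns k) t‖ ^ 2 ∂volume.restrict E) atTop (𝓝 L) ∧
      ∫ t, ‖y t‖ ^ 2 ∂volume.restrict E ≤ L ∧
      ∀ z, MemLp z 2 (volume.restrict E) →
        Tendsto (fun k => ∫ t, (inner ℝ (d (ns k) t) (z t) : ℝ) ∂volume.restrict E) atTop
          (𝓝 (∫ t, (inner ℝ (y t) (z t) : ℝ) ∂volume.restrict E)) := by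
  have : Fact ((2 : ℝ≥0∞) ≠ ⊤) := ⟨by simp⟩
  have hb : ∀ n, ‖(hd n).toLp (d n)‖ ≤ Real.sqrt C := fun n =>
    Real.le_sqrt_of_sq_le ((norm_sq_toLp (hd n)).trans_le (hC n))
  obtain ⟨y, ns, hns, hy⟩ := exists_weak_subseq hb
  obtain ⟨l, -, ms, hms, hl⟩ := tendsto_subseq_of_bounded
    (Metric.isBounded_Icc (0 : ℝ) (Real.sqrt C))
    (x := fun k => ‖(hd (ns k)).toLp (d (ns k))‖) fun k => ⟨norm_nonneg _, hb _⟩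
  have hy' : ∀ z, Tendsto (fun k => (inner ℝ ((hd (ns (ms k))).toLp (d (ns (ms k)))) z : ℝ)) atTop
    (𝓝 (inner ℝ y z)) := fun z => (hy z).comp hms.tendsto_atTop
  have hle := norm_le_of_weak hl (hy' y)
  have hym := Lp.memLp y
  have hyt : hym.toLp y = y := Lp.toLp_coeFn y hym
  refine ⟨y, ns ∘ ms, l ^ 2, hym, hns.comp hms, ?_, ?_, fun z hz => ?_⟩
  · refine (hl.pow 2).congr fun k => ?_
    exact norm_sq_toLp _
  · rw [← norm_sq_toLp hym, hyt]
    exact pow_le_pow_left₀ (norm_nonneg _) hle 2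
  · have h1 := hy' (hz.toLp z)
    have h2 : (inner ℝ y (hz.toLp z) : ℝ) = ∫ t, inner ℝ (y t) (z t) ∂volume.restrict E := by
      rw [← inner_toLp hym hz, hyt]
    rw [h2] at h1
    refine h1.congr fun k => ?_
    exact inner_toLp _ _

namespace RevSurface

variable {S T : RevSurface}

/-- The square root of the weight of the derivative in the energy of a profile. -/
noncomputable def derivWeight (S : RevSurface) (t : ℝ) : ℝ := Real.sqrt (S.areaDensity t) / S.speed t

theorem measurable_derivWeight : Measurable S.derivWeight :=
  S.continuous_areaDensity.measurable.sqrt.div S.continuous_speed.measurable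

theorem derivWeight_pos {t : ℝ} (ht : t ∈ Ioo S.a S.b) : 0 < S.derivWeight t :=
  div_pos (Real.sqrt_pos.2 (S.areaDensity_pos ht)) (S.speed_pos (Ioo_subset_Icc_self ht))

theorem derivWeight_sq {t : ℝ} (ht : t ∈ Ioo S.a S.b) :
    S.derivWeight t ^ 2 = S.x t / S.speed t := by
  have h1 := S.speed_pos (Ioo_subset_Icc_self ht)
  rw [derivWeight, div_pow, Real.sq_sqrt (S.areaDensity_pos ht).le, areaDensity]
  field_simp

theorem profileDensity_eq (f f' : ℝ → E3) {t : ℝ} (ht : t ∈ Ioo S.a S.b) :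
    S.profileDensity f f' t = (f t 0 ^ 2 + f t 1 ^ 2) / S.x t ^ 2 * S.areaDensity t +
      ‖S.derivWeight t • f' t‖ ^ 2 := by
  have h1 := S.speed_pos (Ioo_subset_Icc_self ht)
  have h2 := S.x_pos ht
  rw [profileDensity, norm_smul, mul_pow, Real.norm_eq_abs, sq_abs, derivWeight_sq ht, areaDensity]
  field_simp

/-- The part of the energy of a profile which does not involve the derivative. -/
noncomputable def potential (S : RevSurface) (g : ℝ → ℝ≥0) (a : E3 → E3) (t : ℝ) (v : E3) : ℝ≥0∞ :=
  ENNReal.ofReal ((v 0 ^ 2 + v 1 ^ 2) / S.x t ^ 2 * S.areaDensity t) +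
    g (inner ℝ v (a (S.curve t))) * ENNReal.ofReal (S.areaDensity t)

theorem continuous_potential (g : ℝ → ℝ≥0) (hg : Continuous g) (a : E3 → E3) (t : ℝ) :
    Continuous (S.potential g a t) := by
  have h0 := continuous_coord 0
  have h1 := continuous_coord 1
  have h2 : Continuous fun v : E3 => (inner ℝ v (a (S.curve t)) : ℝ) :=
    continuous_id.inner continuous_const
  have h3 : Continuous fun v : E3 => (g (inner ℝ v (a (S.curve t))) : ℝ≥0∞) :=
    ENNReal.continuous_coe.comp (hg.comp h2)
  exact ((ENNReal.continuous_ofReal.comp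
    ((((h0.pow 2).add (h1.pow 2)).div_const _).mul_const _))).add
    ((ENNReal.continuous_mul_const ENNReal.ofReal_ne_top).comp h3)

theorem aem_potential {f : ℝ → E3} (hf : AEStronglyMeasurable f S.mI) {g : ℝ → ℝ≥0}
    (hg : Continuous g) {a : E3 → E3} (ha : ∃ K : ℝ≥0, LipschitzOnWith K a S.carrier) :
    AEMeasurable (fun t => S.potential g a t (f t)) S.mI := by
  have h0 := (aestronglyMeasurable_coord hf 0).aemeasurable
  have h1 := (aestronglyMeasurable_coord hf 1).aemeasurable
  have h2 : AEStronglyMeasurable (fun t => (inner ℝ (f t) (a (S.curve t)) : ℝ)) S.mI :=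
    hf.inner (aesm_comp_curve ha)
  exact ((((h0.pow_const 2).add (h1.pow_const 2)).div
      (S.continuous_x.measurable.pow_const 2).aemeasurable).mul
      S.continuous_areaDensity.measurable.aemeasurable).ennreal_ofReal.add
    ((hg.measurable.comp_aemeasurable h2.aemeasurable).coe_nnreal_ennreal.mul
      (ENNReal.measurable_ofReal.comp S.continuous_areaDensity.measurable).aemeasurable)

theorem profileEnergy_eq {f f' : ℝ → E3} (hf : AEStronglyMeasurable f S.mI) {g : ℝ → ℝ≥0}
    (hg : Continuous g) {a : E3 → E3} (ha : ∃ K : ℝ≥0, LipschitzOnWith K a S.carrier) :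
    S.profileEnergy g a f f' = ENNReal.ofReal (2 * Real.pi) *
      (∫⁻ t, S.potential g a t (f t) ∂S.mI +
        ∫⁻ t, ENNReal.ofReal (‖S.derivWeight t • f' t‖ ^ 2) ∂S.mI) := by
  rw [profileEnergy, ← lintegral_add_left' (aem_potential hf hg ha)]
  congr 1
  refine lintegral_congr_ae ?_
  filter_upwards [ae_restrict_mem measurableSet_Ioo] with t ht
  have := S.areaDensity_pos ht
  rw [profileDensity_eq f f' ht, potential, ENNReal.ofReal_add (by positivity) (by positivity)]
  ring

theorem IsProfile.memLp_deriv {f f' : ℝ → E3} (h : IsProfile S T f f') :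
    MemLp (fun t => S.derivWeight t • f' t) 2 S.mI := by
  rw [memLp_two_iff_integrable_sq_norm]
  · refine Integrable.mono' h.integrable_density
      (((measurable_derivWeight.aestronglyMeasurable.smul h.aesm).norm).pow 2) ?_
    filter_upwards [ae_restrict_mem measurableSet_Ioo] with t ht
    have := S.areaDensity_pos ht
    rw [profileDensity_eq f f' ht, Real.norm_eq_abs, abs_of_nonneg (by positivity)]
    exact le_add_of_nonneg_left (by positivity)
  · exact measurable_derivWeight.aestronglyMeasurable.smul h.aesm

theorem lintegral_norm_sq {d : ℝ → E3} (hd : MemLp d 2 S.mI) :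
    ∫⁻ t, ENNReal.ofReal (‖d t‖ ^ 2) ∂S.mI = ENNReal.ofReal (∫ t, ‖d t‖ ^ 2 ∂S.mI) := by
  rw [ofReal_integral_eq_lintegral_ofReal ((memLp_two_iff_integrable_sq_norm hd.1).1 hd)
    (Eventually.of_forall fun t => sq_nonneg _)]

theorem exists_derivWeight_lower {E : Set ℝ} (hEs : E ⊆ Ioo S.a S.b) {e : ℝ} (he : 0 < e)
    (hx : ∀ t ∈ E, e ≤ S.x t) : ∃ c, 0 < c ∧ ∀ t ∈ E, c ≤ S.derivWeight t := by
  obtain ⟨c, C, hc, hC, hb⟩ := S.exists_weight_bounds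
  refine ⟨Real.sqrt (e / C), Real.sqrt_pos.2 (by positivity), fun t ht => ?_⟩
  rw [← Real.sqrt_sq (derivWeight_pos (hEs ht)).le, derivWeight_sq (hEs ht)]
  obtain ⟨h1, h2, h3⟩ := hb t (Ioo_subset_Icc_self (hEs ht))
  exact Real.sqrt_le_sqrt (div_le_div₀ (S.x_pos (hEs ht)).le (hx t ht) (hc.trans_le h1) h2)

/-- Weak convergence of the weighted derivatives implies convergence of integrals over sets away
from the axis. -/
theorem tendsto_setIntegral_of_weak {d : ℕ → ℝ → E3} {y : ℝ → E3}
    (hw : ∀ z, MemLp z 2 S.mI → Tendsto (fun k => ∫ t, (inner ℝ (S.derivWeight t • d k t) (z t) : ℝ)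
      ∂S.mI) atTop (𝓝 (∫ t, (inner ℝ (S.derivWeight t • y t) (z t) : ℝ) ∂S.mI)))
    {E : Set ℝ} (hE : MeasurableSet E) (hEs : E ⊆ Ioo S.a S.b) {e : ℝ} (he : 0 < e)
    (hx : ∀ t ∈ E, e ≤ S.x t) (hd : ∀ n, IntegrableOn (d n) E) (hy : IntegrableOn y E) :
    Tendsto (fun k => ∫ t in E, d k t) atTop (𝓝 (∫ t in E, y t)) := by
  obtain ⟨c, hc, hcx⟩ := exists_derivWeight_lower hEs he hx
  -- Dividing the indicator of E by the weight produces a test function which undoes the weight. It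
  -- is bounded because the weight is bounded below on E.
  have hz : ∀ i : Fin 3, MemLp (E.indicator fun t => (S.derivWeight t)⁻¹ •
      (EuclideanSpace.single i (1 : ℝ) : E3)) 2 S.mI := fun i => by
    refine MemLp.of_bound ((measurable_derivWeight.inv.aestronglyMeasurable.smul
      aestronglyMeasurable_const).indicator hE) c⁻¹ (Eventually.of_forall fun t => ?_)
    by_cases ht : t ∈ E
    · rw [indicator_of_mem ht, norm_smul, PiLp.norm_single, norm_one, mul_one, norm_inv,
        Real.norm_eq_abs, abs_of_pos (derivWeight_pos (hEs ht))]
      exact inv_anti₀ hc (hcx t ht)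
    · rw [indicator_of_notMem ht, norm_zero]
      positivity
  have key : ∀ (u : ℝ → E3), IntegrableOn u E → ∀ i : Fin 3,
      ∫ t, (inner ℝ (S.derivWeight t • u t) (E.indicator (fun t => (S.derivWeight t)⁻¹ •
      (EuclideanSpace.single i (1 : ℝ) : E3)) t) : ℝ) ∂S.mI = (∫ t in E, u t) i := by
    intro u hu i
    rw [integral_coord hu, ← Measure.restrict_restrict_of_subset hEs, ← integral_indicator hE]
    congr 1
    ext t
    by_cases ht : t ∈ E
    · rw [indicator_of_mem ht, indicator_of_mem ht, inner_smul_left, inner_smul_right,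
        EuclideanSpace.inner_single_right]
      have := (derivWeight_pos (hEs ht)).ne'
      simp
      field_simp
    · rw [indicator_of_notMem ht, indicator_of_notMem ht, inner_zero_right]
  have hcoord : ∀ i, Tendsto (fun k => (∫ t in E, d k t) i) atTop (𝓝 ((∫ t in E, y t) i)) :=
    fun i => by
      have := hw _ (hz i)
      simpa only [key _ hy i, key _ (hd _) i] using this
  have h := tendsto_E3 (hcoord 0) (hcoord 1) (hcoord 2)
  have e : (!₂[(∫ t in E, y t) 0, (∫ t in E, y t) 1, (∫ t in E, y t) 2] : E3) = ∫ t in E, y t :=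
    E3.ext' rfl rfl rfl
  rwa [e] at h

end RevSurface
end AxialMaps

/-! ### The direct method for profiles -/

namespace AxialMaps
namespace RevSurface

variable {S T : RevSurface} {g : ℝ → ℝ≥0} {a : E3 → E3}

/-- Sequences of profiles of bounded energy have a subsequence which converges pointwise, and
weakly in the sense of derivatives. -/
theorem exists_profile_limit {f f' : ℕ → ℝ → E3} (hf : ∀ n, IsProfile S T (f n) (f' n))
    (hg : Continuous g) (ha : ∃ K : ℝ≥0, LipschitzOnWith K a S.carrier)
    {C : ℝ≥0∞} (hC : C ≠ ⊤) (hE : ∀ n, S.profileEnergy g a (f n) (f' n) ≤ C) :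
    ∃ F F', IsProfile S T F F' ∧ ∃ ns : ℕ → ℕ, StrictMono ns ∧ ∀ E₀,
      Tendsto (fun n => S.profileEnergy g a (f n) (f' n)) atTop (𝓝 E₀) →
        S.profileEnergy g a F F' ≤ E₀ := by
  have hpi : ENNReal.ofReal (2 * Real.pi) ≠ 0 := (ENNReal.ofReal_pos.2 two_pi_pos).ne'
  have hd := fun n => (hf n).memLp_deriv
  have hEn : ∀ n, S.profileEnergy g a (f n) (f' n) = ENNReal.ofReal (2 * Real.pi) *
      (∫⁻ t, S.potential g a t (f n t) ∂S.mI +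
        ENNReal.ofReal (∫ t, ‖S.derivWeight t • f' n t‖ ^ 2 ∂S.mI)) := fun n => by
    rw [profileEnergy_eq (hf n).aesm_fun hg ha, lintegral_norm_sq (hd n)]
  have hbd : ∀ n, ∫⁻ t, S.potential g a t (f n t) ∂S.mI +
        ENNReal.ofReal (∫ t, ‖S.derivWeight t • f' n t‖ ^ 2 ∂S.mI) ≤
          C / ENNReal.ofReal (2 * Real.pi) := fun n => by
    rw [ENNReal.le_div_iff_mul_le (Or.inl hpi) (Or.inl ENNReal.ofReal_ne_top), mul_comm, ← hEn]
    exact hE n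
  have hC' : C / ENNReal.ofReal (2 * Real.pi) ≠ ⊤ := ENNReal.div_ne_top hC hpi
  have hbd' : ∀ n, ∫ t, ‖S.derivWeight t • f' n t‖ ^ 2 ∂S.mI ≤
      (C / ENNReal.ofReal (2 * Real.pi)).toReal := fun n =>
    (ENNReal.ofReal_le_iff_le_toReal hC').1 ((self_le_add_left _ _).trans (hbd n))
  obtain ⟨y, ns, L, hy, hns, hL, hyL, hw⟩ := exists_weak_limit hd hbd'
  -- A further subsequence makes the values at one point t₀ converge in the compact surface T and
  -- the potential energies converge in the compact space [0, ∞].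
  obtain ⟨t₀, ht₀⟩ := nonempty_Ioo.2 S.lt
  obtain ⟨⟨y₀, A⟩, -, ms, hms, hlim⟩ := (T.isCompact_carrier.prod (isCompact_univ (X := ℝ≥0∞))
    ).tendsto_subseq (x := fun k => (f (ns k) t₀, ∫⁻ t, S.potential g a t (f (ns k) t) ∂S.mI))
    fun k => ⟨(hf _).mem t₀ ht₀, mem_univ _⟩
  have hlim0 : Tendsto (fun k => f (ns (ms k)) t₀) atTop (𝓝 y₀) :=
    (continuous_fst.tendsto _).comp hlim
  have hlimA : Tendsto (fun k => ∫⁻ t, S.potential g a t (f (ns (ms k)) t) ∂S.mI) atTop (𝓝 A) :=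
    (continuous_snd.tendsto _).comp hlim
  replace hL := hL.comp hms.tendsto_atTop
  replace hw := fun z hz => (hw z hz).comp hms.tendsto_atTop
  obtain ⟨ks, hks⟩ : ∃ ks : ℕ → ℕ, ∀ k, ks k = ns (ms k) := ⟨_, fun _ => rfl⟩
  have hksm : StrictMono ks := by
    have : ks = ns ∘ ms := funext hks
    rw [this]
    exact hns.comp hms
  simp only [Function.comp_def, ← hks] at hL hw hlim0 hlimA
  -- The weak limit is that of the weighted derivatives, so the weight is divided out again.
  obtain ⟨F', hF'⟩ : ∃ F' : ℝ → E3, ∀ t, F' t = (S.derivWeight t)⁻¹ • y t := ⟨_, fun _ => rfl⟩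
  have hFm : AEStronglyMeasurable F' S.mI := by
    rw [funext hF']
    exact measurable_derivWeight.inv.aestronglyMeasurable.smul hy.1
  have hyF : ∀ t ∈ Ioo S.a S.b, S.derivWeight t • F' t = y t := fun t ht => by
    rw [hF', smul_inv_smul₀ (derivWeight_pos ht).ne']
  have hFd : MemLp (fun t => S.derivWeight t • F' t) 2 S.mI := by
    refine (memLp_congr_ae ?_).2 hy
    filter_upwards [ae_restrict_mem measurableSet_Ioo] with t ht using hyF t ht
  have hyF' : ∫ t, ‖S.derivWeight t • F' t‖ ^ 2 ∂S.mI = ∫ t, ‖y t‖ ^ 2 ∂S.mI :=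
    setIntegral_congr_fun measurableSet_Ioo fun t ht => by simp only [hyF t ht]
  have hwF : ∀ z, MemLp z 2 S.mI → Tendsto (fun k => ∫ t, (inner ℝ (S.derivWeight t • f' (ks k) t)
      (z t) : ℝ) ∂S.mI) atTop (𝓝 (∫ t, (inner ℝ (S.derivWeight t • F' t) (z t) : ℝ) ∂S.mI)) :=
    fun z hz => by
      have e : ∫ t, (inner ℝ (S.derivWeight t • F' t) (z t) : ℝ) ∂S.mI =
          ∫ t, (inner ℝ (y t) (z t) : ℝ) ∂S.mI :=
        setIntegral_congr_fun measurableSet_Ioo fun t ht => by simp only [hyF t ht]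
      rw [e]
      exact hw z hz
  have hFi : Integrable (fun t => S.x t * ‖F' t‖ ^ 2) S.mI := by
    obtain ⟨c, C, hc, hC, hb⟩ := S.exists_weight_bounds
    refine Integrable.mono' (((memLp_two_iff_integrable_sq_norm hFd.1).1 hFd).const_mul C)
      (S.continuous_x.aestronglyMeasurable.mul (hFm.norm.pow 2)) ?_
    filter_upwards [ae_restrict_mem measurableSet_Ioo] with t ht
    have hx := S.x_pos ht
    obtain ⟨h1, h2, h3⟩ := hb t (Ioo_subset_Icc_self ht)
    rw [Real.norm_eq_abs, abs_of_nonneg (by positivity), norm_smul, mul_pow, Real.norm_eq_abs,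
      sq_abs, derivWeight_sq ht]
    have h4 : S.x t ≤ C * (S.x t / S.speed t) := by
      rw [mul_div_assoc', le_div_iff₀ (hc.trans_le h1), mul_comm]
      exact mul_le_mul_of_nonneg_right h2 hx.le
    calc S.x t * ‖F' t‖ ^ 2 ≤ C * (S.x t / S.speed t) * ‖F' t‖ ^ 2 := by gcongr
      _ = _ := by ring
  have hconv : ∀ {E : Set ℝ}, MeasurableSet E → E ⊆ Ioo S.a S.b → ∀ {e : ℝ}, 0 < e →
      (∀ t ∈ E, e ≤ S.x t) → Tendsto (fun k => ∫ t in E, f' (ks k) t) atTop (𝓝 (∫ t in E, F' t)) :=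
    fun hE hEs _ he hx => tendsto_setIntegral_of_weak hwF hE hEs he hx
      (fun n => integrableOn_of_weight (hf _).aesm (hf _).integrable_deriv hE hEs he hx)
      (integrableOn_of_weight hFm hFi hE hEs he hx)
  have hIoc : ∀ s ∈ Ioo S.a S.b, ∀ t ∈ Ioo S.a S.b,
      Tendsto (fun k => ∫ r in Ioc s t, f' (ks k) r) atTop (𝓝 (∫ r in Ioc s t, F' r)) := by
    intro s hs t ht
    obtain ⟨e, he, hx⟩ := S.exists_x_lower hs.1 ht.2
    exact hconv measurableSet_Ioc (fun r hr => ⟨hs.1.trans hr.1, hr.2.trans_lt ht.2⟩) he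
      fun r hr => hx r (Ioc_subset_Icc_self hr)
  obtain ⟨F, hF⟩ : ∃ F : ℝ → E3, ∀ t, F t = y₀ + ∫ r in t₀..t, F' r := ⟨_, fun _ => rfl⟩
  have hii : ∀ s ∈ Ioo S.a S.b, ∀ t ∈ Ioo S.a S.b, IntervalIntegrable F' volume s t := by
    refine fun s hs t ht => intervalIntegrable_of_locallyIntegrableOn
      (locallyIntegrableOn_Ioo fun c d hc _ hd => ?_) hs ht
    obtain ⟨e, he, hx⟩ := S.exists_x_lower hc hd
    exact integrableOn_of_weight hFm hFi measurableSet_Icc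
      (fun t ht => ⟨hc.trans_le ht.1, ht.2.trans_lt hd⟩) he hx
  have hFp : IsPrim S.a S.b F F' := ⟨hii, fun s hs t ht => by
    rw [hF, hF, add_sub_add_left_eq_sub,
      intervalIntegral.integral_interval_sub_left (hii _ ht₀ _ ht) (hii _ ht₀ _ hs)]⟩
  -- Values at t are obtained from those at t₀ by integrating the derivatives over a compact
  -- interval away from the axis, where weak convergence suffices. Both orientations are covered by
  -- a difference of integrals over half-open intervals.
  have hpt : ∀ t ∈ Ioo S.a S.b, Tendsto (fun k => f (ks k) t) atTop (𝓝 (F t)) := by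
    intro t ht
    rw [hF]
    have h1 := hlim0.add ((hIoc t₀ ht₀ t ht).sub (hIoc t ht t₀ ht₀))
    refine h1.congr fun k => ?_
    rw [(hf (ks k)).prim.eq_add ht₀ ht]
    rfl
  have hFT : ∀ t ∈ Ioo S.a S.b, F t ∈ T.carrier := fun t ht =>
    T.isClosed_carrier.mem_of_tendsto (hpt t ht) (Eventually.of_forall fun k => (hf _).mem t ht)
  have hFae : AEStronglyMeasurable F S.mI :=
    hFp.continuousOn.aestronglyMeasurable measurableSet_Ioo
  -- Fatou's lemma, with pointwise convergence of the profiles and continuity of the potential.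
  have hpot : ∫⁻ t, S.potential g a t (F t) ∂S.mI ≤ A := by
    have h1 := lintegral_liminf_le' (μ := S.mI) (u := atTop)
      (fun k => aem_potential (hf (ks k)).aesm_fun hg ha)
    rw [hlimA.liminf_eq] at h1
    refine le_trans (lintegral_mono_ae ?_) h1
    filter_upwards [ae_restrict_mem measurableSet_Ioo] with t ht
    have h2 := ((continuous_potential (S := S) g hg a t).tendsto (F t)).comp (hpt t ht)
    exact h2.liminf_eq.ge
  have hA : A ≠ ⊤ := by
    refine ne_top_of_le_ne_top hC' (le_of_tendsto' hlimA fun k => ?_)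
    exact (self_le_add_right _ _).trans (hbd _)
  have hen : S.profileEnergy g a F F' ≤ ENNReal.ofReal (2 * Real.pi) * (A + ENNReal.ofReal L) := by
    rw [profileEnergy_eq hFae hg ha, lintegral_norm_sq hFd, hyF']
    gcongr
  refine ⟨F, F', ⟨hFp, hFm, hFT, fun hS => ?_, ?_⟩, ks, hksm, fun E₀ hE₀ => ?_⟩
  · obtain ⟨e, he, hx⟩ := hS.exists_x_lower
    -- On a torus x is bounded below up to the ends, so the integral of the derivative over the
    -- whole interval passes to the limit and the limit profile closes up.
    have h1 := hconv measurableSet_Ioo Subset.rfl he fun t ht => hx t (Ioo_subset_Icc_self ht)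
    refine tendsto_nhds_unique h1 ?_
    simp only [(hf _).loop hS]
    exact tendsto_const_nhds
  · have h1 : S.profileEnergy g a F F' < ⊤ := hen.trans_lt (ENNReal.mul_lt_top
      ENNReal.ofReal_lt_top (ENNReal.add_lt_top.2 ⟨hA.lt_top, ENNReal.ofReal_lt_top⟩))
    rw [profileEnergy] at h1
    have h2 := ENNReal.lt_top_of_mul_ne_top_right h1.ne hpi
    exact (lintegral_mono fun t => self_le_add_right _ _).trans_lt h2
  · have h1 : Tendsto (fun k => S.profileEnergy g a (f (ks k)) (f' (ks k))) atTop
        (𝓝 (ENNReal.ofReal (2 * Real.pi) * (A + ENNReal.ofReal L))) := by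
      simp only [hEn]
      exact ENNReal.Tendsto.const_mul (hlimA.add ((ENNReal.continuous_ofReal.tendsto L).comp hL))
        (Or.inr ENNReal.ofReal_ne_top)
    rw [tendsto_nhds_unique (hE₀.comp hksm.tendsto_atTop) h1]
    exact hen

/-- The one-dimensional problem is solvable as soon as there is a profile. -/
theorem exists_minimal_profile {f₀ f₀' : ℝ → E3} (h₀ : IsProfile S T f₀ f₀') (hg : Continuous g)
    (ha : ∃ K : ℝ≥0, LipschitzOnWith K a S.carrier)
    (hfin : S.profileEnergy g a f₀ f₀' < ⊤) :
    ∃ f f', IsProfile S T f f' ∧ S.profileEnergy g a f f' < ⊤ ∧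
      ∀ h h', IsProfile S T h h' → S.profileEnergy g a f f' ≤ S.profileEnergy g a h h' := by
  obtain ⟨𝓔, h𝓔⟩ : ∃ 𝓔 : Set ℝ≥0∞,
    ∀ c, c ∈ 𝓔 ↔ ∃ f f', IsProfile S T f f' ∧ S.profileEnergy g a f f' = c := ⟨_, fun _ => Iff.rfl⟩
  obtain ⟨u, hu, hul, hum⟩ := exists_seq_tendsto_sInf (S := 𝓔)
    ⟨_, (h𝓔 _).2 ⟨f₀, f₀', h₀, rfl⟩⟩ (OrderBot.bddBelow _)
  have hlt : sInf 𝓔 < ⊤ := (sInf_le ((h𝓔 _).2 ⟨f₀, f₀', h₀, rfl⟩)).trans_lt hfin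
  obtain ⟨C, hC1, hC2⟩ := exists_between hlt
  obtain ⟨N, hN⟩ := (hul.eventually_lt_const hC1).exists
  choose f f' hf he using fun n => (h𝓔 _).1 (hum n)
  -- The first N members are dropped so that all energies are bounded by a finite constant C above
  -- the infimum.
  obtain ⟨F, F', hF, ns, hns, hle⟩ := exists_profile_limit (fun n => hf (n + N)) hg ha hC2.ne
    fun n => by
      rw [he]
      exact (hu (Nat.le_add_left N n)).trans hN.le
  have hFle := hle (sInf 𝓔) (by
    simp only [he]
    exact (tendsto_add_atTop_iff_nat N).2 hul)
  exact ⟨F, F', hF, hFle.trans_lt hlt, fun h h' hh => hFle.trans (sInf_le ((h𝓔 _).2 ⟨h, h', hh, rfl⟩))⟩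

end RevSurface
end AxialMaps

/-! ### Minimizers: equivariance, structure, and existence of optimal profiles -/

namespace AxialMaps
namespace RevSurface

variable {S T : RevSurface}

/-- Squaring xW > √(2π) brings the hypothesis into the form required by Wirtinger's inequality with
penalty. -/
theorem two_pi_div_lt_of_circWeight {ω : E3 → ℝ≥0} {t : ℝ} (hx : 0 < S.x t)
    (hW : ENNReal.ofReal (Real.sqrt (2 * Real.pi)) < ENNReal.ofReal (S.x t) * S.circWeight ω t) :
    ENNReal.ofReal (2 * Real.pi / S.x t ^ 2) < ∫⁻ φ, (ω (S.param φ t) : ℝ≥0∞) ^ 2 ∂circ := by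
  have h1 := ENNReal.pow_lt_pow_left two_ne_zero hW
  have h2 : S.circWeight ω t ^ 2 = ∫⁻ φ, (ω (S.param φ t) : ℝ≥0∞) ^ 2 ∂circ := by
    rw [circWeight, ← ENNReal.rpow_natCast, ← ENNReal.rpow_mul]
    norm_num
  rw [mul_pow, h2, ← ENNReal.ofReal_pow (Real.sqrt_nonneg _), Real.sq_sqrt two_pi_pos.le,
    ← ENNReal.ofReal_pow hx.le] at h1
  rw [ENNReal.ofReal_div_of_pos (by positivity)]
  exact ENNReal.div_lt_of_lt_mul' h1

/-- Away from the axis and the cut, the coordinates chosen in the definition have the correct t, and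
the angle is correct up to its sine and cosine. -/
theorem symField_param (f : ℝ → E3) (φ : ℝ) {t : ℝ} (ht : t ∈ Ioo S.a S.b) :
    ∃ ψ, Real.cos ψ = Real.cos φ ∧ Real.sin ψ = Real.sin φ ∧
      S.symField f (S.param φ t) = axialRot ψ (f t) ∧
      S.antiField f (S.param φ t) = axialRot (-ψ) (f t) := by
  have h : ∃ p : ℝ × ℝ, p.2 ∈ Icc S.a S.b ∧ S.param φ t = S.param p.1 p.2 :=
    ⟨(φ, t), Ioo_subset_Icc_self ht, rfl⟩
  have hs : h.choose.2 = t := by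
    rcases S.t_eq_of_param_eq (Ioo_subset_Icc_self ht) h.choose_spec.1 h.choose_spec.2 with
      h1 | ⟨-, ⟨h1, -⟩ | ⟨h1, -⟩⟩
    · exact h1.symm
    · exact absurd h1 ht.1.ne'
    · exact absurd h1 ht.2.ne
  obtain ⟨-, -, h2⟩ := S.x_eq_of_param_eq (Ioo_subset_Icc_self ht) h.choose_spec.1 h.choose_spec.2
  obtain ⟨h3, h4⟩ := h2.resolve_left (S.x_pos ht).ne'
  refine ⟨h.choose.1, h3.symm, h4.symm, ?_, ?_⟩
  · rw [symField, dif_pos h, hs]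
  · rw [antiField, dif_pos h, hs]

theorem isField_symField (f : ℝ → E3) : S.IsField 1 f (S.symField f) := by
  intro φ t ht
  obtain ⟨ψ, hc, hs, h, -⟩ := symField_param (S := S) f φ ht
  rw [h, Int.cast_one, one_mul, axialRot, axialRot, hc, hs]

theorem isField_antiField (f : ℝ → E3) : S.IsField (-1) f (S.antiField f) := by
  intro φ t ht
  obtain ⟨ψ, hc, hs, -, h⟩ := symField_param (S := S) f φ ht
  rw [h, Int.cast_neg, Int.cast_one, neg_one_mul, axialRot, axialRot]
  simp only [Real.cos_neg, Real.sin_neg, hc, hs]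

theorem equivariant_one (u : E3 → E3) : S.Equivariant 1 u ↔ S.AxiallySymmetric u := by
  simp only [Equivariant, AxiallySymmetric, Int.cast_one, one_mul]

theorem equivariant_neg_one (u : E3 → E3) : S.Equivariant (-1) u ↔ S.AxiallyAntisymmetric u := by
  simp only [Equivariant, AxiallyAntisymmetric, Int.cast_neg, Int.cast_one, neg_one_mul]

theorem profileEnergy_congr {f h f' : ℝ → E3} (hfh : EqOn h f (Ioo S.a S.b)) (g : ℝ → ℝ≥0)
    (a : E3 → E3) : S.profileEnergy g a h f' = S.profileEnergy g a f f' := by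
  rw [profileEnergy, profileEnergy]
  congr 1
  refine lintegral_congr_ae ?_
  filter_upwards [ae_restrict_mem measurableSet_Ioo] with t ht
  rw [hfh ht, profileDensity, hfh ht, profileDensity]

theorem HasRep.mono {p q : (E3 → E3) → Prop} {m : E3 → E3} (h : S.HasRep T p m)
    (hpq : ∀ u, p u → q u) : S.HasRep T q m := by
  obtain ⟨u, h1, h2, h3⟩ := h
  exact ⟨u, h1, h2, hpq u h3⟩

/-- The field of a profile has an equivariant representative. -/
theorem IsProfile.hasRep {f f' : ℝ → E3} (h : IsProfile S T f f') {σ : ℤ} {m : E3 → E3}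
    (hm : S.IsField σ f m) : S.HasRep T (S.Equivariant σ) m := by
  obtain ⟨F, hFf, hF, hFx, hFl⟩ := h.exists_extension
  have hper : ∀ φ ψ t, Real.cos φ = Real.cos ψ → Real.sin φ = Real.sin ψ →
      axialRot (σ * φ) (F t) = axialRot (σ * ψ) (F t) := by
    intro φ ψ t hc hs
    -- The angles differ by a multiple of 2π, and so do their multiples by the integer σ.
    have hc' : Real.cos (φ - ψ) = 1 := by
      rw [Real.cos_sub, hc, hs]
      nlinarith [Real.sin_sq_add_cos_sq ψ]
    obtain ⟨n, hn⟩ := (Real.cos_eq_one_iff _).1 hc'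
    have e : (σ : ℝ) * φ = σ * ψ + (σ * n : ℤ) * (2 * Real.pi) := by
      push_cast; linear_combination -(σ : ℝ) * hn
    simp only [e, axialRot, Real.cos_add_int_mul_two_pi, Real.sin_add_int_mul_two_pi]
  have haxis : ∀ t ∈ Icc S.a S.b, S.x t = 0 → ∀ φ ψ,
      axialRot (σ * φ) (F t) = axialRot (σ * ψ) (F t) := by
    intro t ht hx φ ψ
    obtain ⟨h0, h1⟩ := hFx t ht hx
    simp only [axialRot, h0, h1, mul_zero, sub_zero, add_zero]
  obtain ⟨u, hu⟩ := S.exists_field (V := fun φ t => axialRot (σ * φ) (F t)) hper haxis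
    fun hS φ => by simp only [hFl hS]
  refine ⟨u, ?_, ?_, ?_⟩
  · refine S.ae_area_iff.2 ?_
    filter_upwards [S.ae_mC_mem] with r hr
    rw [hu _ _ (Ioo_subset_Icc_self hr.2), hm _ _ hr.2, hFf hr.2]
  · rintro _ ⟨φ, t, ht, rfl⟩
    rw [hu _ _ ht]
    exact T.axialRot_mem (hF.2 ht) _
  · rintro φ _ ⟨ψ, t, ht, rfl⟩
    rw [axialRot_param, hu _ _ ht, hu _ _ ht, axialRot_int_mul_add]

section Minimizers

variable {ω : E3 → ℝ≥0} {g : ℝ → ℝ≥0} {a : E3 → E3} {σ : ℤ} {fld : (ℝ → E3) → E3 → E3}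

theorem exists_isProfile_of_energy_lt_top {f : ℝ → E3} (hf : S.MemH1IMap T f)
    (hσ : σ = 1 ∨ σ = -1) {m : E3 → E3} (hm : S.IsField σ f m) (hE : S.energy ω g a m < ⊤) :
    ∃ f', IsProfile S T f f' := by
  refine hf.exists_isProfile hσ hm (lt_of_le_of_lt ?_ hE)
  rw [energy, add_assoc]
  exact self_le_add_right _ _

/-- Minimality among fields with a profile implies minimality. -/
theorem isMinimizer_of_profile {f f' : ℝ → E3} (h : IsProfile S T f f') (hσ : σ = 1 ∨ σ = -1)
    (hae : S.Equivariant σ a) (hω : Measurable ω) (hg : ∃ K : ℝ≥0, LipschitzWith K g)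
    (ha : ∃ K : ℝ≥0, LipschitzOnWith K a S.carrier)
    (hW : ∀ t ∈ Ioo S.a S.b, ENNReal.ofReal (2 * Real.pi / S.x t ^ 2) <
      ∫⁻ φ, (ω (S.param φ t) : ℝ≥0∞) ^ 2 ∂circ)
    {m : E3 → E3} (hm : S.IsField σ f m) (hE : S.energy ω g a m < ⊤)
    (hmin : ∀ h h', IsProfile S T h h' → S.energy ω g a m ≤ S.profileEnergy g a h h') :
    S.IsMinimizer T ω g a m := by
  refine ⟨h.memH1Map hσ hm, hE, fun u hu => ?_⟩
  rcases eq_or_ne (S.energy ω g a u) ⊤ with h1 | h1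
  · rw [h1]; exact le_top
  · obtain ⟨P, Q, hPQ⟩ := MemH1Map.exists_isWeakMap hu
    obtain ⟨k, k', hk, hle⟩ := hPQ.exists_profile_energy_le hae hω hg ha hW (lt_top_iff_ne_top.2 h1)
    exact (hmin k k' hk).trans hle

/-- Fields of optimal profiles are minimizers. -/
theorem IsOptimalProfile.isMinimizer {f : ℝ → E3}
    (hf : S.IsOptimalProfile T (fun f => S.energy ω g a (fld f)) f) (hσ : σ = 1 ∨ σ = -1)
    (hfld : ∀ f, S.IsField σ f (fld f)) (hae : S.Equivariant σ a) (hω : Measurable ω)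
    (hg : ∃ K : ℝ≥0, LipschitzWith K g) (ha : ∃ K : ℝ≥0, LipschitzOnWith K a S.carrier)
    (hW : ∀ t ∈ Ioo S.a S.b, ENNReal.ofReal (2 * Real.pi / S.x t ^ 2) <
      ∫⁻ φ, (ω (S.param φ t) : ℝ≥0∞) ^ 2 ∂circ) :
    S.IsMinimizer T ω g a (fld f) ∧ S.HasRep T (S.Equivariant σ) (fld f) := by
  obtain ⟨hf1, hE, hmin⟩ := hf
  obtain ⟨f', hf'⟩ := exists_isProfile_of_energy_lt_top hf1 hσ (hfld f) hE
  refine ⟨isMinimizer_of_profile hf' hσ hae hω hg ha hW (hfld f) hE fun h h' hh => ?_,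
    hf'.hasRep (hfld f)⟩
  -- Competing profiles live on the open interval only. Their continuous extension is an admissible
  -- competitor in H¹(I, T) of the same energy.
  obtain ⟨H, hHh, hH, -⟩ := hh.exists_extension
  rw [← profileEnergy_congr hHh, ← (hh.congr hHh).energy_field hσ hg ha hae (hfld H) ω]
  exact hmin H hH

/-- The one-dimensional problem has a solution of finite energy, if there is a profile of finite
energy. -/
theorem exists_isOptimalProfile {f₀ f₀' : ℝ → E3} (h₀ : IsProfile S T f₀ f₀')
    (hfin : S.profileEnergy g a f₀ f₀' < ⊤) (hσ : σ = 1 ∨ σ = -1)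
    (hfld : ∀ f, S.IsField σ f (fld f)) (hae : S.Equivariant σ a)
    (hg : ∃ K : ℝ≥0, LipschitzWith K g) (ha : ∃ K : ℝ≥0, LipschitzOnWith K a S.carrier) :
    ∃ f, S.IsOptimalProfile T (fun f => S.energy ω g a (fld f)) f := by
  have hgc : Continuous g := hg.elim fun K hK => hK.continuous
  obtain ⟨f, f', hf, hE, hmin⟩ := exists_minimal_profile h₀ hgc ha hfin
  obtain ⟨F, hFf, hF, -⟩ := hf.exists_extension
  have hFE : S.energy ω g a (fld F) = S.profileEnergy g a f f' := by
    rw [(hf.congr hFf).energy_field hσ hg ha hae (hfld F) ω, profileEnergy_congr hFf]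
  refine ⟨F, hF, by simpa only [hFE] using hE, fun f₁ hf₁ => ?_⟩
  simp only [hFE]
  -- A competitor in H¹(I, T) may have infinite energy, in which case there is nothing to show.
  -- Finite energy makes it a profile, for which minimality is known.
  rcases eq_or_ne (S.energy ω g a (fld f₁)) ⊤ with h1 | h1
  · rw [h1]; exact le_top
  · obtain ⟨f₁', h1'⟩ := exists_isProfile_of_energy_lt_top hf₁ hσ (hfld f₁) (lt_top_iff_ne_top.2 h1)
    rw [h1'.energy_field hσ hg ha hae (hfld f₁) ω]
    exact hmin _ _ h1'

/-- A minimizer gives rise to an equivariant minimizer. -/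
theorem IsMinimizer.exists_equivariant {m : E3 → E3} (hm : S.IsMinimizer T ω g a m)
    (hσ : σ = 1 ∨ σ = -1) (hfld : ∀ f, S.IsField σ f (fld f)) (hae : S.Equivariant σ a)
    (hω : Measurable ω) (hg : ∃ K : ℝ≥0, LipschitzWith K g)
    (ha : ∃ K : ℝ≥0, LipschitzOnWith K a S.carrier)
    (hW : ∀ t ∈ Ioo S.a S.b, ENNReal.ofReal (2 * Real.pi / S.x t ^ 2) <
      ∫⁻ φ, (ω (S.param φ t) : ℝ≥0∞) ^ 2 ∂circ) :
    ∃ u, S.IsMinimizer T ω g a u ∧ S.HasRep T (S.Equivariant σ) u := by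
  obtain ⟨hm1, hE, hmin⟩ := hm
  obtain ⟨P, Q, hPQ⟩ := MemH1Map.exists_isWeakMap hm1
  obtain ⟨f, f', hf, hle⟩ := hPQ.exists_profile_energy_le hae hω hg ha hW hE
  have he := hf.energy_field hσ hg ha hae (hfld f) ω
  refine ⟨fld f, ⟨hf.memH1Map hσ (hfld f), ?_, fun u hu => ?_⟩, hf.hasRep (hfld f)⟩
  · rw [he]; exact hle.trans_lt hE
  · rw [he]; exact hle.trans (hmin u hu)

/-- The structure of minimizers. -/
theorem IsMinimizer.hasRep {m : E3 → E3} (hm : S.IsMinimizer T ω g a m) (hT : T.NeverFlat)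
    (hσ : σ = 1 ∨ σ = -1) (hfld : ∀ f, S.IsField σ f (fld f)) (hae : S.Equivariant σ a)
    (hω : Measurable ω) (hg : ∃ K : ℝ≥0, LipschitzWith K g)
    (ha : ∃ K : ℝ≥0, LipschitzOnWith K a S.carrier)
    (hW : ∀ t ∈ Ioo S.a S.b, ENNReal.ofReal (2 * Real.pi / S.x t ^ 2) <
      ∫⁻ φ, (ω (S.param φ t) : ℝ≥0∞) ^ 2 ∂circ) :
    S.HasRep T (fun u => S.LineSymmetric u ∧
        ∃ (α β : ℝ → EuclideanSpace ℝ (Fin 2)) (η : ℝ → ℝ),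
          S.MemH1I α ∧ S.MemH1I β ∧ S.MemH1I η ∧
          (∀ t ∈ Icc S.a S.b, inner ℝ (β t) (α t) = 0 ∧ ‖β t‖ = ‖α t‖) ∧
          ∀ φ : ℝ, ∀ t ∈ Icc S.a S.b, u (S.param φ t) =
            !₂[Real.cos φ * α t 0 + Real.sin φ * β t 0,
               Real.cos φ * α t 1 + Real.sin φ * β t 1, η t]) m := by
  obtain ⟨hm1, hE, hmin⟩ := hm
  obtain ⟨P, Q, hPQ⟩ := MemH1Map.exists_isWeakMap hm1
  have hae1 := hPQ.ae_of_minimal hae hω hg ha hW hE fun f f' hf => by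
    rw [← hf.energy_field hσ hg ha hae (hfld f) ω]
    exact hmin _ (hf.memH1Map hσ (hfld f))
  obtain ⟨v₀, w₀, hvw⟩ := hPQ.ae_eq_ellipse hae1
  have hfin := ((self_le_add_right _ _).trans
    (hPQ.symm_energy_le (g := g) (a := a) hω hW)).trans_lt hE
  -- On almost every meridian m is the rotated continuous extension of a profile, which has the
  -- required regularity, axis values and periodicity.
  obtain ⟨v, w, hv, hw, hmvw, hmem, haxis, hloop⟩ := exists_ellipse_rep hvw hPQ.mem (by
    filter_upwards [hPQ.ae_profile σ hae g hfin.ne] with φ ⟨f, f', hf, hmf, _⟩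
    obtain ⟨F, hFf, hF, hFx, hFl⟩ := hf.exists_extension
    refine ⟨fun t => axialRot (σ * φ) (F t), hF.1.clm (axialRotCLM (σ * φ)), fun t ht hx => ?_,
      fun hS => by simp only [hFl hS], ?_⟩
    · obtain ⟨h0, h1⟩ := hFx t ht hx
      simp only [axialRot_zero_apply, axialRot_one_apply, h0, h1, mul_zero, sub_zero, add_zero,
        and_self]
    · filter_upwards [hmf, ae_restrict_mem measurableSet_Ioo] with t h1 h2
      rw [h1, hFf h2])
  obtain ⟨u, hu⟩ := S.exists_field (V := fun φ t => ellipse (v t) (w t) φ)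
    (fun φ ψ t hc hs => ellipse_congr hc hs _ _) (fun t ht hx φ ψ => by
      obtain ⟨h1, h2, h3, h4⟩ := haxis t ht hx
      simp only [ellipse, h1, h2, h3, h4, mul_zero]) (fun hS φ => by
      simp only [(hloop hS).1, (hloop hS).2])
  have hcirc := fun t ht => hT.ellipse_circle (hmem t ht)
  refine ⟨u, ?_, ?_, lineSymmetric_of_ellipse hu hcirc, fun t => horizontal (v t),
    fun t => horizontal (w t), fun t => v t 2, hv.clm _, hw.clm _,
    hv.clm (EuclideanSpace.proj (𝕜 := ℝ) 2 : E3 →L[ℝ] ℝ), fun t ht => ?_, fun φ t ht => hu φ t ht⟩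
  · refine S.ae_area_iff.2 ?_
    filter_upwards [S.ae_mC_mem, hmvw] with r hr h
    rw [hu _ _ (Ioo_subset_Icc_self hr.2), h]
  · rintro _ ⟨φ, t, ht, rfl⟩
    rw [hu _ _ ht]
    exact hmem t ht φ
  · obtain ⟨h1, h2⟩ := hcirc t ht
    constructor
    · rw [PiLp.inner_apply, Fin.sum_univ_two]
      simp only [horizontal_zero, horizontal_one, RCLike.inner_apply, conj_trivial]
      linear_combination h1
    · rw [EuclideanSpace.norm_eq, EuclideanSpace.norm_eq, Fin.sum_univ_two, Fin.sum_univ_two]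
      simp only [horizontal_zero, horizontal_one, Real.norm_eq_abs, sq_abs]
      rw [h2]

/-- Either all minimizers are equivariant, or equivariant minimizers coexist with others. -/
theorem minimizer_dichotomy (hT : T.NeverFlat)
    (hσ : σ = 1 ∨ σ = -1) (hfld : ∀ f, S.IsField σ f (fld f)) (hae : S.Equivariant σ a)
    (hω : Measurable ω) (hg : ∃ K : ℝ≥0, LipschitzWith K g)
    (ha : ∃ K : ℝ≥0, LipschitzOnWith K a S.carrier)
    (hW : ∀ t ∈ Ioo S.a S.b, ENNReal.ofReal (2 * Real.pi / S.x t ^ 2) <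
      ∫⁻ φ, (ω (S.param φ t) : ℝ≥0∞) ^ 2 ∂circ) :
    (∀ m, S.IsMinimizer T ω g a m → S.HasRep T (S.Equivariant σ) m) ∨
      ((∃ m, S.IsMinimizer T ω g a m ∧ S.HasRep T (S.Equivariant σ) m) ∧
        ∃ m, S.IsMinimizer T ω g a m ∧ S.HasRep T S.LineSymmetric m ∧
          ¬ S.HasRep T (S.Equivariant σ) m) := by
  by_cases hall : ∀ m, S.IsMinimizer T ω g a m → S.HasRep T (S.Equivariant σ) m
  · exact Or.inl hall
  · push Not at hall
    obtain ⟨m, hm, hn⟩ := hall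
    -- A minimizer that is not equivariant has line symmetry by the structure result, and its
    -- symmetrization along a suitable meridian is the coexisting equivariant minimizer.
    exact Or.inr ⟨hm.exists_equivariant hσ hfld hae hω hg ha hW, m, hm,
      (hm.hasRep hT hσ hfld hae hω hg ha hW).mono fun u hu => hu.1, hn⟩

end Minimizers

/-- A constant map is a profile of finite energy, if its distance to the axis vanishes or the
surface stays away from the axis. -/
theorem isProfile_const {c : E3} (hc : c ∈ T.carrier)
    (h : (∀ t ∈ Icc S.a S.b, 0 < S.x t) ∨ (c 0 = 0 ∧ c 1 = 0)) :
    IsProfile S T (fun _ => c) (fun _ => 0) where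
  prim := ⟨fun _ _ _ _ => intervalIntegrable_const, fun s _ t _ => by simp⟩
  aesm := aestronglyMeasurable_const
  mem _ _ := hc
  loop _ := by simp
  fin := by
    refine Integrable.lintegral_lt_top ?_
    rcases h with h | ⟨h0, h1⟩
    · have hi : IntegrableOn (fun t => (c 0 ^ 2 + c 1 ^ 2) / S.x t ^ 2 * S.areaDensity t)
          (Icc S.a S.b) := by
        refine ContinuousOn.integrableOn_Icc ?_
        exact (continuousOn_const.div (S.continuous_x.continuousOn.pow 2)
          fun t ht => (pow_pos (h t ht) 2).ne').mul S.continuous_areaDensity.continuousOn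
      refine (hi.mono_set Ioo_subset_Icc_self).congr (Eventually.of_forall fun t => ?_)
      simp [profileDensity]
    · refine (integrable_zero _ _ _).congr (Eventually.of_forall fun t => ?_)
      simp [profileDensity, h0, h1]

theorem profileEnergy_const_lt_top {c : E3} (hc : IsProfile S T (fun _ => c) (fun _ => 0))
    {g : ℝ → ℝ≥0} (hg : ∃ K : ℝ≥0, LipschitzWith K g)
    {a : E3 → E3} (ha : ∃ K : ℝ≥0, LipschitzOnWith K a S.carrier) :
    S.profileEnergy g a (fun _ => c) (fun _ => 0) < ⊤ := by
  refine ENNReal.mul_lt_top ENNReal.ofReal_lt_top ?_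
  rw [lintegral_add_left' hc.aemeasurable_density.ennreal_ofReal]
  refine ENNReal.add_lt_top.2 ⟨hc.fin, ?_⟩
  obtain ⟨K, hK⟩ := hg
  have h1 : ContinuousOn (fun t => a (S.curve t)) (Icc S.a S.b) := by
    have h := (continuousOn_comp_curve ha).comp (f := fun t : ℝ => ((0 : ℝ), t)) (s := Icc S.a S.b)
      (by fun_prop) fun t ht => ⟨mem_univ _, ht⟩
    exact h.congr fun t _ => by simp [param_zero]
  have h2 : ContinuousOn (fun t => (g (inner ℝ c (a (S.curve t))) : ℝ) * S.areaDensity t)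
      (Icc S.a S.b) :=
    (NNReal.continuous_coe.comp_continuousOn
      (hK.continuous.comp_continuousOn (continuousOn_const.inner h1))).mul
      S.continuous_areaDensity.continuousOn
  have h3 := (h2.integrableOn_Icc (μ := volume)).mono_set Ioo_subset_Icc_self
  have h4 := h3.lintegral_lt_top
  refine lt_of_eq_of_lt (lintegral_congr fun t => ?_) h4
  rw [ENNReal.ofReal_mul NNReal.zero_le_coe, ENNReal.ofReal_coe_nnreal]

theorem exists_profile_of_axis
    (h : (∀ t ∈ Icc S.a S.b, 0 < S.x t) ∨ (∃ t ∈ Icc T.a T.b, T.x t = 0)) :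
    ∃ c : E3, IsProfile S T (fun _ => c) (fun _ => 0) := by
  rcases h with h | ⟨t, ht, h0⟩
  · exact ⟨_, isProfile_const (T.param_mem 0 (left_mem_Icc.2 T.lt.le)) (Or.inl h)⟩
  · refine ⟨_, isProfile_const (T.param_mem 0 ht) (Or.inr ?_)⟩
    rw [param_zero]
    simp [curve, h0]

/-- Minimizers of the energy and the one-dimensional problem, for fields of one symmetry type. -/
theorem equivariant_minimizers {ω : E3 → ℝ≥0} {g : ℝ → ℝ≥0} {a : E3 → E3} {σ : ℤ}
    {fld : (ℝ → E3) → E3 → E3} (hT : T.NeverFlat) (hσ : σ = 1 ∨ σ = -1)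
    (hfld : ∀ f, S.IsField σ f (fld f)) (hae : S.Equivariant σ a) (hω : Measurable ω)
    (hg : ∃ K : ℝ≥0, LipschitzWith K g) (ha : ∃ K : ℝ≥0, LipschitzOnWith K a S.carrier)
    (hW : ∀ t ∈ Ioo S.a S.b, ENNReal.ofReal (2 * Real.pi / S.x t ^ 2) <
      ∫⁻ φ, (ω (S.param φ t) : ℝ≥0∞) ^ 2 ∂circ) :
    ((∀ m, S.IsMinimizer T ω g a m → S.HasRep T (S.Equivariant σ) m) ∨
      ((∃ m, S.IsMinimizer T ω g a m ∧ S.HasRep T (S.Equivariant σ) m) ∧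
        ∃ m, S.IsMinimizer T ω g a m ∧ S.HasRep T S.LineSymmetric m ∧
          ¬ S.HasRep T (S.Equivariant σ) m)) ∧
    ((∀ t ∈ Icc S.a S.b, 0 < S.x t) ∨ (∃ t ∈ Icc T.a T.b, T.x t = 0) →
      ∃ f, S.IsOptimalProfile T (fun f => S.energy ω g a (fld f)) f) ∧
    ∀ f, S.IsOptimalProfile T (fun f => S.energy ω g a (fld f)) f →
      S.IsMinimizer T ω g a (fld f) ∧ S.HasRep T (S.Equivariant σ) (fld f) := by
  refine ⟨minimizer_dichotomy hT hσ hfld hae hω hg ha hW, fun h => ?_,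
    fun f hf => hf.isMinimizer hσ hfld hae hω hg ha hW⟩
  obtain ⟨c, hc⟩ := exists_profile_of_axis h
  exact exists_isOptimalProfile hc (profileEnergy_const_lt_top hc hg ha) hσ hfld hae hg ha

theorem equivariant_one_eq (S : RevSurface) : S.Equivariant 1 = S.AxiallySymmetric :=
  funext fun u => propext (equivariant_one u)

theorem equivariant_neg_one_eq (S : RevSurface) : S.Equivariant (-1) = S.AxiallyAntisymmetric :=
  funext fun u => propext (equivariant_neg_one u)

end RevSurface
end AxialMaps

end

theorem theorem2 (S T : AxialMaps.RevSurface) (ω : AxialMaps.E3 → ℝ≥0) (hω : Measurable ω)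
    (hsup : (⨆ t ∈ Icc S.a S.b, ENNReal.ofReal (S.x t) * S.circWeight ω t) < ⊤)
    (g : ℝ → ℝ≥0) (hg : ∃ K : ℝ≥0, LipschitzWith K g)
    (a : AxialMaps.E3 → AxialMaps.E3) (ha : ∃ K : ℝ≥0, LipschitzOnWith K a S.carrier)
    (hW : ∀ t ∈ Icc S.a S.b, 0 < S.x t →
      ENNReal.ofReal (Real.sqrt (2 * Real.pi)) < ENNReal.ofReal (S.x t) * S.circWeight ω t)
    (hT : T.NeverFlat) :
    (S.AxiallySymmetric a →
      ((∀ m, S.IsMinimizer T ω g a m → S.HasRep T S.AxiallySymmetric m) ∨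
        ((∃ m, S.IsMinimizer T ω g a m ∧ S.HasRep T S.AxiallySymmetric m) ∧
          ∃ m, S.IsMinimizer T ω g a m ∧ S.HasRep T S.LineSymmetric m ∧
            ¬ S.HasRep T S.AxiallySymmetric m)) ∧
      ((∀ t ∈ Icc S.a S.b, 0 < S.x t) ∨ (∃ t ∈ Icc T.a T.b, T.x t = 0) →
        ∃ f, S.IsOptimalProfile T (fun f => S.energy ω g a (S.symField f)) f) ∧
      (∀ f, S.IsOptimalProfile T (fun f => S.energy ω g a (S.symField f)) f →
        S.IsMinimizer T ω g a (S.symField f) ∧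
          S.HasRep T S.AxiallySymmetric (S.symField f))) ∧
    (S.AxiallyAntisymmetric a →
      ((∀ m, S.IsMinimizer T ω g a m → S.HasRep T S.AxiallyAntisymmetric m) ∨
        ((∃ m, S.IsMinimizer T ω g a m ∧ S.HasRep T S.AxiallyAntisymmetric m) ∧
          ∃ m, S.IsMinimizer T ω g a m ∧ S.HasRep T S.LineSymmetric m ∧
            ¬ S.HasRep T S.AxiallyAntisymmetric m)) ∧
      ((∀ t ∈ Icc S.a S.b, 0 < S.x t) ∨ (∃ t ∈ Icc T.a T.b, T.x t = 0) →
        ∃ f, S.IsOptimalProfile T (fun f => S.energy ω g a (S.antiField f)) f) ∧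
      (∀ f, S.IsOptimalProfile T (fun f => S.energy ω g a (S.antiField f)) f →
        S.IsMinimizer T ω g a (S.antiField f) ∧
          S.HasRep T S.AxiallyAntisymmetric (S.antiField f))) ∧
    (S.AxiallySymmetric a ∨ S.AxiallyAntisymmetric a →
      ∀ m, S.IsMinimizer T ω g a m → S.HasRep T (fun u => S.LineSymmetric u ∧
        ∃ (α β : ℝ → EuclideanSpace ℝ (Fin 2)) (η : ℝ → ℝ),
          S.MemH1I α ∧ S.MemH1I β ∧ S.MemH1I η ∧
          (∀ t ∈ Icc S.a S.b, inner ℝ (β t) (α t) = 0 ∧ ‖β t‖ = ‖α t‖) ∧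
          ∀ φ : ℝ, ∀ t ∈ Icc S.a S.b, u (S.param φ t) =
            !₂[Real.cos φ * α t 0 + Real.sin φ * β t 0,
               Real.cos φ * α t 1 + Real.sin φ * β t 1, η t]) m) := by
  -- The circles over the endpoints form a null set, and x is positive in the interior.
  have hW' : ∀ t ∈ Ioo S.a S.b, ENNReal.ofReal (2 * Real.pi / S.x t ^ 2) <
      ∫⁻ φ, (ω (S.param φ t) : ℝ≥0∞) ^ 2 ∂AxialMaps.circ := fun t ht =>
    AxialMaps.RevSurface.two_pi_div_lt_of_circWeight (S.x_pos ht)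
      (hW t (Ioo_subset_Icc_self ht) (S.x_pos ht))
  -- From here the two symmetry types differ only in the sign σ.
  rw [← S.equivariant_one_eq, ← S.equivariant_neg_one_eq]
  refine ⟨fun hs => ?_, fun hs => ?_, fun hs m hm => ?_⟩
  · exact AxialMaps.RevSurface.equivariant_minimizers hT (Or.inl rfl)
      AxialMaps.RevSurface.isField_symField hs hω hg ha hW'
  · exact AxialMaps.RevSurface.equivariant_minimizers hT (Or.inr rfl)
      AxialMaps.RevSurface.isField_antiField hs hω hg ha hW'
  · rcases hs with hs | hs
    · exact hm.hasRep hT (Or.inl rfl) AxialMaps.RevSurface.isField_symField hs hω hg ha hW'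
    · exact hm.hasRep hT (Or.inr rfl) AxialMaps.RevSurface.isField_antiField hs hω hg ha hW'
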